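/- **Setting.** *Values.* Local values are terms $\mathtt c(\ell_1,\dots,\ell_n)$ over data constructors including $\mathtt{true},\mathtt{false}$; neighbouring values are partial maps $\phi$ from devices to local values. *Expressions* of the field calculus are $$e ::= x \mid v \mid \mathtt{let}\ x=e\ \mathtt{in}\ e \mid f(\bar e)\mid \mathtt{if}(e)\{e\}\{e\}\mid \mathtt{nbr}\{e\}\mid \mathtt{rep}(e)\{(x)\Rightarrow e\}\mid \mathtt{share}(e)\{(x)\Rightarrow e\},$$ where $f$ is a built-in operator or a non-recursive declared function. They have the usual big-step device semantics (device $\delta$, environment $\Theta$ of value-trees aligned by position, sensor state $\sigma$): $\mathtt{rep}$ evaluates its body with $x$ bound to the previous local result on the device (initially the value of its first argument), $\mathtt{share}$ with $x$ bound to the neighbouring value made of the latest results received from the neighbours and of the own previous result (initially the value of its first argument). Networks evolve (infinitely) by the true concurrent semantics: firings, sends, and environment changes (topology and sensors); a filter may discard any stored trees at a firing. *Event structures.* An augmented event structure is a countable set of events $\epsilon$ with devices $d(\epsilon)$ and a neighbouring relation $\rightsquigarrow$ whose transitive closure is a strict order with finitely many predecessors, each event having finitely many receivers, satisfying linearity,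 uniqueness, impersistence and immediacy. It is stabilising with limit the finite reflexive network graph $G$ if the devices of $G$ are those with infinitely many events and, for all but finitely many $\epsilon$, $d(\epsilon)$ is in $G$ and $\{d(\epsilon'):\epsilon'\rightsquigarrow\epsilon\}$ is the set of neighbours of $d(\epsilon)$ in $G$. The firings of an evolution, with $\epsilon'\rightsquigarrow\epsilon$ if $\epsilon$ uses the tree computed by $\epsilon'$, form an event structure. For each device a set of admissible sensor states is fixed (for instance all states, or a single one). Throughout, evolutions are those that follow an augmented event structure with limit $G$, and in which all but finitely many firings read admissible sensor states. An expression *stabilises* to $g$ on $G$ if in each such evolution all but finitely many firings $\epsilon$ produce the value $g(d(\epsilon))$. *Full rounds.* For a set $E_0$ of events let $r(\epsilon)=0$ if $\epsilon\in E_0$ and $r(\epsilon)=1+\min_{\epsilon'\rightsquigarrow\epsilon}r(\epsilon')$ otherwise. By default $E_0$ is the closure under causal predecessors of the finite set of firings whose neighbours are not those in $G$ or whose sensor state is not admissible. An expression stabilises to $g$ *within $n\in\mathbb N\cup\{\infty\}$ full rounds* if in each such evolution every firing $\epsilon$ with $r(\epsilon)>n$ produces $g(d(\epsilon))$ (no requirement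 if $n=\infty$). *Built-in operators.* These are $\mathtt{mux}$, $\mathtt{nbrlt}(x)$ (i.e. $\mathtt{nbr}\{x\}<x$), $\mathtt{minHoodLoc}(\phi,\ell)$ (minimum of $\phi$ updated with $\ell$ on the current device), $\mathtt{localHood}(\phi)=\phi(\delta)$, and arbitrary further partial operators $b$ depending on sensors, device, environment and arguments. The latter are assumed *self-stabilising*: there are a map $g_b$ and a number $c_b\in\mathbb N\cup\{\infty\}$ such that on the restriction to any set of events of any augmented event structure, when this restriction has a limit $G$, and with eventually admissible sensor states, if the arguments stabilise to $s$ then the result of $b$ stabilises to $g_b(G,s)$; and, for any $E_0$ outside of which neighbourhoods, sensors and arguments have their final behaviour, it equals its limit at all events with $r(\epsilon)>c_b$. *The fragment.* The non-equivalent rewriting replaces $\mathtt{rep}(e_1)\{(x)\Rightarrow e_2\}$ by $\mathtt{share}(e_1)\{(x)\Rightarrow e_2[x:=\mathtt{localHood}(x),\ \mathtt{nbr}\{x\}:=x]\}$. Expressions $s$ of the self-stabilising fragment, their translations $s'$, and bounds $n^r(s)\ge n^s(s)$ are generated as follows, where $N$ is the number of devices of $G$, primes denote translations in the fragment, $e',\bar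 e'$ denote the arbitrary expressions $e,\bar e$ with the rewriting applied to any selection of their $\mathtt{rep}$ constructs, a tilde denotes the substitution $[x:=\mathtt{localHood}(x),\mathtt{nbr}\{x\}:=x]$, fragment subexpressions of a pattern do not contain $x$ free, and each bound formula is given for $n=n^r$ and $n=n^s$: * $x,v$: bound $0$. $\mathtt{let}\ x=s_1\ \mathtt{in}\ s_2$: $n(s_1)+n(s_2)$. $b(\bar s)$: $\max n(\bar s)+c_b$, with $c_{\mathtt{nbrlt}}=1$ and $c=0$ for the other three prescribed operators. $f(\bar s)$ with $f$ declared with body $s_0$ in the fragment: $\max n(\bar s)+n(s_0)$. $\mathtt{if}(s_1)\{s_2\}\{s_3\}$: $n(s_1)+1+\max(n(s_2),n(s_3))$. $\mathtt{nbr}\{s\}$: $n(s)+1$. These are translated componentwise. * *Converging:* $\mathtt{rep}(e)\{(x)\Rightarrow f(\mathtt{nbr}\{x\},\mathtt{nbr}\{s\},\bar e)\}$, translated to $\mathtt{share}(e')\{(x)\Rightarrow f(x,\mathtt{nbr}\{s'\},\tilde{\bar e}')\}$. The arguments and results of $f$ belong to a metric space of local values whose set $W$ of distances is well-founded, and $f(\phi,\psi,\bar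 v)$ on device $\delta$ either equals $\psi(\delta)$ or is strictly closer to $\psi(\delta)$ than the maximum of the distances between $\phi(\delta')$ and $\psi(\delta')$. Bounds: $n^r(s)+1+2|W|$ and $n^s(s)+1+|W|$. * *Acyclic:* $\mathtt{rep}(e)\{(x)\Rightarrow f(\mathtt{mux}(\mathtt{nbrlt}(p),\mathtt{nbr}\{x\},s),\bar s)\}$, translated to $\mathtt{share}(e')\{(x)\Rightarrow f(\mathtt{mux}(\mathtt{nbrlt}(p'),x,s'),\bar s')\}$, where $\mathtt{nbrlt}$ refers to a strict partial order and, for admissible sensor states, the result of $f$ depends only on the device, the set of its neighbours and the arguments. Bounds: $\max(n^r(p)+1,n^r(s),n^r(\bar s))+2N$ and $\max(n^s(p)+1,n^s(s),n^s(\bar s))+N$. * *Minimising:* $\mathtt{rep}(e)\{(x)\Rightarrow f^R(\mathtt{minHoodLoc}(f^{MP}(\mathtt{nbr}\{x\},\bar s),s),x,\bar e)\}$, translated to $\mathtt{share}(e')\{(x)\Rightarrow f^R(\mathtt{minHoodLoc}(f^{MP}(x,\bar s'),s'),\mathtt{localHood}(x),\tilde{\bar e}')\}$. Here $<$ and $\vartriangleleft$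 are strict total orders without infinite ascending chains on a set $T$ of local values; $f^{MP}$ promotes pointwise to neighbouring values a function $F(\ell,\bar\ell)$ with values in $T$ which is non-decreasing in $\ell$ and satisfies $\ell<F(\ell,\bar\ell)$ unless $F(\ell,\bar\ell)$ is the maximum of $T$; and $f^R(\ell_1,\ell_2,\bar v)=\ell$ has arguments $\ell_1,\ell_2$ and result in $T$ with (i) $\ell=\ell_1$ if $\ell_1=\ell_2$, (ii) $\ell\ge\min(\ell_1,\ell_2)$, (iii) $\ell_2\vartriangleleft\ell$ or $\ell=\ell_1$. Bounds: $\max(n^r(s),n^r(\bar s))+2|T|+N(2+|T|)$ and $\max(n^s(s),n^s(\bar s))+|T|+N(1+|T|)$. (Infinite $|W|$, $|T|$ give the value $\infty$; an empty list of expressions has bound $0$.) **Theorem.** Assume that every built-in operator is self-stabilising. Let $s$ be a closed expression of the self-stabilising fragment, $s'$ its translation with $\mathtt{share}$, and $G$ a network graph. Then there is a single $g$ such that both $s$ and $s'$ stabilise on $G$ to $g$ (whether or not the bounds are finite); moreover $s$ stabilises within $n^r(s)$ and $s'$ within $n^s(s)$ full rounds of execution, and $n^s(s)\le n^r(s)$.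 -/

import Mathlib

namespace FieldCalculus

open scoped Classical

noncomputable section

/-! ### Values, value-trees, value-tree environments -/

/-- Variable names. -/
abbrev Var := ℕ

/-- Data constructors: the two Booleans, and any further constructors `K`. -/
inductive Con (K : Type) : Type
  | tt
  | ff
  | other (k : K)

/-- Local values `c(ℓ₁, …, ℓₙ)`. -/
inductive Loc (K : Type) : Type
  | mk (c : Con K) (args : List (Loc K))

def Loc.tt {K : Type} : Loc K := .mk .tt []
def Loc.ff {K : Type} : Loc K := .mk .ff []
def Loc.ofBool {K : Type} (c : Bool) : Loc K := if c then Loc.tt else Loc.ff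

/-- A neighbouring value: a partial map from devices to local values. -/
abbrev Field (Dev K : Type) := Dev → Option (Loc K)

/-- Values: local values and neighbouring values. -/
inductive Value (Dev K : Type) : Type
  | loc (l : Loc K)
  | fld (φ : Field Dev K)

def Value.toLoc {Dev K : Type} : Value Dev K → Option (Loc K)
  | .loc l => some l
  | .fld _ => none

/-- The component of a value relative to `δ`; a local value is the same for every device. -/
def Value.at {Dev K : Type} (δ : Dev) : Value Dev K → Option (Loc K)
  | .loc l => some l
  | .fld φ => φ δ

inductive VTree (Dev K : Type) : Type
  | node (v : Value Dev K) (ts : List (VTree Dev K))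

def VTree.root {Dev K : Type} : VTree Dev K → Value Dev K
  | .node v _ => v

def VTree.children {Dev K : Type} : VTree Dev K → List (VTree Dev K)
  | .node _ ts => ts

/-- Value-tree environments. -/
abbrev VEnv (Dev K : Type) := Dev → Option (VTree Dev K)

def VEnv.dom {Dev K : Type} (Θ : VEnv Dev K) : Set Dev := {δ | (Θ δ).isSome}

/-- Alignment with the `i`-th subtree (counted from `0`). -/
def VEnv.proj {Dev K : Type} (i : ℕ) (Θ : VEnv Dev K) : VEnv Dev K :=
  fun δ => (Θ δ).bind fun t => t.children[i]?

/-- Alignment for conditionals: the second subtree, for the trees whose guard evaluated to `l`. -/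
def VEnv.branch {Dev K : Type} (l : Loc K) (Θ : VEnv Dev K) : VEnv Dev K :=
  fun δ => (Θ δ).bind fun t =>
    match t.children with
    | [t₁, t₂] => if t₁.root = .loc l then some t₂ else none
    | _ => none

/-- The neighbouring value made of the roots of the trees (`ρ(Θ)`). -/
def VEnv.roots {Dev K : Type} (Θ : VEnv Dev K) : Field Dev K :=
  fun δ => (Θ δ).bind fun t => t.root.toLoc

/-! ### Syntax -/

/-- A data type together with a strict partial order on data. -/
structure DataOrder (K : Type) where
  carrier : Set (Loc K)
  lt : Loc K → Loc K → Prop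
  irrefl : ∀ a, ¬ lt a a
  trans : ∀ a b c, lt a b → lt b c → lt a c

/-- Built-in operators: the four with a prescribed meaning, and any further ones `B`.
The two that compare data carry the order they refer to. -/
inductive Builtin (K B : Type) : Type
  | mux
  | nbrlt (P : DataOrder K)
  | minHoodLoc (P : DataOrder K)
  | localHood
  | user (b : B)

mutual

/-- Expressions of the field calculus with `share`. -/
inductive Expr (Dev K B : Type) : Type
  | var (x : Var)
  | val (v : Value Dev K)
  | letE (x : Var) (e₁ e₂ : Expr Dev K B)
  | app (f : Fn Dev K B) (es : List (Expr Dev K B))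
  | ite (e₁ e₂ e₃ : Expr Dev K B)
  | nbr (e : Expr Dev K B)
  | rep (e₁ : Expr Dev K B) (x : Var) (e₂ : Expr Dev K B)
  | share (e₁ : Expr Dev K B) (x : Var) (e₂ : Expr Dev K B)

/-- Functions: built-in operators and user-declared functions. A declared function is represented
by its declaration (formal parameters and body), hence there are no recursive declarations. -/
inductive Fn (Dev K B : Type) : Type
  | builtin (b : Builtin K B)
  | decl (xs : List Var) (body : Expr Dev K B)

end

mutual

/-- Free variables. The body of a declared function only sees its own parameters. -/
def Expr.fv {Dev K B : Type} : Expr Dev K B → Set Var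
  | .var x => {x}
  | .val _ => ∅
  | .letE x e₁ e₂ => e₁.fv ∪ (e₂.fv \ {x})
  | .app _ es => Expr.fvList es
  | .ite e₁ e₂ e₃ => e₁.fv ∪ e₂.fv ∪ e₃.fv
  | .nbr e => e.fv
  | .rep e₁ x e₂ => e₁.fv ∪ (e₂.fv \ {x})
  | .share e₁ x e₂ => e₁.fv ∪ (e₂.fv \ {x})

def Expr.fvList {Dev K B : Type} : List (Expr Dev K B) → Set Var
  | [] => ∅
  | e :: es => e.fv ∪ Expr.fvList es

end

/-- Finite assignments of (closed) values to variables. -/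
abbrev Assign (Dev K : Type) := Var → Option (Value Dev K)

def Assign.erase {Dev K : Type} (ρ : Assign Dev K) (x : Var) : Assign Dev K :=
  fun y => if y = x then none else ρ y

def Assign.single {Dev K : Type} (x : Var) (v : Value Dev K) : Assign Dev K :=
  fun y => if y = x then some v else none

def Assign.ofLists {Dev K : Type} : List Var → List (Value Dev K) → Assign Dev K
  | x :: xs, v :: vs => fun y => if y = x then some v else Assign.ofLists xs vs y
  | _, _ => fun _ => none

mutual

/-- Simultaneous substitution of values for free variables. -/
def Expr.subst {Dev K B : Type} (ρ : Assign Dev K) : Expr Dev K B → Expr Dev K B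
  | .var x => match ρ x with
    | some v => .val v
    | none => .var x
  | .val v => .val v
  | .letE x e₁ e₂ => .letE x (e₁.subst ρ) (e₂.subst (ρ.erase x))
  | .app f es => .app f (Expr.substList ρ es)
  | .ite e₁ e₂ e₃ => .ite (e₁.subst ρ) (e₂.subst ρ) (e₃.subst ρ)
  | .nbr e => .nbr (e.subst ρ)
  | .rep e₁ x e₂ => .rep (e₁.subst ρ) x (e₂.subst (ρ.erase x))
  | .share e₁ x e₂ => .share (e₁.subst ρ) x (e₂.subst (ρ.erase x))

def Expr.substList {Dev K B : Type} (ρ : Assign Dev K) : List (Expr Dev K B) → List (Expr Dev K B)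
  | [] => []
  | e :: es => e.subst ρ :: Expr.substList ρ es

end

mutual

/-- `e[x := localHood(x), nbr{x} := x]`, for the free occurrences of `x`. -/
def Expr.toShare {Dev K B : Type} (x : Var) : Expr Dev K B → Expr Dev K B
  | .var y => if y = x then .app (.builtin .localHood) [.var x] else .var y
  | .val v => .val v
  | .letE y e₁ e₂ => .letE y (e₁.toShare x) (if y = x then e₂ else e₂.toShare x)
  | .app f es => .app f (Expr.toShareList x es)
  | .ite e₁ e₂ e₃ => .ite (e₁.toShare x) (e₂.toShare x) (e₃.toShare x)
  | .nbr e => if e = .var x then .var x else .nbr (e.toShare x)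
  | .rep e₁ y e₂ => .rep (e₁.toShare x) y (if y = x then e₂ else e₂.toShare x)
  | .share e₁ y e₂ => .share (e₁.toShare x) y (if y = x then e₂ else e₂.toShare x)

def Expr.toShareList {Dev K B : Type} (x : Var) : List (Expr Dev K B) → List (Expr Dev K B)
  | [] => []
  | e :: es => e.toShare x :: Expr.toShareList x es

end

/-! ### Device semantics -/

/-- Interpretation of the further built-in operators: `b` applied on device `δ`, with sensor
state `σ` and value-tree environment `Θ`, to the given values. Operators are partial
(an ill-typed application has no value). -/
abbrev Interp (Dev K S B : Type) :=
  B → S → Dev → VEnv Dev K → List (Value Dev K) → Option (Value Dev K)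

/-- The local values in the neighbouring value `φ`, updated with `l` for the device `δ`. -/
def minHoodRange {Dev K : Type} (δ : Dev) (φ : Field Dev K) (l : Loc K) : Set (Loc K) :=
  {a | ∃ δ', Function.update φ δ (some l) δ' = some a}

/-- `m` is the minimum of a set of data of the ordered type `P`. -/
def DataOrder.IsMin {K : Type} (P : DataOrder K) (X : Set (Loc K)) (m : Loc K) : Prop :=
  X ⊆ P.carrier ∧ m ∈ X ∧ ∀ a ∈ X, a = m ∨ P.lt m a

def muxOp {Dev K : Type} : List (Value Dev K) → Option (Value Dev K)
  | [.loc c, v, w] => if c = Loc.tt then some v else if c = Loc.ff then some w else none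
  | [.fld β, v, w] => some (.fld fun δ' => (β δ').bind fun c =>
      if c = Loc.tt then v.at δ' else if c = Loc.ff then w.at δ' else none)
  | _ => none

/-- `nbrlt(x)`, i.e. `nbr{x} < x`: the first subtrees in `Θ` hold the neighbours' arguments. -/
def nbrltOp {Dev K : Type} (P : DataOrder K) (δ : Dev) (Θ : VEnv Dev K) :
    List (Value Dev K) → Option (Value Dev K)
  | [.loc l] => some (.fld fun δ' =>
      (Function.update (Θ.proj 0).roots δ (some l) δ').map fun l' => Loc.ofBool (decide (P.lt l' l)))
  | _ => none

def minHoodLocOp {Dev K : Type} (P : DataOrder K) (δ : Dev) :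
    List (Value Dev K) → Option (Value Dev K)
  | [.fld φ, .loc l] =>
      if h : ∃ m, P.IsMin (minHoodRange δ φ l) m then some (.loc h.choose) else none
  | _ => none

def localHoodOp {Dev K : Type} (δ : Dev) : List (Value Dev K) → Option (Value Dev K)
  | [.fld φ] => (φ δ).map .loc
  | _ => none

def builtinOp {Dev K S B : Type} (I : Interp Dev K S B) (b : Builtin K B) (σ : S) (δ : Dev)
    (Θ : VEnv Dev K) (vs : List (Value Dev K)) : Option (Value Dev K) :=
  match b with
  | .mux => muxOp vs
  | .nbrlt P => nbrltOp P δ Θ vs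
  | .minHoodLoc P => minHoodLocOp P δ vs
  | .localHood => localHoodOp δ vs
  | .user b => I b σ δ Θ vs

/-- The domain restriction of a neighbouring value. -/
def Field.restrict {Dev K : Type} (φ : Field Dev K) (D : Set Dev) : Field Dev K :=
  fun δ => if δ ∈ D then φ δ else none

/-- Field update `φ₀[φ₁]`. -/
def Field.override {Dev K : Type} (φ₀ φ₁ : Field Dev K) : Field Dev K :=
  fun δ => (φ₁ δ).or (φ₀ δ)

/-- The field defined on the device `δ` only. -/
def Field.single {Dev K : Type} (δ : Dev) (l : Loc K) : Field Dev K :=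
  fun δ' => if δ' = δ then some l else none

/-- Big-step device semantics: on device `δ`, with respect to the environment `Θ` and the sensor
state `σ`, the expression evaluates to the value-tree. -/
inductive Eval {Dev K S B : Type} (I : Interp Dev K S B) :
    Dev → VEnv Dev K → S → Expr Dev K B → VTree Dev K → Prop
  | loc {δ Θ σ} (l : Loc K) : Eval I δ Θ σ (.val (.loc l)) (.node (.loc l) [])
  | fld {δ Θ σ} (φ : Field Dev K) :
      Eval I δ Θ σ (.val (.fld φ)) (.node (.fld (φ.restrict (Θ.dom ∪ {δ}))) [])
  | letE {δ Θ σ x e₁ e₂ t₁ t₂} :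
      Eval I δ (Θ.proj 0) σ e₁ t₁ →
      Eval I δ (Θ.proj 1) σ (e₂.subst (Assign.single x t₁.root)) t₂ →
      Eval I δ Θ σ (.letE x e₁ e₂) (.node t₂.root [t₁, t₂])
  | bapp {δ Θ σ b v} {es : List (Expr Dev K B)} {ts : List (VTree Dev K)} :
      ts.length = es.length →
      (∀ i e t, es[i]? = some e → ts[i]? = some t → Eval I δ (Θ.proj i) σ e t) →
      builtinOp I b σ δ Θ (ts.map VTree.root) = some v →
      Eval I δ Θ σ (.app (.builtin b) es) (.node v ts)
  | dapp {δ Θ σ xs body t} {es : List (Expr Dev K B)} {ts : List (VTree Dev K)} :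
      ts.length = es.length →
      xs.length = es.length →
      (∀ i e t, es[i]? = some e → ts[i]? = some t → Eval I δ (Θ.proj i) σ e t) →
      Eval I δ (Θ.proj es.length) σ (body.subst (Assign.ofLists xs (ts.map VTree.root))) t →
      Eval I δ Θ σ (.app (.decl xs body) es) (.node t.root (ts ++ [t]))
  | nbr {δ Θ σ e t l} :
      Eval I δ (Θ.proj 0) σ e t →
      t.root = .loc l →
      Eval I δ Θ σ (.nbr e) (.node (.fld (Field.override (Θ.proj 0).roots (Field.single δ l))) [t])
  | rep {δ Θ σ e₁ x e₂ t₁ t₂ l₀ l} :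
      Eval I δ (Θ.proj 0) σ e₁ t₁ →
      (δ ∈ Θ.dom → (Θ.proj 1).roots δ = some l₀) →
      (δ ∉ Θ.dom → t₁.root = .loc l₀) →
      Eval I δ (Θ.proj 1) σ (e₂.subst (Assign.single x (.loc l₀))) t₂ →
      t₂.root = .loc l →
      Eval I δ Θ σ (.rep e₁ x e₂) (.node (.loc l) [t₁, t₂])
  | share {δ Θ σ e₁ x e₂ t₁ t₂ l₁ l} :
      Eval I δ (Θ.proj 0) σ e₁ t₁ →
      t₁.root = .loc l₁ →
      Eval I δ (Θ.proj 1) σ (e₂.subst (Assign.single x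
        (.fld (Field.override (Field.single δ l₁) (Θ.proj 1).roots)))) t₂ →
      t₂.root = .loc l →
      Eval I δ Θ σ (.share e₁ x e₂) (.node (.loc l) [t₁, t₂])
  | ite {δ Θ σ e₁ e₂ e₃ t₁ t} (c : Bool) :
      Eval I δ (Θ.proj 0) σ e₁ t₁ →
      t₁.root = .loc (Loc.ofBool c) →
      Eval I δ (Θ.branch (Loc.ofBool c)) σ (if c then e₂ else e₃) t →
      Eval I δ Θ σ (.ite e₁ e₂ e₃) (.node t.root [t₁, t])

/-- On device `δ`, in the environment `Θ` of the application and with sensor state `σ`, the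
function `f` applied to the values `vs` returns `w`. -/
def Fn.Returns {Dev K S B : Type} (I : Interp Dev K S B) (f : Fn Dev K B) (δ : Dev)
    (Θ : VEnv Dev K) (σ : S) (vs : List (Value Dev K)) (w : Value Dev K) : Prop :=
  match f with
  | .builtin b => builtinOp I b σ δ Θ vs = some w
  | .decl xs body => xs.length = vs.length ∧
      ∃ t, Eval I δ (Θ.proj vs.length) σ (body.subst (Assign.ofLists xs vs)) t ∧ t.root = w

/-! ### Augmented event structures -/

/-- Events with the neighbouring relation (`nb ε' ε` reads `ε' ⤳ ε`) and the device of each. -/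
structure EventStr (Dev : Type) where
  Ev : Type
  nb : Ev → Ev → Prop
  dev : Ev → Dev

namespace EventStr

variable {Dev : Type} (E : EventStr Dev)

/-- Causality. -/
def lt : E.Ev → E.Ev → Prop := Relation.TransGen E.nb

/-- `ε' = next(ε)`. -/
def Next (ε ε' : E.Ev) : Prop :=
  E.nb ε ε' ∧ E.dev ε' = E.dev ε ∧ ∀ ε'', E.nb ε ε'' → E.dev ε'' = E.dev ε → ε'' = ε'

/-- `ε` implicitly precedes `ε'`. -/
def Implicit (ε ε' : E.Ev) : Prop := ∃ ε₁, E.Next ε ε₁ ∧ E.nb ε' ε₁ ∧ ¬ E.nb ε' ε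

structure IsAugmented : Prop where
  countable : Countable E.Ev
  irrefl : ∀ ε, ¬ E.lt ε ε
  finite : ∀ ε, ({ε' | E.lt ε' ε} ∪ {ε' | E.nb ε ε'}).Finite
  linearity : ∀ ε ε₁ ε₂, E.nb ε ε₁ → E.nb ε ε₂ → E.dev ε₁ = E.dev ε → E.dev ε₂ = E.dev ε → ε₁ = ε₂
  uniqueness : ∀ ε ε₁ ε₂, E.nb ε₁ ε → E.nb ε₂ ε → E.dev ε₁ = E.dev ε₂ → ε₁ = ε₂
  impersistence : ∀ ε ε₁ ε₂, E.nb ε ε₁ → E.nb ε ε₂ → E.dev ε₁ = E.dev ε₂ →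
    Relation.ReflTransGen (fun a b => E.Next a b ∧ E.nb ε b) ε₁ ε₂ ∨
    Relation.ReflTransGen (fun a b => E.Next a b ∧ E.nb ε b) ε₂ ε₁
  immediacy : ∀ ε, ¬ Relation.TransGen (fun a c => ∃ b, E.lt a b ∧ E.Implicit b c) ε ε

/-- The restriction to a set of events. -/
def restrict (A : Set E.Ev) : EventStr Dev where
  Ev := A
  nb := fun a b => E.nb a b
  dev := fun a => E.dev a

end EventStr

/-- Network graphs; `adj δ' δ` reads `δ' ↣ δ`. -/
structure NetGraph (Dev : Type) where
  devs : Finset Dev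
  adj : Dev → Dev → Prop
  adj_mem : ∀ δ' δ, adj δ' δ → δ' ∈ devs ∧ δ ∈ devs
  refl : ∀ δ ∈ devs, adj δ δ

namespace EventStr

variable {Dev : Type} (E : EventStr Dev)

/-- The devices of the neighbours of `ε` are the neighbours in `G` of the device of `ε`. -/
def Agrees (G : NetGraph Dev) (ε : E.Ev) : Prop :=
  E.dev ε ∈ G.devs ∧ {δ | ∃ ε', E.nb ε' ε ∧ E.dev ε' = δ} = {δ | G.adj δ (E.dev ε)}

/-- The (infinite) event structure is stabilising with limit `G`. -/
def HasLimit (G : NetGraph Dev) : Prop :=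
  Infinite E.Ev ∧ (∀ δ, δ ∈ G.devs ↔ {ε | E.dev ε = δ}.Infinite) ∧ {ε | ¬ E.Agrees G ε}.Finite

/-- There is a chain `ε₀ ⤳ ⋯ ⤳ ε` with `n` steps from some `ε₀ ∈ E₀`. -/
inductive Chain (E₀ : Set E.Ev) : ℕ → E.Ev → Prop
  | zero {ε} : ε ∈ E₀ → Chain E₀ 0 ε
  | step {n ε' ε} : Chain E₀ n ε' → E.nb ε' ε → Chain E₀ (n + 1) ε

/-- The full round of execution after `E₀` to which an event belongs; see `round_eq`. -/
def round (E₀ : Set E.Ev) (ε : E.Ev) : ℕ∞ := ⨅ (n : ℕ) (_ : E.Chain E₀ n ε), (n : ℕ∞)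

theorem round_eq (E₀ : Set E.Ev) (ε : E.Ev) :
    E.round E₀ ε = if ε ∈ E₀ then 0 else ⨅ (ε' : E.Ev) (_ : E.nb ε' ε), (E.round E₀ ε' + 1) := by
  split_ifs with h
  · exact le_antisymm (iInf₂_le_of_le 0 (Chain.zero h) (by simp)) bot_le
  · apply le_antisymm
    · refine le_iInf₂ fun ε' hε' => ?_
      by_cases hn : ∃ n, E.Chain E₀ n ε'
      · have hne : E.round E₀ ε' ≠ ⊤ := by
          obtain ⟨n, hn⟩ := hn
          exact ne_top_of_le_ne_top (ENat.natCast_ne_top n) (iInf₂_le n hn)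
        obtain ⟨m, hm⟩ := ENat.ne_top_iff_exists.1 hne
        have hc : ∃ n, E.Chain E₀ n ε' ∧ n ≤ m := by
          by_contra hcon
          push Not at hcon
          have : ((m + 1 : ℕ) : ℕ∞) ≤ E.round E₀ ε' :=
            le_iInf₂ fun n hn => by exact_mod_cast hcon n hn
          rw [← hm] at this
          have h2 : m + 1 ≤ m := by exact_mod_cast this
          omega
        obtain ⟨n, hn, hnm⟩ := hc
        refine (iInf₂_le (n + 1) (Chain.step hn hε')).trans ?_
        rw [← hm]
        exact_mod_cast Nat.succ_le_succ hnm
      · have : E.round E₀ ε' = ⊤ := by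
          simp only [round, iInf_eq_top]
          exact fun n hn' => absurd ⟨n, hn'⟩ hn
        simp [this]
    · refine le_iInf₂ fun n hn => ?_
      cases hn with
      | zero h' => exact absurd h' h
      | @step n ε' _ hc hnb =>
        refine (iInf₂_le ε' hnb).trans ?_
        have : E.round E₀ ε' ≤ n := iInf₂_le n hc
        push_cast
        gcongr

/-- The closure of a set of events under causal predecessors. -/
def past (X : Set E.Ev) : Set E.Ev := {ε | ∃ ε' ∈ X, ε = ε' ∨ E.lt ε ε'}

end EventStr

/-! ### Network semantics -/

/-- A value-tree tagged with the transition that computed it (its space-time tag). -/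
structure Msg (Dev K : Type) where
  stamp : ℕ
  tree : VTree Dev K

/-- Tagged value-tree environments, as kept by the devices. -/
abbrev Inbox (Dev K : Type) := Dev → Option (Msg Dev K)

def Inbox.trees {Dev K : Type} (Θ : Inbox Dev K) : VEnv Dev K := fun δ => (Θ δ).map Msg.tree

/-- Network configurations: topology, sensors-map, status field, activation predicate, all being
partial maps from devices. -/
structure Config (Dev K S : Type) where
  topology : Dev → Option (Set Dev)
  sensors : Dev → Option S
  status : Dev → Option (Inbox Dev K)
  active : Dev → Option Bool

def Config.empty {Dev K S : Type} : Config Dev K S :=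
  ⟨fun _ => none, fun _ => none, fun _ => none, fun _ => none⟩

/-- Action labels `δ+`, `δ-`, `env`. The label `δ+` also records the environment that the
filter retained for the firing. -/
inductive Act (Dev K : Type) : Type
  | comp (δ : Dev) (Θ : Inbox Dev K)
  | send (δ : Dev)
  | env

def WellFormedEnv {Dev S : Type} (τ : Dev → Option (Set Dev)) (Sig : Dev → Option S) : Prop :=
  (∀ δ, (τ δ).isSome ↔ (Sig δ).isSome) ∧ ∀ δ X, τ δ = some X → ∀ δ' ∈ X, (Sig δ').isSome

/-- True concurrent network semantics: the `n`-th transition of a network running `e`. The filter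
may clear out any stored trees. -/
inductive Step {Dev K S B : Type} (I : Interp Dev K S B) (e : Expr Dev K B) (n : ℕ) :
    Config Dev K S → Act Dev K → Config Dev K S → Prop
  | comp {N : Config Dev K S} {δ : Dev} {Θ₀ Θ : Inbox Dev K} {σ : S} {t : VTree Dev K} :
      N.active δ = some false →
      N.status δ = some Θ₀ →
      (∀ δ', Θ δ' = Θ₀ δ' ∨ Θ δ' = none) →
      N.sensors δ = some σ →
      Eval I δ Θ.trees σ e t →
      Step I e n N (.comp δ Θ)
        { N with
          status := Function.update N.status δ (some (Function.update Θ δ (some ⟨n, t⟩)))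
          active := Function.update N.active δ (some true) }
  | send {N : Config Dev K S} {δ : Dev} {X : Set Dev} {Θ : Inbox Dev K} {m : Msg Dev K} :
      N.active δ = some true →
      N.topology δ = some X →
      N.status δ = some Θ →
      Θ δ = some m →
      Step I e n N (.send δ)
        { N with
          status := fun δ' => if δ' ∈ X
            then (N.status δ').map fun Θ' => Function.update Θ' δ (some m)
            else N.status δ'
          active := Function.update N.active δ (some false) }
  | env {N : Config Dev K S} {τ : Dev → Option (Set Dev)} {Sig : Dev → Option S} :
      WellFormedEnv τ Sig →
      Step I e n N .env
        { topology := τ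
          sensors := Sig
          status := fun δ => if (τ δ).isSome
            then some ((N.status δ).getD fun _ => none) else none
          active := fun δ => if (τ δ).isSome then some ((N.active δ).getD false) else none }

/-- (Infinite) system evolutions of the program `e`. -/
structure Evolution {Dev K S B : Type} (I : Interp Dev K S B) (e : Expr Dev K B) where
  conf : ℕ → Config Dev K S
  act : ℕ → Act Dev K
  start : conf 0 = Config.empty
  step : ∀ n, Step I e n (conf n) (act n) (conf (n + 1))

namespace Evolution

variable {Dev K S B : Type} {I : Interp Dev K S B} {e : Expr Dev K B} (R : Evolution I e)

/-- The underlying event structure: events are the firings, and `ε' ⤳ ε` if the value-tree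
computed by `ε'` is the one used by `ε` for the device of `ε'`. -/
def events : EventStr Dev where
  Ev := {p : ℕ × Dev × Inbox Dev K // R.act p.1 = .comp p.2.1 p.2.2}
  nb := fun ε' ε => ∃ m, ε.1.2.2 ε'.1.2.1 = some m ∧ m.stamp = ε'.1.1
  dev := fun ε => ε.1.2.1

/-- The sensor state read by the firing. -/
def Reads (ε : R.events.Ev) (σ : S) : Prop := (R.conf ε.1.1).sensors ε.1.2.1 = some σ

/-- The underlying space-time value: the value computed by the firing is `v`. -/
def HasValue (ε : R.events.Ev) (v : Value Dev K) : Prop :=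
  ∃ Θ m, (R.conf (ε.1.1 + 1)).status ε.1.2.1 = some Θ ∧ Θ ε.1.2.1 = some m ∧ m.tree.root = v

/-- Firings whose neighbourhood is not the one in `G`, or whose sensor state is not admissible. -/
def transient (Adm : Dev → Set S) (G : NetGraph Dev) : Set R.events.Ev :=
  {ε | ¬ (R.events.Agrees G ε ∧ ∀ σ, R.Reads ε σ → σ ∈ Adm ε.1.2.1)}

/-- The evolution follows an augmented event structure with limit `G`, with sensor states that are
eventually admissible. -/
def Follows (Adm : Dev → Set S) (G : NetGraph Dev) : Prop :=
  R.events.IsAugmented ∧ R.events.HasLimit G ∧ (R.transient Adm G).Finite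

end Evolution

/-- The expression is stabilising with limit `g` on `G`. -/
def Stabilising {Dev K S B : Type} (I : Interp Dev K S B) (Adm : Dev → Set S) (e : Expr Dev K B)
    (G : NetGraph Dev) (g : Dev → Value Dev K) : Prop :=
  ∀ R : Evolution I e, R.Follows Adm G → {ε | ¬ R.HasValue ε (g (R.events.dev ε))}.Finite

/-- All firings after the first `n` full rounds of execution have the limit value `g`. -/
def StabilisingWithin {Dev K S B : Type} (I : Interp Dev K S B) (Adm : Dev → Set S)
    (e : Expr Dev K B) (G : NetGraph Dev) (g : Dev → Value Dev K) (n : ℕ∞) : Prop :=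
  ∀ R : Evolution I e, R.Follows Adm G → ∀ ε,
    n < R.events.round (R.events.past (R.transient Adm G)) ε → R.HasValue ε (g (R.events.dev ε))

/-! ### Self-stabilising built-in operators -/

/-- `T` is the space-time value-tree of an application of the operator `b` in `E`, with sensor
states `σ` and trees `args` for the arguments. -/
def IsBuiltinRun {Dev K S B : Type} (I : Interp Dev K S B) (b : B) (E : EventStr Dev)
    (σ : E.Ev → S) (args : E.Ev → List (VTree Dev K)) (T : E.Ev → VTree Dev K) : Prop :=
  ∀ ε, ∃ (Θ : VEnv Dev K) (v : Value Dev K),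
    (∀ δ t, Θ δ = some t ↔ ∃ ε', E.nb ε' ε ∧ E.dev ε' = δ ∧ T ε' = t) ∧
    I b (σ ε) (E.dev ε) Θ ((args ε).map VTree.root) = some v ∧ T ε = .node v (args ε)

/-- The operator `b` is self-stabilising, with limit the field function `g G` on each graph `G`:
whenever the arguments are stabilising, so is the result, and its limit is the image of the limits
of the arguments. The event structures are the restrictions of augmented event structures to
subsets of events, on which the branches of conditionals are computed.
Moreover the result settles within `c` full rounds after the arguments, the sensors and the
neighbourhoods (no requirement for `c = ⊤`). -/
def SelfStabilising {Dev K S B : Type} (I : Interp Dev K S B) (Adm : Dev → Set S) (b : B)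
    (g : NetGraph Dev → (Dev → List (Value Dev K)) → Dev → Value Dev K) (c : ℕ∞) : Prop :=
  ∀ (E₁ : EventStr Dev) (A : Set E₁.Ev) (E : EventStr Dev) (G : NetGraph Dev)
    (σ : E.Ev → S) (args : E.Ev → List (VTree Dev K)) (T : E.Ev → VTree Dev K)
    (s : Dev → List (Value Dev K)),
    E₁.IsAugmented → E = E₁.restrict A → E.HasLimit G → {ε | σ ε ∉ Adm (E.dev ε)}.Finite →
    IsBuiltinRun I b E σ args T →
    {ε | (args ε).map VTree.root ≠ s (E.dev ε)}.Finite →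
    {ε | (T ε).root ≠ g G s (E.dev ε)}.Finite ∧
    ∀ E₀ : Set E.Ev,
      (∀ ε, ε ∉ E₀ → E.Agrees G ε ∧ σ ε ∈ Adm (E.dev ε) ∧
        (args ε).map VTree.root = s (E.dev ε)) →
      ∀ ε, c < E.round E₀ ε → (T ε).root = g G s (E.dev ε)

/-! ### Semantic restrictions on the functions in the patterns

Types are represented by sets of local values; functions of a type have no value
on ill-typed arguments. -/

def Field.In {Dev K : Type} (φ : Field Dev K) (X : Set (Loc K)) : Prop :=
  ∀ δ l, φ δ = some l → l ∈ X

/-- The set of distances of a metric on a type. -/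
def distances {K : Type} (X : Set (Loc K)) (m : MetricSpace X) : Set ℝ :=
  {r | ∃ a b : X, r = m.dist a b}

/-- Converging functions `f(φ, ψ, vs)`: the result is `ψ(δ)`, or it is strictly closer to `ψ(δ)`
than the maximal distance of `φ` to `ψ`. -/
def Fn.Converging {Dev K S B : Type} (I : Interp Dev K S B) (f : Fn Dev K B) (X : Set (Loc K))
    (m : MetricSpace X) : Prop :=
  ∀ δ Θ σ φ ψ vs w, f.Returns I δ Θ σ (.fld φ :: .fld ψ :: vs) w →
    φ.In X ∧ ψ.In X ∧ ∃ l p : X, w = .loc l ∧ ψ δ = some p.1 ∧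
      (l = p ∨ ∃ (δ' : Dev) (a q : X), φ δ' = some a.1 ∧ ψ δ' = some q.1 ∧
        m.dist l p < m.dist a q)

/-- The order is total and noetherian (no infinite ascending chain) on `X`. -/
structure TotalNoetherian {K : Type} (X : Set (Loc K)) (r : Loc K → Loc K → Prop) : Prop where
  irrefl : ∀ a ∈ X, ¬ r a a
  trans : ∀ a ∈ X, ∀ b ∈ X, ∀ c ∈ X, r a b → r b c → r a c
  total : ∀ a ∈ X, ∀ b ∈ X, a = b ∨ r a b ∨ r b a
  noetherian : WellFounded fun a b : X => r b a

/-- Monotonic non-decreasing functions of the first argument. -/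
def Monotonic {K : Type} (P : DataOrder K) (F : Loc K → List (Loc K) → Loc K) : Prop :=
  ∀ a ∈ P.carrier, ∀ b ∈ P.carrier, ∀ ls, (a = b ∨ P.lt a b) →
    (F a ls = F b ls ∨ P.lt (F a ls) (F b ls))

/-- Progressive functions: the result is greater than the first argument, or it is the
maximal element of the type. -/
def Progressive {K : Type} (P : DataOrder K) (F : Loc K → List (Loc K) → Loc K) : Prop :=
  ∀ a ∈ P.carrier, ∀ ls, F a ls ∈ P.carrier ∧
    (P.lt a (F a ls) ∨ ∀ b ∈ P.carrier, b = F a ls ∨ P.lt b (F a ls))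

/-- `f(φ, vs)` is the stateless function `F` on local values, promoted to operate pointwise
on neighbouring values. -/
def Fn.Promotes {Dev K S B : Type} (I : Interp Dev K S B) (f : Fn Dev K B) (X : Set (Loc K))
    (F : Loc K → List (Loc K) → Loc K) : Prop :=
  ∀ δ Θ σ φ vs w, f.Returns I δ Θ σ (.fld φ :: vs) w →
    φ.In X ∧ w = .fld fun δ' => (φ δ').bind fun l => (vs.mapM (Value.at δ')).map (F l)

/-- Raising functions `f(ℓ₁, ℓ₂, vs)` with respect to the orders `P` and `tri`. -/
def Fn.Raising {Dev K S B : Type} (I : Interp Dev K S B) (f : Fn Dev K B) (P : DataOrder K)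
    (tri : Loc K → Loc K → Prop) : Prop :=
  ∀ δ Θ σ l₁ l₂ vs w, f.Returns I δ Θ σ (.loc l₁ :: .loc l₂ :: vs) w →
    l₁ ∈ P.carrier ∧ l₂ ∈ P.carrier ∧ ∃ l ∈ P.carrier, w = .loc l ∧
      (l₁ = l₂ → l = l₁) ∧
      ((l₁ = l ∨ P.lt l₁ l) ∨ (l₂ = l ∨ P.lt l₂ l)) ∧
      (tri l₂ l ∨ l = l₁)

/-- The result of `f` only depends on its arguments, on the device and on its set of neighbours
(for admissible sensor states): `f` has no memory and does not access the data of neighbours. -/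
def Fn.Stateless {Dev K S B : Type} (I : Interp Dev K S B) (Adm : Dev → Set S)
    (f : Fn Dev K B) : Prop :=
  ∃ F : Dev → Set Dev → List (Value Dev K) → Value Dev K,
    ∀ δ Θ, ∀ σ ∈ Adm δ, ∀ vs w, f.Returns I δ Θ σ vs w → w = F δ Θ.dom vs

/-! ### The non-equivalent rewriting and the self-stabilising fragment -/

/-- `e'` is obtained from the arbitrary expression `e` by applying the non-equivalent rewriting
`rep(e₁){(x) => e₂} ⟶ share(e₁){(x) => e₂[x := localHood(x), nbr{x} := x]}`
to any number (possibly none) of its `rep` constructs. -/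
inductive Rewriting {Dev K B : Type} : Expr Dev K B → Expr Dev K B → Prop
  | refl (e) : Rewriting e e
  | letE {x e₁ e₂ e₁' e₂'} : Rewriting e₁ e₁' → Rewriting e₂ e₂' →
      Rewriting (.letE x e₁ e₂) (.letE x e₁' e₂')
  | app {f es es'} : List.Forall₂ Rewriting es es' → Rewriting (.app f es) (.app f es')
  | call {xs body body' es es'} : Rewriting body body' → List.Forall₂ Rewriting es es' →
      Rewriting (.app (.decl xs body) es) (.app (.decl xs body') es')
  | ite {e₁ e₂ e₃ e₁' e₂' e₃'} : Rewriting e₁ e₁' → Rewriting e₂ e₂' → Rewriting e₃ e₃' →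
      Rewriting (.ite e₁ e₂ e₃) (.ite e₁' e₂' e₃')
  | nbr {e e'} : Rewriting e e' → Rewriting (.nbr e) (.nbr e')
  | rep {x e₁ e₂ e₁' e₂'} : Rewriting e₁ e₁' → Rewriting e₂ e₂' →
      Rewriting (.rep e₁ x e₂) (.rep e₁' x e₂')
  | share {x e₁ e₂ e₁' e₂'} : Rewriting e₁ e₁' → Rewriting e₂ e₂' →
      Rewriting (.share e₁ x e₂) (.share e₁' x e₂')
  | repShare {x e₁ e₂ e₁' e₂'} : Rewriting e₁ e₁' → Rewriting e₂ e₂' →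
      Rewriting (.rep e₁ x e₂) (.share e₁' x (e₂'.toShare x))

/-- Additional full rounds of execution needed by a built-in operator. -/
def settleOf {K B : Type} (settle : B → ℕ∞) : Builtin K B → ℕ∞
  | .nbrlt _ => 1
  | .user b => settle b
  | _ => 0

mutual

/-- `Fragment I Adm settle N s s' nr ns`: the expression `s` belongs to the self-stabilising
fragment with `rep`, and `s'` is its translation with `share`. The indices `nr`, `ns` are the
bounds, for `s` and `s'` respectively, on the number of full rounds of execution before
stabilisation in networks with at most `N` devices (they do not restrict `s`, `s'`). -/
inductive Fragment {Dev K S B : Type} (I : Interp Dev K S B) (Adm : Dev → Set S)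
    (settle : B → ℕ∞) (N : ℕ) : Expr Dev K B → Expr Dev K B → ℕ∞ → ℕ∞ → Prop
  | var (x) : Fragment I Adm settle N (.var x) (.var x) 0 0
  | val (v) : Fragment I Adm settle N (.val v) (.val v) 0 0
  | letE {x s₁ s₁' s₂ s₂' nr₁ ns₁ nr₂ ns₂} :
      Fragment I Adm settle N s₁ s₁' nr₁ ns₁ →
      Fragment I Adm settle N s₂ s₂' nr₂ ns₂ →
      Fragment I Adm settle N (.letE x s₁ s₂) (.letE x s₁' s₂') (nr₁ + nr₂) (ns₁ + ns₂)
  | builtin (b : Builtin K B) {ss ss' nr ns} :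
      FragmentList I Adm settle N ss ss' nr ns →
      Fragment I Adm settle N (.app (.builtin b) ss) (.app (.builtin b) ss')
        (nr + settleOf settle b) (ns + settleOf settle b)
  | call {xs body body' ss ss' nr₁ ns₁ nr₂ ns₂} :
      FragmentList I Adm settle N ss ss' nr₁ ns₁ →
      Fragment I Adm settle N body body' nr₂ ns₂ →
      Fragment I Adm settle N (.app (.decl xs body) ss) (.app (.decl xs body') ss')
        (nr₁ + nr₂) (ns₁ + ns₂)
  | ite {s₁ s₁' s₂ s₂' s₃ s₃' nr₁ ns₁ nr₂ ns₂ nr₃ ns₃} :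
      Fragment I Adm settle N s₁ s₁' nr₁ ns₁ →
      Fragment I Adm settle N s₂ s₂' nr₂ ns₂ →
      Fragment I Adm settle N s₃ s₃' nr₃ ns₃ →
      Fragment I Adm settle N (.ite s₁ s₂ s₃) (.ite s₁' s₂' s₃')
        (nr₁ + 1 + max nr₂ nr₃) (ns₁ + 1 + max ns₂ ns₃)
  | nbr {s s' nr ns} :
      Fragment I Adm settle N s s' nr ns →
      Fragment I Adm settle N (.nbr s) (.nbr s') (nr + 1) (ns + 1)
  /-- Converging pattern. -/
  | converging {x e e' es es' s s' nr ns} (f : Fn Dev K B) (X : Set (Loc K))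
      (m : MetricSpace X) :
      f.Converging I X m →
      (distances X m).IsWF →
      Fragment I Adm settle N s s' nr ns →
      x ∉ s.fv → x ∉ s'.fv →
      Rewriting e e' → List.Forall₂ Rewriting es es' →
      Fragment I Adm settle N
        (.rep e x (.app f (.nbr (.var x) :: .nbr s :: es)))
        (.share e' x (.app f (.var x :: .nbr s' :: es'.map (Expr.toShare x))))
        (nr + 1 + 2 * (distances X m).encard) (ns + 1 + (distances X m).encard)
  /-- Acyclic pattern, with potential `p`. -/
  | acyclic {x e e' p p' s s' ss ss' nrp nsp nr ns nrl nsl} (f : Fn Dev K B)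
      (P : DataOrder K) :
      f.Stateless I Adm →
      Fragment I Adm settle N p p' nrp nsp →
      Fragment I Adm settle N s s' nr ns →
      FragmentList I Adm settle N ss ss' nrl nsl →
      x ∉ p.fv → x ∉ p'.fv → x ∉ s.fv → x ∉ s'.fv →
      x ∉ Expr.fvList ss → x ∉ Expr.fvList ss' →
      Rewriting e e' →
      Fragment I Adm settle N
        (.rep e x (.app f (.app (.builtin .mux)
          [.app (.builtin (.nbrlt P)) [p], .nbr (.var x), s] :: ss)))
        (.share e' x (.app f (.app (.builtin .mux)
          [.app (.builtin (.nbrlt P)) [p'], .var x, s'] :: ss')))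
        (max (nrp + 1) (max nr nrl) + 2 * N) (max (nsp + 1) (max ns nsl) + N)
  /-- Minimising pattern. -/
  | minimising {x e e' es es' s s' ss ss' nr ns nrl nsl} (fR fMP : Fn Dev K B)
      (P : DataOrder K) (tri : Loc K → Loc K → Prop) (F : Loc K → List (Loc K) → Loc K) :
      TotalNoetherian P.carrier P.lt →
      TotalNoetherian P.carrier tri →
      fMP.Promotes I P.carrier F → Monotonic P F → Progressive P F →
      fR.Raising I P tri →
      Fragment I Adm settle N s s' nr ns →
      FragmentList I Adm settle N ss ss' nrl nsl →
      x ∉ s.fv → x ∉ s'.fv → x ∉ Expr.fvList ss → x ∉ Expr.fvList ss' →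
      Rewriting e e' → List.Forall₂ Rewriting es es' →
      Fragment I Adm settle N
        (.rep e x (.app fR (.app (.builtin (.minHoodLoc P))
          [.app fMP (.nbr (.var x) :: ss), s] :: .var x :: es)))
        (.share e' x (.app fR (.app (.builtin (.minHoodLoc P))
          [.app fMP (.var x :: ss'), s'] :: .app (.builtin .localHood) [.var x] ::
            es'.map (Expr.toShare x))))
        (max nr nrl + 2 * P.carrier.encard + N * (2 + P.carrier.encard))
        (max ns nsl + P.carrier.encard + N * (1 + P.carrier.encard))

/-- Sequences of expressions in the fragment. -/
inductive FragmentList {Dev K S B : Type} (I : Interp Dev K S B) (Adm : Dev → Set S)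
    (settle : B → ℕ∞) (N : ℕ) :
    List (Expr Dev K B) → List (Expr Dev K B) → ℕ∞ → ℕ∞ → Prop
  | nil : FragmentList I Adm settle N [] [] 0 0
  | cons {s s' ss ss' nr ns nrl nsl} :
      Fragment I Adm settle N s s' nr ns →
      FragmentList I Adm settle N ss ss' nrl nsl →
      FragmentList I Adm settle N (s :: ss) (s' :: ss') (max nr nrl) (max ns nsl)

end

end

end FieldCalculus

/-!
Expressions are evaluated on a set `A` of events of an augmented event structure, because the
branches of a conditional are evaluated on the events that take them. Full rounds are counted by
the operator `EventStr.inner`: if something holds on `S`, the events more than `k` full rounds later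
form the `k`-th inner set of `S`. The statement `EventStr.Reach A n S R` says that `R` contains all
but finitely many events of `A`, and that it is reached from `S` within `n` rounds; such
statements compose by adding bounds. An expression *settles* (`Settles`) to a limit within `n` rounds
if the events with the limit value are reached within `n` rounds from those where neighbourhoods,
sensors and free variables have their final values. The theorem follows by induction on the
fragment (`Fragment.settles`): an expression and its translation settle to one and the same limit,
a function of the network and of the limits of the free variables.

The three patterns are treated once for both forms. By `IsLoop.rep` and `IsLoop.share`, each form is
a feedback loop in which a device sees results of its neighbours that are at most `h` rounds old,
with `h = 2` for `rep` and `h = 1` for `share`. The tool for such loops is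
`EventStr.Reach.descent`: if every bad event has a bad ancestor, at most `h` rounds before, of
larger rank in a well-founded set `V`, then there are no bad events after `h * |V|` rounds, and only
finitely many if `V` is infinite (a forest with finitely many roots, finite branching and finite
branches is finite).

* Converging pattern: the rank is the distance to the limit.
* Acyclic pattern: a device settles `h` rounds after those of lower potential, hence after at most
  `h` times as many rounds as there are devices. The limit is defined by recursion on the potential.
* Minimising pattern: the limit solves the equations of shortest paths (`exists_shortest_path`).
  Devices settle in the order of their limits. In turn, the values of the devices that have not
  settled rise to the least remaining limit (`reach_rise`, descent in the values), and then a device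
  with this limit settles (`reach_settle`, descent in the second order); `reach_minimum` adds up
  the rounds.
-/

namespace FieldCalculus

open scoped Classical

noncomputable section

/-! ### Settling in an event structure -/

namespace EventStr

variable {Dev : Type} (E : EventStr Dev) (A : Set E.Ev)

/-- The events of `S` all of whose neighbours in `A` belong to `S`. If the events of `S` are those
where some phenomenon has settled, the `n`-th iterate of this operator consists of the events that
come more than `n` full rounds after those outside `S`. -/
def inner (S : Set E.Ev) : Set E.Ev := {ε | ε ∈ S ∧ ∀ ε' ∈ A, E.nb ε' ε → ε' ∈ S}

theorem inner_subset (S : Set E.Ev) : E.inner A S ⊆ S := fun _ h => h.1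

theorem inner_mono {S S' : Set E.Ev} (h : S ⊆ S') : E.inner A S ⊆ E.inner A S' :=
  fun _ hε => ⟨h hε.1, fun ε' hA hn => h (hε.2 ε' hA hn)⟩

theorem iterate_inner_mono (n : ℕ) {S S' : Set E.Ev} (h : S ⊆ S') :
    (E.inner A)^[n] S ⊆ (E.inner A)^[n] S' := by
  induction n generalizing S S' with
  | zero => exact h
  | succ n ih => exact ih (E.inner_mono A h)

theorem iterate_inner_subset (n : ℕ) (S : Set E.Ev) : (E.inner A)^[n] S ⊆ S := by
  induction n generalizing S with
  | zero => exact subset_rfl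
  | succ n ih => exact (ih _).trans (E.inner_subset A S)

theorem iterate_inner_anti {m n : ℕ} (h : m ≤ n) (S : Set E.Ev) :
    (E.inner A)^[n] S ⊆ (E.inner A)^[m] S := by
  obtain ⟨k, rfl⟩ := Nat.exists_eq_add_of_le h
  rw [Function.iterate_add_apply]
  exact E.iterate_inner_mono A m (E.iterate_inner_subset A k S)

variable {E A}

theorem IsAugmented.finite_succ (hE : E.IsAugmented) (ε : E.Ev) : {ε' | E.nb ε ε'}.Finite :=
  (hE.finite ε).subset Set.subset_union_right

theorem IsAugmented.wellFounded (hE : E.IsAugmented) : WellFounded E.lt := by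
  have hfin : ∀ ε, {ε' | E.lt ε' ε}.Finite := fun ε =>
    (hE.finite ε).subset Set.subset_union_left
  refine Subrelation.wf (r := InvImage (· < ·) fun ε => {ε' | E.lt ε' ε}.ncard) ?_
    (InvImage.wf _ wellFounded_lt)
  intro a b hab
  refine Set.ncard_lt_ncard ?_ (hfin b)
  refine ⟨fun c hc => Relation.TransGen.trans hc hab, fun h => ?_⟩
  exact hE.irrefl a (h hab)

theorem IsAugmented.finite_diff_inner (hE : E.IsAugmented) {S : Set E.Ev} (hS : (A \ S).Finite) :
    (A \ E.inner A S).Finite := by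
  refine (hS.union (hS.biUnion fun ε _ => hE.finite_succ ε)).subset ?_
  rintro ε ⟨hA, hε⟩
  by_cases h : ε ∈ S
  · right
    simp only [inner, Set.mem_ofPred_eq, not_and, not_forall] at hε
    obtain ⟨ε', hA', hn, hS'⟩ := hε h
    exact Set.mem_biUnion (x := ε') ⟨hA', hS'⟩ hn
  · exact Or.inl ⟨hA, h⟩

theorem IsAugmented.finite_diff_iterate (hE : E.IsAugmented) {S : Set E.Ev}
    (hS : (A \ S).Finite) (n : ℕ) : (A \ (E.inner A)^[n] S).Finite := by
  induction n generalizing S with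
  | zero => exact hS
  | succ n ih => exact ih (hE.finite_diff_inner hS)

variable (E A)

/-- `q` is an ancestor of `ε` at most `h` rounds before: `q` belongs to every set whose `h`-th inner set
contains `ε`. This holds when `q` is reached from `ε` by following at most `h` neighbour links
backwards. -/
def Anc (h : ℕ) (q ε : E.Ev) : Prop := ∀ C, ε ∈ (E.inner A)^[h] C → q ∈ C

variable {E A}

theorem Anc.mono {h h' : ℕ} (hh : h ≤ h') {q ε : E.Ev} (hq : E.Anc A h q ε) :
    E.Anc A h' q ε := fun C hC => hq C (E.iterate_inner_anti A hh C hC)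

theorem Anc.of_nb {q ε : E.Ev} (hA : q ∈ A) (h : E.nb q ε) : E.Anc A 1 q ε :=
  fun _ hC => hC.2 q hA h

theorem Anc.of_nb_nb {q ε' ε : E.Ev} (hA : q ∈ A) (hA' : ε' ∈ A) (h' : E.nb q ε')
    (h : E.nb ε' ε) : E.Anc A 2 q ε :=
  fun _ hC => (hC.2 ε' hA' h).2 q hA h'

theorem Anc.eq_or_lt {h : ℕ} {q ε : E.Ev} (hq : E.Anc A h q ε) : q = ε ∨ E.lt q ε := by
  refine hq {q | q = ε ∨ E.lt q ε} ?_
  -- a set closed under causal predecessors is contained in its inner sets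
  have key : ∀ C : Set E.Ev, (∀ a ∈ C, ∀ b, E.nb b a → b ∈ C) → ∀ n, C ⊆ (E.inner A)^[n] C := by
    intro C hC n
    induction n with
    | zero => exact subset_rfl
    | succ n ih =>
      exact ih.trans (E.iterate_inner_mono A n fun a ha => ⟨ha, fun b _ hb => hC a ha b hb⟩)
  refine key _ ?_ h (Or.inl rfl)
  rintro a (rfl | ha) b hb
  · exact Or.inr (Relation.TransGen.single hb)
  · exact Or.inr (Relation.TransGen.head hb ha)

theorem Anc.finite (hE : E.IsAugmented) (h : ℕ) (q : E.Ev) : {ε ∈ A | E.Anc A h q ε}.Finite := by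
  have h1 : (A \ (A \ {q})).Finite := (Set.finite_singleton q).subset (by intro x; simp)
  refine (hE.finite_diff_iterate h1 h).subset ?_
  rintro ε ⟨hA, hε⟩
  exact ⟨hA, fun hC => (hε _ hC).2 rfl⟩

variable (E A)

/-- If `S` is the set of events where the premises of some phenomenon hold, then the phenomenon
holds on `R` and so at all but finitely many events, and within `n` full rounds after `S`
(no bound is claimed for `n = ⊤`). -/
structure Reach (n : ℕ∞) (S R : Set E.Ev) : Prop where
  subset : R ⊆ A
  finite : (A \ R).Finite
  within : ∀ k : ℕ, n ≤ k → (E.inner A)^[k] S ⊆ R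

variable {E A}

namespace Reach

variable {n m : ℕ∞} {S R U : Set E.Ev}

theorem refl (hS : S ⊆ A) (hf : (A \ S).Finite) (n : ℕ∞) : E.Reach A n S S :=
  ⟨hS, hf, fun k _ => E.iterate_inner_subset A k S⟩

theorem iterate (hE : E.IsAugmented) (hS : S ⊆ A) (hf : (A \ S).Finite) (n : ℕ) :
    E.Reach A n S ((E.inner A)^[n] S) :=
  ⟨(E.iterate_inner_subset A n S).trans hS, hE.finite_diff_iterate hf n,
    fun _ hk => E.iterate_inner_anti A (by exact_mod_cast hk) S⟩

theorem trans (h₁ : E.Reach A n S R) (h₂ : E.Reach A m R U) : E.Reach A (n + m) S U := by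
  refine ⟨h₂.subset, h₂.finite, fun k hk => ?_⟩
  have hn : n ≠ ⊤ := by rintro rfl; simp at hk
  have hm : m ≠ ⊤ := by rintro rfl; simp at hk
  lift n to ℕ using hn
  lift m to ℕ using hm
  have hk' : m + n ≤ k := by rw [add_comm]; exact_mod_cast hk
  refine (E.iterate_inner_anti A hk' S).trans ?_
  rw [Function.iterate_add_apply]
  exact (E.iterate_inner_mono A m (h₁.within n le_rfl)).trans (h₂.within m le_rfl)

theorem mono_right (h : E.Reach A n S R) (hRU : R ⊆ U) (hU : U ⊆ A) : E.Reach A n S U :=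
  ⟨hU, h.finite.subset (Set.sdiff_subset_sdiff_right hRU), fun k hk => (h.within k hk).trans hRU⟩

theorem mono (h : E.Reach A n S R) (hnm : n ≤ m) : E.Reach A m S R :=
  ⟨h.subset, h.finite, fun k hk => h.within k (hnm.trans hk)⟩

theorem inter (h₁ : E.Reach A n S R) (h₂ : E.Reach A m S U) :
    E.Reach A (max n m) S (R ∩ U) := by
  refine ⟨fun _ h => h₁.subset h.1, (h₁.finite.union h₂.finite).subset ?_, fun k hk =>
    Set.subset_inter (h₁.within k ((le_max_left _ _).trans hk))
      (h₂.within k ((le_max_right _ _).trans hk))⟩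
  rintro ε ⟨hA, h⟩
  by_cases h' : ε ∈ R
  · exact Or.inr ⟨hA, fun hU => h ⟨h', hU⟩⟩
  · exact Or.inl ⟨hA, h'⟩

theorem inner (hE : E.IsAugmented) (h : E.Reach A n S R) : E.Reach A (n + 1) S (E.inner A R) :=
  h.trans (by simpa using Reach.iterate hE h.subset h.finite 1)

end Reach

/-- The descent argument behind every feedback pattern. Suppose that, from `C` on, a bad event
always has a bad ancestor of larger rank at most `h` rounds before, the ranks lying in a
well-founded set `V`. Walking back from a bad event that comes late after `C` gives a strictly
increasing sequence of ranks, so that after `h * |V|` rounds there is no bad event. If `V` is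
infinite, the bad events still form a finitely branching forest with finitely many roots, and the
well-foundedness of the ranks makes its trees finite. -/
theorem Reach.descent {α : Type*} (hE : E.IsAugmented) {C B : Set E.Ev} (hC : C ⊆ A)
    (hf : (A \ C).Finite) {h : ℕ} (hh : 1 ≤ h) (rank : E.Ev → α) (V : Set α) (lt : α → α → Prop)
    (hV : ∀ ε ∈ B, ε ∈ C → rank ε ∈ V)
    (htrans : ∀ a ∈ V, ∀ b ∈ V, ∀ c ∈ V, lt a b → lt b c → lt a c)
    (hwf : WellFounded fun a b : V => lt a b)
    (hstep : ∀ ε ∈ B, ε ∈ (E.inner A)^[h] C → ∃ q ∈ B, E.Anc A h q ε ∧ lt (rank ε) (rank q)) :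
    E.Reach A (h * V.encard) C (C \ B) := by
  have hirr : ∀ a ∈ V, ¬ lt a a := fun a ha hl =>
    hwf.irrefl.irrefl (⟨a, ha⟩ : V) hl
  refine ⟨fun _ hx => hC hx.1, ?_, ?_⟩
  · -- `p q ε`: the bad event `q` is a possible parent of the bad event `ε` in the forest
    let B' := B ∩ C
    let p : E.Ev → E.Ev → Prop := fun q ε => q ∈ B' ∧ ε ∈ B' ∧ E.Anc A h q ε ∧ lt (rank ε) (rank q)
    have hdesc : ∀ v : V, ∀ q ∈ B', rank q = v → {ε | Relation.ReflTransGen p q ε}.Finite := by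
      intro v
      induction v using hwf.induction with
      | _ v ih =>
        intro q hq hv
        have hch : {ε | p q ε}.Finite :=
          (Anc.finite hE h q).subset fun ε hε => ⟨hC hε.2.1.2, hε.2.2.1⟩
        refine ((Set.finite_singleton q).union (hch.biUnion
          (t := fun ε => {ε' | Relation.ReflTransGen p ε ε'}) fun ε hε => ?_)).subset ?_
        · refine ih ⟨rank ε, hV ε hε.2.1.1 hε.2.1.2⟩ ?_ ε hε.2.1 rfl
          have := hε.2.2.2
          rwa [hv] at this
        · intro ε hε
          rcases Relation.ReflTransGen.cases_head hε with rfl | ⟨c, hc, hcε⟩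
          · exact Or.inl rfl
          · exact Or.inr (Set.mem_biUnion (x := c) hc hcε)
    have hroots : (A \ (E.inner A)^[h] C).Finite := hE.finite_diff_iterate hf h
    -- walking back along causality, every bad event has a root among its ancestors
    have hfrom : ∀ ε ∈ B', ∃ r ∈ B' \ (E.inner A)^[h] C, Relation.ReflTransGen p r ε := by
      intro ε
      induction ε using hE.wellFounded.induction with
      | _ ε ih =>
        intro hε
        by_cases hin : ε ∈ (E.inner A)^[h] C
        · obtain ⟨q, hq, ha, hl⟩ := hstep ε hε.1 hin
          have hqC : q ∈ B' := ⟨hq, ha C hin⟩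
          have hne : E.lt q ε := by
            rcases ha.eq_or_lt with rfl | hlt
            · exact absurd hl (hirr _ (hV _ hε.1 hε.2))
            · exact hlt
          obtain ⟨r, hr, hrq⟩ := ih q hne hqC
          exact ⟨r, hr, hrq.tail ⟨hqC, hε, ha, hl⟩⟩
        · exact ⟨ε, ⟨hε, hin⟩, .refl⟩
    have hfinR : (B' \ (E.inner A)^[h] C).Finite :=
      hroots.subset fun x hx => ⟨hC hx.1.2, hx.2⟩
    refine (hf.union (hfinR.biUnion (t := fun r => {ε | Relation.ReflTransGen p r ε})
      fun r hr => hdesc ⟨rank r, hV r hr.1.1 hr.1.2⟩ r hr.1 rfl)).subset ?_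
    rintro ε ⟨hA, hε⟩
    by_cases hεC : ε ∈ C
    · have hB : ε ∈ B := by by_contra hB; exact hε ⟨hεC, hB⟩
      obtain ⟨r, hr, hrε⟩ := hfrom ε ⟨hB, hεC⟩
      exact Or.inr (Set.mem_biUnion (x := r) hr hrε)
    · exact Or.inl ⟨hA, hεC⟩
  · intro K hK
    have hVfin : V.Finite := by
      by_contra hinf
      rw [Set.encard_eq_top_iff.2 hinf, ENat.mul_top
        (by exact_mod_cast Nat.one_le_iff_ne_zero.1 hh)] at hK
      simp at hK
    -- the ranks met on the way back from a bad event, `h` rounds at a time, are distinct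
    have hchain : ∀ k, ∀ ε ∈ B, ε ∈ (E.inner A)^[h * k] C →
        ∃ F : Finset α, ↑F ⊆ V ∧ F.card = k + 1 ∧ ∀ a ∈ F, a = rank ε ∨ lt (rank ε) a := by
      intro k
      induction k with
      | zero =>
        intro ε hB hε
        exact ⟨{rank ε}, by simpa using hV ε hB hε, by simp, by simp⟩
      | succ k ih =>
        intro ε hB hε
        have hεC : ε ∈ C := E.iterate_inner_subset A _ C hε
        have hε' : ε ∈ (E.inner A)^[h] ((E.inner A)^[h * k] C) := by
          rw [← Function.iterate_add_apply, add_comm]; exact hε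
        obtain ⟨q, hq, ha, hl⟩ := hstep ε hB
          (E.iterate_inner_mono A h (E.iterate_inner_subset A _ C) hε')
        have hqk := ha _ hε'
        have hqC : q ∈ C := E.iterate_inner_subset A _ C hqk
        obtain ⟨F, hFV, hFc, hF⟩ := ih q hq hqk
        have hlt : ∀ a ∈ F, lt (rank ε) a := by
          intro a ha'
          rcases hF a ha' with rfl | h'
          · exact hl
          · exact htrans _ (hV ε hB hεC) _ (hV q hq hqC) _ (hFV ha') hl h'
        refine ⟨insert (rank ε) F, ?_, ?_, ?_⟩
        · intro a ha'
          rcases Finset.mem_insert.1 (Finset.mem_coe.1 ha') with rfl | h'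
          · exact hV ε hB hεC
          · exact hFV h'
        · rw [Finset.card_insert_of_notMem, hFc]
          exact fun hmem => hirr _ (hV ε hB hεC) (hlt _ hmem)
        · intro a ha'
          rcases Finset.mem_insert.1 ha' with rfl | h'
          · exact Or.inl rfl
          · exact Or.inr (hlt a h')
    intro ε hε
    refine ⟨E.iterate_inner_subset A _ C hε, fun hB => ?_⟩
    have hK' : h * V.ncard ≤ K := by
      rw [← hVfin.cast_ncard_eq] at hK; exact_mod_cast hK
    obtain ⟨F, hFV, hFc, -⟩ := hchain V.ncard ε hB (E.iterate_inner_anti A hK' C hε)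
    have := Set.ncard_le_ncard hFV hVfin
    rw [Set.ncard_coe_finset] at this
    omega

end EventStr

/-! ### Neighbours and alignment inside a set of events -/

namespace EventStr

variable {Dev : Type} (E : EventStr Dev) (A : Set E.Ev)

/-- The neighbour of `ε` on the device `δ`, among the events of `A`. -/
def pred (ε : E.Ev) (δ : Dev) : Option E.Ev :=
  if h : ∃ ε' ∈ A, E.nb ε' ε ∧ E.dev ε' = δ then some h.choose else none

variable {E A}

theorem pred_some {ε ε' : E.Ev} {δ : Dev} (h : E.pred A ε δ = some ε') :
    ε' ∈ A ∧ E.nb ε' ε ∧ E.dev ε' = δ := by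
  unfold pred at h
  split_ifs at h with h'
  cases h
  exact h'.choose_spec

theorem IsAugmented.pred_eq (hE : E.IsAugmented) {ε ε' : E.Ev} {δ : Dev} :
    E.pred A ε δ = some ε' ↔ ε' ∈ A ∧ E.nb ε' ε ∧ E.dev ε' = δ := by
  refine ⟨pred_some, fun h => ?_⟩
  have hex : ∃ ε' ∈ A, E.nb ε' ε ∧ E.dev ε' = δ := ⟨ε', h⟩
  have hs := hex.choose_spec
  rw [pred, dif_pos hex, Option.some_inj]
  exact hE.uniqueness ε _ _ hs.2.1 h.2.1 (hs.2.2.trans h.2.2.symm)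

theorem pred_isSome {ε : E.Ev} {δ : Dev} :
    (E.pred A ε δ).isSome ↔ ∃ ε' ∈ A, E.nb ε' ε ∧ E.dev ε' = δ := by
  unfold pred
  split_ifs with h <;> simp [h]

variable (E A)

/-- Within `A`, the devices of the neighbours of `ε` are the neighbours of its device in `G`. -/
def AgreesIn (G : NetGraph Dev) (ε : E.Ev) : Prop :=
  E.dev ε ∈ G.devs ∧ ∀ δ, (E.pred A ε δ).isSome ↔ G.adj δ (E.dev ε)

/-- The restriction to `A` has limit `G`; see `limitIn_iff`. -/
structure LimitIn (G : NetGraph Dev) : Prop where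
  infinite : A.Infinite
  devs : ∀ δ, δ ∈ G.devs ↔ {ε ∈ A | E.dev ε = δ}.Infinite
  agrees : {ε ∈ A | ¬ E.AgreesIn A G ε}.Finite

variable {E A}

theorem restrict_agrees_iff {G : NetGraph Dev} {ε : E.Ev} (hε : ε ∈ A) :
    (E.restrict A).Agrees G ⟨ε, hε⟩ ↔ E.AgreesIn A G ε := by
  unfold Agrees AgreesIn
  refine and_congr Iff.rfl ?_
  rw [Set.ext_iff]
  refine forall_congr' fun δ => ?_
  refine iff_congr ?_ Iff.rfl
  rw [pred_isSome]
  constructor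
  · rintro ⟨ε', h⟩
    exact ⟨ε'.1, ε'.2, h⟩
  · rintro ⟨ε', h, h'⟩
    exact ⟨⟨ε', h⟩, h'⟩

theorem finite_subtype_iff {p : E.Ev → Prop} :
    {ε : A | p ε}.Finite ↔ {ε ∈ A | p ε}.Finite := by
  rw [← Set.finite_image_iff (s := {ε : A | p ε}) Subtype.val_injective.injOn]
  suffices h : Subtype.val '' {ε : A | p ε} = {ε ∈ A | p ε} by rw [h]
  ext ε
  constructor
  · rintro ⟨a, ha, rfl⟩; exact ⟨a.2, ha⟩
  · rintro ⟨h, hp⟩; exact ⟨⟨ε, h⟩, hp, rfl⟩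

theorem limitIn_iff {G : NetGraph Dev} : (E.restrict A).HasLimit G ↔ E.LimitIn A G := by
  have h1 : Infinite (E.restrict A).Ev ↔ A.Infinite := Set.infinite_coe_iff
  have h2 : ∀ δ, {ε | (E.restrict A).dev ε = δ}.Infinite ↔ {ε ∈ A | E.dev ε = δ}.Infinite :=
    fun δ => not_congr (finite_subtype_iff (p := fun ε => E.dev ε = δ))
  have h3 : {ε | ¬ (E.restrict A).Agrees G ε}.Finite ↔ {ε ∈ A | ¬ E.AgreesIn A G ε}.Finite := by
    rw [← finite_subtype_iff (p := fun ε => ¬ E.AgreesIn A G ε)]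
    have : {ε : A | ¬ E.AgreesIn A G ε} = {ε | ¬ (E.restrict A).Agrees G ε} :=
      Set.ext fun ε => not_congr (restrict_agrees_iff ε.2).symm
    rw [this]; rfl
  unfold HasLimit
  rw [h1, h3]
  simp only [h2]
  exact ⟨fun h => ⟨h.1, h.2.1, h.2.2⟩, fun h => ⟨h.1, h.2, h.3⟩⟩

/-- The rounds of the restriction to `A` are counted by iterating `inner`. -/
theorem lt_round_of_iterate {S : Set E.Ev} {k : ℕ} {ε : A} (h : ε.1 ∈ (E.inner A)^[k] S) :
    (k : ℕ∞) < (E.restrict A).round {ε | ε.1 ∉ S} ε := by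
  have key : ∀ n (ε : (E.restrict A).Ev), (E.restrict A).Chain {ε | ε.1 ∉ S} n ε →
      ∀ k, ε.1 ∈ (E.inner A)^[k] S → k < n := by
    intro n ε hc
    induction hc with
    | zero h0 => exact fun k hk => absurd (E.iterate_inner_subset A k S hk) h0
    | @step n ε' ε _ hnb ih =>
      intro k hk
      cases k with
      | zero => omega
      | succ k =>
        rw [Function.iterate_succ_apply'] at hk
        have := ih k (hk.2 ε'.1 ε'.2 hnb)
        omega
  have : ((k + 1 : ℕ) : ℕ∞) ≤ (E.restrict A).round {ε | ε.1 ∉ S} ε :=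
    le_iInf₂ fun n hn => by exact_mod_cast key n ε hn k h
  exact (by exact_mod_cast Nat.lt_succ_self k : (k : ℕ∞) < ((k + 1 : ℕ) : ℕ∞)).trans_le this

theorem iterate_of_lt_round {E₀ : Set E.Ev} {k : ℕ} {ε : E.Ev} (h : (k : ℕ∞) < E.round E₀ ε) :
    ε ∈ (E.inner Set.univ)^[k] E₀ᶜ := by
  have h0 : ∀ ε, 0 < E.round E₀ ε → ε ∈ E₀ᶜ := fun ε h hε => by
    rw [round_eq, if_pos hε] at h; exact lt_irrefl _ h
  induction k generalizing ε with
  | zero => exact h0 ε (by exact_mod_cast h)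
  | succ k ih =>
    rw [Function.iterate_succ_apply']
    refine ⟨ih ((by exact_mod_cast Nat.lt_succ_self k : (k : ℕ∞) < ((k + 1 : ℕ) : ℕ∞)).trans h),
      fun ε' _ hn => ih ?_⟩
    have hε := h0 ε (bot_le.trans_lt h)
    rw [round_eq, if_neg hε] at h
    have h2 := h.trans_le (iInf₂_le ε' hn)
    push_cast at h2
    exact lt_of_add_lt_add_right h2

end EventStr

instance (K : Type) : Inhabited (Loc K) := ⟨Loc.tt⟩
instance (Dev K : Type) : Inhabited (Value Dev K) := ⟨.loc default⟩
instance (Dev K : Type) : Inhabited (VTree Dev K) := ⟨.node default []⟩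

variable {Dev K S B : Type}

/-- The `i`-th subtree, with a default value if there is none. -/
def VTree.child (i : ℕ) (t : VTree Dev K) : VTree Dev K := t.children.getD i default

/-- The value-tree environment of `ε`, when `T` gives the trees of the events of `A`. -/
def envOf (E : EventStr Dev) (A : Set E.Ev) (T : E.Ev → VTree Dev K) (ε : E.Ev) : VEnv Dev K :=
  fun δ => (E.pred A ε δ).map T

variable {E : EventStr Dev}

theorem envOf_proj {A : Set E.Ev} {T T' : E.Ev → VTree Dev K} {i : ℕ}
    (h : ∀ ε ∈ A, (T ε).children[i]? = some (T' ε)) (ε : E.Ev) :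
    (envOf E A T ε).proj i = envOf E A T' ε := by
  funext δ
  unfold VEnv.proj envOf
  cases hp : E.pred A ε δ with
  | none => rfl
  | some ε' => simpa using h ε' (EventStr.pred_some hp).1

theorem envOf_roots {A : Set E.Ev} {T : E.Ev → VTree Dev K} {y : E.Ev → Loc K}
    (h : ∀ ε ∈ A, (T ε).root = .loc (y ε)) (ε : E.Ev) (δ : Dev) :
    (envOf E A T ε).roots δ = (E.pred A ε δ).map y := by
  unfold VEnv.roots envOf
  cases hp : E.pred A ε δ with
  | none => rfl
  | some ε' => simp [h ε' (EventStr.pred_some hp).1, Value.toLoc]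

theorem mem_envOf_dom {A : Set E.Ev} {T : E.Ev → VTree Dev K} {ε : E.Ev} {δ : Dev} :
    δ ∈ (envOf E A T ε).dom ↔ (E.pred A ε δ).isSome := by
  simp [VEnv.dom, envOf]

theorem envOf_dom_of_agrees {A : Set E.Ev} {T : E.Ev → VTree Dev K} {G : NetGraph Dev} {ε : E.Ev}
    (h : E.AgreesIn A G ε) : (envOf E A T ε).dom = {δ | G.adj δ (E.dev ε)} :=
  Set.ext fun δ => mem_envOf_dom.trans (h.2 δ)

/-- Alignment in the branch of a conditional amounts to restricting the set of events. -/
theorem envOf_branch (hE : E.IsAugmented) {A : Set E.Ev} {T T₁ T₂ : E.Ev → VTree Dev K}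
    (h : ∀ ε ∈ A, (T ε).children = [T₁ ε, T₂ ε]) (l : Loc K) (ε : E.Ev) :
    (envOf E A T ε).branch l = envOf E {ε ∈ A | (T₁ ε).root = .loc l} T₂ ε := by
  funext δ
  unfold VEnv.branch envOf
  cases hp : E.pred A ε δ with
  | none =>
    have : E.pred {ε ∈ A | (T₁ ε).root = .loc l} ε δ = none := by
      rw [← Option.not_isSome_iff_eq_none, EventStr.pred_isSome] at hp ⊢
      rintro ⟨ε', h1, h2⟩
      exact hp ⟨ε', h1.1, h2⟩
    simp [this]
  | some ε' =>
    have hp' := EventStr.pred_some hp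
    by_cases hl : (T₁ ε').root = .loc l
    · have : E.pred {ε ∈ A | (T₁ ε).root = .loc l} ε δ = some ε' :=
        hE.pred_eq.2 ⟨⟨hp'.1, hl⟩, hp'.2⟩
      simp [this, h ε' hp'.1, hl]
    · have : E.pred {ε ∈ A | (T₁ ε).root = .loc l} ε δ = none := by
        rw [← Option.not_isSome_iff_eq_none, EventStr.pred_isSome]
        rintro ⟨ε'', h1, h2⟩
        have := hE.uniqueness ε _ _ h2.1 hp'.2.1 (h2.2.trans hp'.2.2.symm)
        exact hl (this ▸ h1.2)
      simp [this, h ε' hp'.1, hl]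

/-! ### Substitution -/

/-- The assignment `ρ` with `x` set to `v`. -/
def Assign.set (ρ : Assign Dev K) (x : Var) (v : Value Dev K) : Assign Dev K :=
  fun y => if y = x then some v else ρ y

/-- The assignment `τ` for the variables that `ρ` leaves free. -/
def Assign.orElse (ρ τ : Assign Dev K) : Assign Dev K := fun y => (ρ y).or (τ y)

theorem Assign.erase_orElse_single (ρ : Assign Dev K) (x : Var) (v : Value Dev K) :
    (ρ.erase x).orElse (Assign.single x v) = ρ.set x v := by
  funext y
  by_cases h : y = x <;> simp [orElse, erase, single, set, h]

theorem Assign.erase_orElse (ρ τ : Assign Dev K) (x : Var) :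
    (ρ.orElse τ).erase x = (ρ.erase x).orElse (τ.erase x) := by
  funext y
  by_cases h : y = x <;> simp [orElse, erase, h]

mutual

theorem Expr.subst_subst (ρ τ : Assign Dev K) :
    ∀ e : Expr Dev K B, (e.subst ρ).subst τ = e.subst (ρ.orElse τ)
  | .var x => by
    cases h : ρ x <;> simp [Expr.subst, h, Assign.orElse]
  | .val v => by simp [Expr.subst]
  | .letE x e₁ e₂ => by
    simp [Expr.subst, Expr.subst_subst _ _ e₁, Expr.subst_subst _ _ e₂, Assign.erase_orElse]
  | .app f es => by simp [Expr.subst, Expr.substList_substList _ _ es]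
  | .ite e₁ e₂ e₃ => by
    simp [Expr.subst, Expr.subst_subst _ _ e₁, Expr.subst_subst _ _ e₂, Expr.subst_subst _ _ e₃]
  | .nbr e => by simp [Expr.subst, Expr.subst_subst _ _ e]
  | .rep e₁ x e₂ => by
    simp [Expr.subst, Expr.subst_subst _ _ e₁, Expr.subst_subst _ _ e₂, Assign.erase_orElse]
  | .share e₁ x e₂ => by
    simp [Expr.subst, Expr.subst_subst _ _ e₁, Expr.subst_subst _ _ e₂, Assign.erase_orElse]

theorem Expr.substList_substList (ρ τ : Assign Dev K) :
    ∀ es : List (Expr Dev K B),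
      Expr.substList τ (Expr.substList ρ es) = Expr.substList (ρ.orElse τ) es
  | [] => by simp [Expr.substList]
  | e :: es => by
    simp [Expr.substList, Expr.subst_subst _ _ e, Expr.substList_substList _ _ es]

end

theorem Expr.subst_erase_single (e : Expr Dev K B) (ρ : Assign Dev K) (x : Var)
    (v : Value Dev K) : (e.subst (ρ.erase x)).subst (Assign.single x v) = e.subst (ρ.set x v) := by
  rw [Expr.subst_subst, Assign.erase_orElse_single]

theorem Assign.erase_congr {ρ τ : Assign Dev K} {s : Set Var} {x : Var}
    (h : ∀ y ∈ s \ {x}, ρ y = τ y) : ∀ y ∈ s, ρ.erase x y = τ.erase x y := by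
  intro y hy
  by_cases hx : y = x
  · simp [Assign.erase, hx]
  · simpa [Assign.erase, hx] using h y ⟨hy, hx⟩

mutual

theorem Expr.subst_congr : ∀ (e : Expr Dev K B) {ρ τ : Assign Dev K},
    (∀ y ∈ e.fv, ρ y = τ y) → e.subst ρ = e.subst τ
  | .var x, ρ, τ, h => by simp [Expr.subst, h x (by simp [Expr.fv])]
  | .val v, _, _, _ => by simp [Expr.subst]
  | .letE x e₁ e₂, ρ, τ, h => by
    simp only [Expr.fv] at h
    simp [Expr.subst, Expr.subst_congr e₁ fun y hy => h y (Or.inl hy),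
      Expr.subst_congr e₂ (Assign.erase_congr fun y hy => h y (Or.inr hy))]
  | .app f es, ρ, τ, h => by
    simp only [Expr.fv] at h
    simp [Expr.subst, Expr.substList_congr es h]
  | .ite e₁ e₂ e₃, ρ, τ, h => by
    simp only [Expr.fv] at h
    simp [Expr.subst, Expr.subst_congr e₁ fun y hy => h y (Or.inl (Or.inl hy)),
      Expr.subst_congr e₂ fun y hy => h y (Or.inl (Or.inr hy)),
      Expr.subst_congr e₃ fun y hy => h y (Or.inr hy)]
  | .nbr e, ρ, τ, h => by
    simp only [Expr.fv] at h
    simp [Expr.subst, Expr.subst_congr e h]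
  | .rep e₁ x e₂, ρ, τ, h => by
    simp only [Expr.fv] at h
    simp [Expr.subst, Expr.subst_congr e₁ fun y hy => h y (Or.inl hy),
      Expr.subst_congr e₂ (Assign.erase_congr fun y hy => h y (Or.inr hy))]
  | .share e₁ x e₂, ρ, τ, h => by
    simp only [Expr.fv] at h
    simp [Expr.subst, Expr.subst_congr e₁ fun y hy => h y (Or.inl hy),
      Expr.subst_congr e₂ (Assign.erase_congr fun y hy => h y (Or.inr hy))]

theorem Expr.substList_congr : ∀ (es : List (Expr Dev K B)) {ρ τ : Assign Dev K},
    (∀ y ∈ Expr.fvList es, ρ y = τ y) → Expr.substList ρ es = Expr.substList τ es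
  | [], _, _, _ => by simp [Expr.substList]
  | e :: es, ρ, τ, h => by
    simp only [Expr.fvList] at h
    simp [Expr.substList, Expr.subst_congr e fun y hy => h y (Or.inl hy),
      Expr.substList_congr es fun y hy => h y (Or.inr hy)]

end

theorem Expr.subst_set (e : Expr Dev K B) {x : Var} (hx : x ∉ e.fv) (ρ : Assign Dev K)
    (v : Value Dev K) : e.subst (ρ.set x v) = e.subst ρ :=
  Expr.subst_congr e fun y hy => if_neg (by rintro rfl; exact hx hy)

theorem Expr.substList_set (es : List (Expr Dev K B)) {x : Var} (hx : x ∉ Expr.fvList es)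
    (ρ : Assign Dev K) (v : Value Dev K) :
    Expr.substList (ρ.set x v) es = Expr.substList ρ es :=
  Expr.substList_congr es fun y hy => if_neg (by rintro rfl; exact hx hy)

theorem Assign.erase_empty (x : Var) :
    Assign.erase (fun _ => none : Assign Dev K) x = fun _ => none := by
  funext y; simp [Assign.erase]

mutual

theorem Expr.subst_empty : ∀ e : Expr Dev K B, e.subst (fun _ => none) = e
  | .var x => by simp [Expr.subst]
  | .val v => by simp [Expr.subst]
  | .letE x e₁ e₂ => by
    simp [Expr.subst, Expr.subst_empty e₁, Assign.erase_empty, Expr.subst_empty e₂]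
  | .app f es => by simp [Expr.subst, Expr.substList_empty es]
  | .ite e₁ e₂ e₃ => by
    simp [Expr.subst, Expr.subst_empty e₁, Expr.subst_empty e₂, Expr.subst_empty e₃]
  | .nbr e => by simp [Expr.subst, Expr.subst_empty e]
  | .rep e₁ x e₂ => by
    simp [Expr.subst, Expr.subst_empty e₁, Assign.erase_empty, Expr.subst_empty e₂]
  | .share e₁ x e₂ => by
    simp [Expr.subst, Expr.subst_empty e₁, Assign.erase_empty, Expr.subst_empty e₂]

theorem Expr.substList_empty : ∀ es : List (Expr Dev K B), Expr.substList (fun _ => none) es = es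
  | [] => by simp [Expr.substList]
  | e :: es => by simp [Expr.substList, Expr.subst_empty e, Expr.substList_empty es]

end

variable {I : Interp Dev K S B}

/-! ### Inversion of the device semantics -/

theorem children_eq_of_length {t : VTree Dev K} {ts : List (VTree Dev K)} (i : ℕ)
    (h : t.children = ts) (hi : i < ts.length) : t.children[i]? = some (t.child i) := by
  subst h
  simp [VTree.child, List.getD, List.getElem?_eq_getElem hi]

section Inversion

variable {δ : Dev} {Θ : VEnv Dev K} {σ : S} {t : VTree Dev K}

theorem Eval.val_loc_inv {l : Loc K} (h : Eval I δ Θ σ (.val (.loc l) : Expr Dev K B) t) :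
    t.root = .loc l := by
  cases h; rfl

theorem Eval.val_fld_inv {φ : Field Dev K} (h : Eval I δ Θ σ (.val (.fld φ) : Expr Dev K B) t) :
    t.root = .fld (φ.restrict (Θ.dom ∪ {δ})) := by
  cases h; rfl

theorem Eval.letE_inv {x : Var} {e₁ e₂ : Expr Dev K B} (h : Eval I δ Θ σ (.letE x e₁ e₂) t) :
    t.children = [t.child 0, t.child 1] ∧ Eval I δ (Θ.proj 0) σ e₁ (t.child 0) ∧
      Eval I δ (Θ.proj 1) σ (e₂.subst (Assign.single x (t.child 0).root)) (t.child 1) ∧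
      t.root = (t.child 1).root := by
  cases h with
  | letE h₁ h₂ => exact ⟨rfl, h₁, h₂, rfl⟩

theorem Eval.nbr_inv {e : Expr Dev K B} (h : Eval I δ Θ σ (.nbr e) t) :
    ∃ l, t.children = [t.child 0] ∧ Eval I δ (Θ.proj 0) σ e (t.child 0) ∧
      (t.child 0).root = .loc l ∧
      t.root = .fld (Field.override (Θ.proj 0).roots (Field.single δ l)) := by
  cases h with
  | nbr h₁ h₂ => exact ⟨_, rfl, h₁, h₂, rfl⟩

theorem Eval.rep_inv {x : Var} {e₁ e₂ : Expr Dev K B} (h : Eval I δ Θ σ (.rep e₁ x e₂) t) :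
    ∃ l₀ l, t.children = [t.child 0, t.child 1] ∧
      (δ ∈ Θ.dom → (Θ.proj 1).roots δ = some l₀) ∧
      Eval I δ (Θ.proj 1) σ (e₂.subst (Assign.single x (.loc l₀))) (t.child 1) ∧
      (t.child 1).root = .loc l ∧ t.root = .loc l := by
  cases h with
  | rep h₁ h₂ h₃ h₄ h₅ => exact ⟨_, _, rfl, h₂, h₄, h₅, rfl⟩

theorem Eval.share_inv {x : Var} {e₁ e₂ : Expr Dev K B} (h : Eval I δ Θ σ (.share e₁ x e₂) t) :
    ∃ l₁ l, t.children = [t.child 0, t.child 1] ∧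
      Eval I δ (Θ.proj 1) σ (e₂.subst (Assign.single x
        (.fld (Field.override (Field.single δ l₁) (Θ.proj 1).roots)))) (t.child 1) ∧
      (t.child 1).root = .loc l ∧ t.root = .loc l := by
  cases h with
  | share h₁ h₂ h₃ h₄ => exact ⟨_, _, rfl, h₃, h₄, rfl⟩

theorem Eval.ite_inv {e₁ e₂ e₃ : Expr Dev K B} (h : Eval I δ Θ σ (.ite e₁ e₂ e₃) t) :
    t.children = [t.child 0, t.child 1] ∧ t.root = (t.child 1).root ∧
      Eval I δ (Θ.proj 0) σ e₁ (t.child 0) ∧ ∃ c : Bool, (t.child 0).root = .loc (Loc.ofBool c) ∧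
      Eval I δ (Θ.branch (Loc.ofBool c)) σ (if c then e₂ else e₃) (t.child 1) := by
  cases h with
  | ite c h₁ h₂ h₃ => exact ⟨rfl, rfl, h₁, c, h₂, h₃⟩

theorem Eval.app_inv {f : Fn Dev K B} {es : List (Expr Dev K B)}
    (h : Eval I δ Θ σ (.app f es) t) :
    ∃ ts, ts.length = es.length ∧ ts <+: t.children ∧
      (∀ i e t, es[i]? = some e → ts[i]? = some t → Eval I δ (Θ.proj i) σ e t) ∧
      f.Returns I δ Θ σ (ts.map VTree.root) t.root := by
  cases h with
  | @bapp _ _ _ _ _ ts h₁ h₂ h₃ => exact ⟨ts, h₁, List.prefix_rfl, h₂, h₃⟩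
  | @dapp _ _ _ _ t _ ts h₁ h₂ h₃ h₄ =>
    exact ⟨ts, h₁, List.prefix_append _ _, h₃, by simp [h₁, h₂], t, by simpa [h₁] using h₄, rfl⟩

theorem Eval.builtin_inv {b : Builtin K B} {es : List (Expr Dev K B)}
    (h : Eval I δ Θ σ (.app (.builtin b) es) t) : t.children.length = es.length := by
  cases h with
  | bapp h₁ h₂ h₃ => exact h₁

theorem Eval.decl_inv {xs : List Var} {body : Expr Dev K B} {es : List (Expr Dev K B)}
    (h : Eval I δ Θ σ (.app (.decl xs body) es) t) :
    t.children.length = es.length + 1 ∧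
      Eval I δ (Θ.proj es.length) σ (body.subst (Assign.ofLists xs
        ((t.children.take es.length).map VTree.root))) (t.child es.length) ∧
      t.root = (t.child es.length).root := by
  cases h with
  | @dapp _ _ _ _ t _ ts h₁ h₂ h₃ h₄ =>
    have hc : (VTree.node t.root (ts ++ [t])).child es.length = t := by
      simp [VTree.child, VTree.children, ← h₁]
    rw [hc]
    refine ⟨by simp [VTree.children, h₁], ?_, rfl⟩
    simpa [VTree.children, ← h₁] using h₄

end Inversion

/-! ### Evaluation at all events of a set -/

variable {A : Set E.Ev} {σ : E.Ev → S}

/-- `T` gives the value-trees computed at the events of `A`, when the event `ε` evaluates the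
expression `e ε` in the environment made of the trees of its neighbours in `A`. -/
def IsRun (I : Interp Dev K S B) (E : EventStr Dev) (A : Set E.Ev) (σ : E.Ev → S)
    (e : E.Ev → Expr Dev K B) (T : E.Ev → VTree Dev K) : Prop :=
  ∀ ε ∈ A, Eval I (E.dev ε) (envOf E A T ε) (σ ε) (e ε) (T ε)

/-- `Ts` gives the lists of value-trees computed for the expressions `ss` at the events of `A`,
under the assignments `ρ`. -/
def IsRuns (I : Interp Dev K S B) (E : EventStr Dev) (A : Set E.Ev) (σ : E.Ev → S)
    (ρ : E.Ev → Assign Dev K) : List (Expr Dev K B) → (E.Ev → List (VTree Dev K)) → Prop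
  | [], Ts => ∀ ε ∈ A, Ts ε = []
  | s :: ss, Ts => ∃ T Ts', (∀ ε ∈ A, Ts ε = T ε :: Ts' ε) ∧
      IsRun I E A σ (fun ε => s.subst (ρ ε)) T ∧ IsRuns I E A σ ρ ss Ts'

theorem IsRun.congr {e e' : E.Ev → Expr Dev K B} {T : E.Ev → VTree Dev K}
    (h : IsRun I E A σ e T) (he : ∀ ε ∈ A, e ε = e' ε) : IsRun I E A σ e' T :=
  fun ε hε => he ε hε ▸ h ε hε

theorem IsRun.child_proj {T : E.Ev → VTree Dev K} {i : ℕ}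
    {n : ℕ} (hn : ∀ ε ∈ A, n ≤ (T ε).children.length) (hi : i < n) (ε : E.Ev) :
    (envOf E A T ε).proj i = envOf E A (fun ε => (T ε).child i) ε :=
  envOf_proj (fun ε hε => children_eq_of_length i rfl (hi.trans_le (hn ε hε))) ε

theorem IsRun.letE {x : Var} {e₁ e₂ : E.Ev → Expr Dev K B} {T : E.Ev → VTree Dev K}
    (h : IsRun I E A σ (fun ε => .letE x (e₁ ε) (e₂ ε)) T) :
    ∃ T₁ T₂, IsRun I E A σ e₁ T₁ ∧
      IsRun I E A σ (fun ε => (e₂ ε).subst (Assign.single x (T₁ ε).root)) T₂ ∧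
      ∀ ε ∈ A, (T ε).root = (T₂ ε).root := by
  have hn : ∀ ε ∈ A, 2 ≤ (T ε).children.length := fun ε hε => by rw [(h ε hε).letE_inv.1]; rfl
  refine ⟨fun ε => (T ε).child 0, fun ε => (T ε).child 1, fun ε hε => ?_, fun ε hε => ?_,
    fun ε hε => (h ε hε).letE_inv.2.2.2⟩
  · rw [← IsRun.child_proj hn (by norm_num : 0 < 2)]
    exact (h ε hε).letE_inv.2.1
  · rw [← IsRun.child_proj hn (by norm_num : 1 < 2)]
    exact (h ε hε).letE_inv.2.2.1

theorem IsRun.nbr {e : E.Ev → Expr Dev K B} {T : E.Ev → VTree Dev K}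
    (h : IsRun I E A σ (fun ε => .nbr (e ε)) T) :
    ∃ (T₁ : E.Ev → VTree Dev K) (l : E.Ev → Loc K), IsRun I E A σ e T₁ ∧
      (∀ ε ∈ A, (T₁ ε).root = .loc (l ε)) ∧
      ∀ ε ∈ A, (T ε).root = .fld fun δ =>
        if δ = E.dev ε then some (l ε) else (E.pred A ε δ).map l := by
  have hn : ∀ ε ∈ A, 1 ≤ (T ε).children.length := fun ε hε => by
    rw [(h ε hε).nbr_inv.choose_spec.1]; rfl
  have hl : ∀ ε ∈ A, ∃ l, ((T ε).child 0).root = .loc l := fun ε hε =>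
    ⟨_, (h ε hε).nbr_inv.choose_spec.2.2.1⟩
  choose! l hl using hl
  refine ⟨fun ε => (T ε).child 0, l, fun ε hε => ?_, hl, fun ε hε => ?_⟩
  · rw [← IsRun.child_proj hn (by norm_num : 0 < 1)]
    exact (h ε hε).nbr_inv.choose_spec.2.1
  · obtain ⟨l', -, -, h1, h2⟩ := (h ε hε).nbr_inv
    rw [hl ε hε] at h1
    cases h1
    rw [h2]
    congr 1
    funext δ
    rw [IsRun.child_proj hn (by norm_num : 0 < 1)]
    unfold Field.override Field.single
    rw [envOf_roots hl]
    by_cases hδ : δ = E.dev ε <;> simp [hδ]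

theorem IsRun.rep {x : Var} {e₁ e₂ : E.Ev → Expr Dev K B} {T : E.Ev → VTree Dev K}
    (h : IsRun I E A σ (fun ε => .rep (e₁ ε) x (e₂ ε)) T) :
    ∃ (T₂ : E.Ev → VTree Dev K) (l y : E.Ev → Loc K),
      IsRun I E A σ (fun ε => (e₂ ε).subst (Assign.single x (.loc (l ε)))) T₂ ∧
      (∀ ε ∈ A, (T₂ ε).root = .loc (y ε)) ∧ (∀ ε ∈ A, (T ε).root = .loc (y ε)) ∧
      ∀ ε ∈ A, ∀ q, E.pred A ε (E.dev ε) = some q → l ε = y q := by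
  have hn : ∀ ε ∈ A, 2 ≤ (T ε).children.length := fun ε hε => by
    obtain ⟨_, _, h, -⟩ := (h ε hε).rep_inv; rw [h]; rfl
  have hl := fun ε (hε : ε ∈ A) => (h ε hε).rep_inv
  choose! l y hl using hl
  refine ⟨fun ε => (T ε).child 1, l, y, fun ε hε => ?_, fun ε hε => (hl ε hε).2.2.2.1,
    fun ε hε => (hl ε hε).2.2.2.2, fun ε hε q hq => ?_⟩
  · rw [← IsRun.child_proj hn (by norm_num : 1 < 2)]
    exact (hl ε hε).2.2.1
  · have h1 := (hl ε hε).2.1 (mem_envOf_dom.2 (by simp [hq]))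
    rw [IsRun.child_proj hn (by norm_num : 1 < 2), envOf_roots fun ε hε => (hl ε hε).2.2.2.1, hq] at h1
    exact (Option.some.inj h1).symm

theorem IsRun.share {x : Var} {e₁ e₂ : E.Ev → Expr Dev K B} {T : E.Ev → VTree Dev K}
    (h : IsRun I E A σ (fun ε => .share (e₁ ε) x (e₂ ε)) T) :
    ∃ (T₂ : E.Ev → VTree Dev K) (φ : E.Ev → Field Dev K) (y : E.Ev → Loc K),
      IsRun I E A σ (fun ε => (e₂ ε).subst (Assign.single x (.fld (φ ε)))) T₂ ∧
      (∀ ε ∈ A, (T₂ ε).root = .loc (y ε)) ∧ (∀ ε ∈ A, (T ε).root = .loc (y ε)) ∧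
      ∀ ε ∈ A, (∀ δ q, E.pred A ε δ = some q → φ ε δ = some (y q)) ∧
        ∀ δ, δ ≠ E.dev ε → E.pred A ε δ = none → φ ε δ = none := by
  have hn : ∀ ε ∈ A, 2 ≤ (T ε).children.length := fun ε hε => by
    obtain ⟨_, _, h, -⟩ := (h ε hε).share_inv; rw [h]; rfl
  have hl := fun ε (hε : ε ∈ A) => (h ε hε).share_inv
  choose! l y hl using hl
  refine ⟨fun ε => (T ε).child 1, fun ε => Field.override (Field.single (E.dev ε) (l ε))
    ((envOf E A T ε).proj 1).roots, y, fun ε hε => ?_, fun ε hε => (hl ε hε).2.2.1,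
    fun ε hε => (hl ε hε).2.2.2, fun ε hε => ⟨fun δ q hq => ?_, fun δ hδ hq => ?_⟩⟩
  · rw [← IsRun.child_proj hn (by norm_num : 1 < 2)]
    exact (hl ε hε).2.1
  · dsimp only [Field.override]
    rw [IsRun.child_proj hn (by norm_num : 1 < 2), envOf_roots fun ε hε => (hl ε hε).2.2.1, hq]
    rfl
  · dsimp only [Field.override]
    rw [IsRun.child_proj hn (by norm_num : 1 < 2), envOf_roots fun ε hε => (hl ε hε).2.2.1, hq]
    simp [Field.single, hδ]

theorem IsRun.ite (hE : E.IsAugmented) {e₁ e₂ e₃ : E.Ev → Expr Dev K B} {T : E.Ev → VTree Dev K}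
    (h : IsRun I E A σ (fun ε => .ite (e₁ ε) (e₂ ε) (e₃ ε)) T) :
    ∃ T₁ T₂, IsRun I E A σ e₁ T₁ ∧ (∀ ε ∈ A, (T ε).root = (T₂ ε).root) ∧
      (∀ ε ∈ A, ∃ c, (T₁ ε).root = .loc (Loc.ofBool c)) ∧
      ∀ c, IsRun I E {ε ∈ A | (T₁ ε).root = .loc (Loc.ofBool c)} σ
        (fun ε => if c then e₂ ε else e₃ ε) T₂ := by
  have hn : ∀ ε ∈ A, 2 ≤ (T ε).children.length := fun ε hε => by
    rw [(h ε hε).ite_inv.1]; rfl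
  refine ⟨fun ε => (T ε).child 0, fun ε => (T ε).child 1, fun ε hε => ?_,
    fun ε hε => (h ε hε).ite_inv.2.1, fun ε hε => ?_, fun c ε hε => ?_⟩
  · rw [← IsRun.child_proj hn (by norm_num : 0 < 2)]
    exact (h ε hε).ite_inv.2.2.1
  · obtain ⟨-, -, -, c, hc, -⟩ := (h ε hε).ite_inv
    exact ⟨c, hc⟩
  · obtain ⟨-, -, -, c', hc', h'⟩ := (h ε hε.1).ite_inv
    have hcc : c = c' := by
      have := hε.2.symm.trans hc'
      cases c <;> cases c' <;> simp [Loc.ofBool, Loc.tt, Loc.ff] at this ⊢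
    subst hcc
    rwa [envOf_branch hE (fun ε hε => (h ε hε).ite_inv.1)] at h'

theorem IsRuns.of_eval {ρ : E.Ev → Assign Dev K} {T : E.Ev → VTree Dev K} :
    ∀ (ss : List (Expr Dev K B)) (j : ℕ) (Ts : E.Ev → List (VTree Dev K)),
      (∀ ε ∈ A, (Ts ε).length = ss.length) →
      (∀ ε ∈ A, ∀ i t, (Ts ε)[i]? = some t → (T ε).children[i + j]? = some t) →
      (∀ ε ∈ A, ∀ i e t, (Expr.substList (ρ ε) ss)[i]? = some e → (Ts ε)[i]? = some t →
        Eval I (E.dev ε) ((envOf E A T ε).proj (i + j)) (σ ε) e t) →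
      IsRuns I E A σ ρ ss Ts
  | [], _, Ts, hlen, _, _ => fun ε hε => List.length_eq_zero_iff.1 (hlen ε hε)
  | s :: ss, j, Ts, hlen, hch, hev => by
    have hcons : ∀ ε ∈ A, ∃ t ts, Ts ε = t :: ts := fun ε hε => by
      have := hlen ε hε
      cases h : Ts ε with
      | nil => simp [h] at this
      | cons t ts => exact ⟨t, ts, rfl⟩
    choose! U Us hU using hcons
    refine ⟨U, Us, hU, fun ε hε => ?_, ?_⟩
    · have h := hev ε hε 0 _ (U ε) (by simp [Expr.substList]; rfl) (by simp [hU ε hε])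
      rw [envOf_proj (T' := U) fun ε hε => hch ε hε 0 _ (by simp [hU ε hε])] at h
      exact h
    · refine IsRuns.of_eval (T := T) ss (j + 1) Us (fun ε hε => ?_) (fun ε hε i t ht => ?_)
        fun ε hε i e t he ht => ?_
      · simpa [hU ε hε] using hlen ε hε
      · have := hch ε hε (i + 1) t (by simpa [hU ε hε] using ht)
        rwa [show i + (j + 1) = i + 1 + j by omega]
      · have := hev ε hε (i + 1) e t (by simpa [Expr.substList] using he)
          (by simpa [hU ε hε] using ht)
        rwa [show i + (j + 1) = i + 1 + j by omega]

theorem Expr.length_substList (ρ : Assign Dev K) :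
    ∀ es : List (Expr Dev K B), (Expr.substList ρ es).length = es.length
  | [] => by simp [Expr.substList]
  | e :: es => by simp [Expr.substList, Expr.length_substList ρ es]

theorem IsRun.app {f : Fn Dev K B} {ρ : E.Ev → Assign Dev K} {es : List (Expr Dev K B)}
    {T : E.Ev → VTree Dev K} (h : IsRun I E A σ (fun ε => .app f (Expr.substList (ρ ε) es)) T) :
    ∃ Ts, IsRuns I E A σ ρ es Ts ∧ (∀ ε ∈ A, (Ts ε).length = es.length) ∧
      (∀ ε ∈ A, Ts ε <+: (T ε).children) ∧
      ∀ ε ∈ A, f.Returns I (E.dev ε) (envOf E A T ε) (σ ε) ((Ts ε).map VTree.root) (T ε).root := by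
  have hts := fun ε (hε : ε ∈ A) => (h ε hε).app_inv
  choose! Ts hTs using hts
  refine ⟨Ts, IsRuns.of_eval (T := T) es 0 Ts (fun ε hε => ?_) (fun ε hε i t ht => ?_)
    fun ε hε i e t he ht => (hTs ε hε).2.2.1 i e t he ht, fun ε hε => ?_,
    fun ε hε => (hTs ε hε).2.1, fun ε hε => (hTs ε hε).2.2.2⟩
  · rw [(hTs ε hε).1, Expr.length_substList]
  · obtain ⟨u, hu⟩ := (hTs ε hε).2.1
    rw [← hu, add_zero, List.getElem?_append_left (List.getElem?_eq_some_iff.1 ht).1]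
    exact ht
  · rw [(hTs ε hε).1, Expr.length_substList]

theorem IsRuns.congr {ρ ρ' : E.Ev → Assign Dev K} :
    ∀ {ss : List (Expr Dev K B)} {Ts : E.Ev → List (VTree Dev K)},
      IsRuns I E A σ ρ ss Ts → (∀ ε ∈ A, Expr.substList (ρ ε) ss = Expr.substList (ρ' ε) ss) →
      IsRuns I E A σ ρ' ss Ts
  | [], _, h, _ => h
  | s :: ss, Ts, ⟨T, Ts', h1, h2, h3⟩, hc => by
    simp only [Expr.substList, List.cons.injEq] at hc
    exact ⟨T, Ts', h1, h2.congr fun ε hε => (hc ε hε).1, h3.congr fun ε hε => (hc ε hε).2⟩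

variable {Adm : Dev → Set S} {N : ℕ}

/-! ### Settling expressions -/

section Setting

variable {E : EventStr Dev} {A : Set E.Ev} {G : NetGraph Dev} {σ : E.Ev → S}
  {ρ : E.Ev → Assign Dev K} {ρl : Dev → Assign Dev K}

/-- The events of `A` where the neighbourhood is the one in `G`, the sensor state is admissible
and the free variables have their limit values. -/
def good (E : EventStr Dev) (A : Set E.Ev) (Adm : Dev → Set S) (G : NetGraph Dev) (σ : E.Ev → S)
    (ρ : E.Ev → Assign Dev K) (ρl : Dev → Assign Dev K) : Set E.Ev :=
  {ε | ε ∈ A ∧ E.AgreesIn A G ε ∧ σ ε ∈ Adm (E.dev ε) ∧ ρ ε = ρl (E.dev ε)}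

/-- The restriction to `A` of an augmented event structure has limit `G`, and sensors and free
variables settle. -/
structure Setting (Adm : Dev → Set S) (N : ℕ) (E : EventStr Dev) (A : Set E.Ev) (G : NetGraph Dev)
    (σ : E.Ev → S) (ρ : E.Ev → Assign Dev K) (ρl : Dev → Assign Dev K) : Prop where
  aug : E.IsAugmented
  lim : E.LimitIn A G
  card : G.devs.card ≤ N
  finite : (A \ good E A Adm G σ ρ ρl).Finite

namespace Setting

theorem good_subset : good E A Adm G σ ρ ρl ⊆ A := fun _ h => h.1

theorem refl (h : Setting Adm N E A G σ ρ ρl) (n : ℕ∞) :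
    E.Reach A n (good E A Adm G σ ρ ρl) (good E A Adm G σ ρ ρl) :=
  .refl good_subset h.finite n

theorem and_good (h : Setting Adm N E A G σ ρ ρl) {n : ℕ∞} {R : Set E.Ev}
    (hR : E.Reach A n (good E A Adm G σ ρ ρl) R) :
    E.Reach A n (good E A Adm G σ ρ ρl) (R ∩ good E A Adm G σ ρ ρl) := by
  simpa using hR.inter (h.refl n)

/-- Free variables may be bound to results that settle. -/
theorem extend (h : Setting Adm N E A G σ ρ ρl) {n : ℕ∞} {R : Set E.Ev}
    {ρ' : E.Ev → Assign Dev K} {ρl' : Dev → Assign Dev K}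
    (hR : E.Reach A n (good E A Adm G σ ρ ρl) R)
    (hρ : ∀ ε ∈ R, ε ∈ good E A Adm G σ ρ ρl → ρ' ε = ρl' (E.dev ε)) :
    Setting Adm N E A G σ ρ' ρl' ∧
      E.Reach A n (good E A Adm G σ ρ ρl) (good E A Adm G σ ρ' ρl') := by
  have : E.Reach A n (good E A Adm G σ ρ ρl) (good E A Adm G σ ρ' ρl') :=
    (h.and_good hR).mono_right (fun ε hε => ⟨hε.2.1, hε.2.2.1, hε.2.2.2.1, hρ ε hε.1 hε.2⟩)
      good_subset
  exact ⟨⟨h.aug, h.lim, h.card, this.finite⟩, this⟩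

end Setting

end Setting

/-- The limit of an expression, as a function of the network graph and of the limits of its free
variables. -/
abbrev Lim (Dev K : Type) := NetGraph Dev → (Dev → Assign Dev K) → Dev → Value Dev K

/-- In networks with at most `N` devices, and within `n` full rounds after sensors,
neighbourhoods and free variables have settled, the expression has the limit value. -/
def Settles (I : Interp Dev K S B) (Adm : Dev → Set S) (N : ℕ) (s : Expr Dev K B) (n : ℕ∞)
    (lim : Lim Dev K) : Prop :=
  ∀ (E : EventStr Dev) (A : Set E.Ev) (G : NetGraph Dev) (σ : E.Ev → S)
    (ρ : E.Ev → Assign Dev K) (ρl : Dev → Assign Dev K) (T : E.Ev → VTree Dev K),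
    Setting Adm N E A G σ ρ ρl → IsRun I E A σ (fun ε => s.subst (ρ ε)) T →
    E.Reach A n (good E A Adm G σ ρ ρl) {ε ∈ A | (T ε).root = lim G ρl (E.dev ε)}

/-- The version of `Settles` for a list of expressions. -/
def SettlesList (I : Interp Dev K S B) (Adm : Dev → Set S) (N : ℕ) (ss : List (Expr Dev K B))
    (n : ℕ∞) (lim : NetGraph Dev → (Dev → Assign Dev K) → Dev → List (Value Dev K)) : Prop :=
  ∀ (E : EventStr Dev) (A : Set E.Ev) (G : NetGraph Dev) (σ : E.Ev → S)
    (ρ : E.Ev → Assign Dev K) (ρl : Dev → Assign Dev K) (Ts : E.Ev → List (VTree Dev K)),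
    Setting Adm N E A G σ ρ ρl → IsRuns I E A σ ρ ss Ts →
    E.Reach A n (good E A Adm G σ ρ ρl) {ε ∈ A | (Ts ε).map VTree.root = lim G ρl (E.dev ε)}

theorem pred_mem_of_inner {E : EventStr Dev} {A R : Set E.Ev} {ε q : E.Ev} {δ : Dev}
    (h : ε ∈ E.inner A R) (hq : E.pred A ε δ = some q) : q ∈ R :=
  h.2 q (EventStr.pred_some hq).1 (EventStr.pred_some hq).2.1

theorem EventStr.AgreesIn.pred_self_ne_none {E : EventStr Dev} {A : Set E.Ev} {G : NetGraph Dev}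
    {ε : E.Ev}
    (h : E.AgreesIn A G ε) : E.pred A ε (E.dev ε) ≠ none := by
  rw [← Option.isSome_iff_ne_none, h.2]
  exact G.refl _ h.1

/-- The value to which a fixed value evaluates on `δ` in the network `G`. -/
def Value.onGraph (G : NetGraph Dev) (δ : Dev) : Value Dev K → Value Dev K
  | .loc l => .loc l
  | .fld φ => .fld (φ.restrict ({δ' | G.adj δ' δ} ∪ {δ}))

theorem Eval.val_eq {E : EventStr Dev} {A : Set E.Ev} {G : NetGraph Dev} {ε : E.Ev} {σ : S}
    {T : E.Ev → VTree Dev K} {t : VTree Dev K} {v : Value Dev K} (hε : E.AgreesIn A G ε)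
    (h : Eval I (E.dev ε) (envOf E A T ε) σ (.val v : Expr Dev K B) t) :
    t.root = v.onGraph G (E.dev ε) := by
  cases v with
  | loc l => exact h.val_loc_inv
  | fld φ => rw [h.val_fld_inv, envOf_dom_of_agrees hε]; rfl

theorem Settles.var (x : Var) : Settles I Adm N (.var x) 0 fun G ρl δ =>
    match ρl δ x with
    | some v => v.onGraph G δ
    | none => default := by
  intro E A G σ ρ ρl T hS hT
  refine (hS.refl 0).mono_right (fun ε hε => ⟨hε.1, ?_⟩) fun _ h => h.1
  have h := hT ε hε.1
  dsimp only [Expr.subst] at h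
  rw [hε.2.2.2] at h
  cases hx : ρl (E.dev ε) x with
  | none => simp only [hx] at h; cases h
  | some v =>
    simp only [hx] at h ⊢
    exact h.val_eq hε.2.1

theorem Settles.val (v : Value Dev K) :
    Settles I Adm N (.val v) 0 fun G _ δ => v.onGraph G δ := by
  intro E A G σ ρ ρl T hS hT
  refine (hS.refl 0).mono_right (fun ε hε => ⟨hε.1, ?_⟩) fun _ h => h.1
  have h := hT ε hε.1
  simp only [Expr.subst] at h
  exact h.val_eq hε.2.1

theorem Settles.letE {x : Var} {s₁ s₂ : Expr Dev K B} {n₁ n₂ : ℕ∞} {l₁ l₂ : Lim Dev K}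
    (h₁ : Settles I Adm N s₁ n₁ l₁) (h₂ : Settles I Adm N s₂ n₂ l₂) :
    Settles I Adm N (.letE x s₁ s₂) (n₁ + n₂)
      fun G ρl => l₂ G fun δ => (ρl δ).set x (l₁ G ρl δ) := by
  intro E A G σ ρ ρl T hS hT
  simp only [Expr.subst] at hT
  obtain ⟨T₁, T₂, hT₁, hT₂, hr⟩ := hT.letE
  simp only [Expr.subst_erase_single] at hT₂
  have hR₁ := h₁ E A G σ ρ ρl T₁ hS hT₁
  obtain ⟨hS', hR⟩ := hS.extend (ρ' := fun ε => (ρ ε).set x (T₁ ε).root)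
    (ρl' := fun δ => (ρl δ).set x (l₁ G ρl δ)) hR₁
    fun ε hε hg => by rw [hε.2, hg.2.2.2]
  exact (hR.trans (h₂ E A G σ _ _ T₂ hS' hT₂)).mono_right
    (fun ε hε => ⟨hε.1, (hr ε hε.1).trans hε.2⟩) fun _ h => h.1

theorem Settles.nbr {s : Expr Dev K B} {n : ℕ∞} {l : Lim Dev K} (h : Settles I Adm N s n l) :
    Settles I Adm N (.nbr s) (n + 1) fun G ρl δ =>
      .fld fun δ' => if G.adj δ' δ then (l G ρl δ').toLoc else none := by
  intro E A G σ ρ ρl T hS hT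
  simp only [Expr.subst] at hT
  obtain ⟨T₁, y, hT₁, hy, hr⟩ := hT.nbr
  have hR := (hS.and_good (h E A G σ ρ ρl T₁ hS hT₁)).inner hS.aug
  refine hR.mono_right (fun ε hε => ⟨hε.1.1.1, ?_⟩) fun _ h => h.1
  have hg : ε ∈ good E A Adm G σ ρ ρl := hε.1.2
  rw [hr ε hg.1]
  congr 1
  funext δ
  have key : ∀ q ∈ ({ε ∈ A | (T₁ ε).root = l G ρl (E.dev ε)} ∩ good E A Adm G σ ρ ρl),
      some (y q) = (l G ρl (E.dev q)).toLoc := fun q hq => by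
    rw [← hq.1.2, hy q hq.1.1]; rfl
  have hadj := hg.2.1.2 δ
  by_cases hδ : δ = E.dev ε
  · subst hδ
    rw [if_pos rfl, if_pos (G.refl _ hg.2.1.1), key ε hε.1]
  · rw [if_neg hδ]
    cases hp : E.pred A ε δ with
    | none =>
      rw [if_neg fun hc => by rw [← hadj, hp] at hc; simp at hc]
      rfl
    | some q =>
      rw [if_pos (hadj.1 (by simp [hp])), ← (EventStr.pred_some hp).2.2]
      exact key q (pred_mem_of_inner hε hp)

theorem SettlesList.nil : SettlesList I Adm N [] 0 fun _ _ _ => [] := by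
  intro E A G σ ρ ρl Ts hS hT
  refine (hS.refl 0).mono_right (fun ε hε => ⟨hε.1, ?_⟩) fun _ h => h.1
  rw [hT ε hε.1]; rfl

theorem SettlesList.cons {s : Expr Dev K B} {ss : List (Expr Dev K B)} {n m : ℕ∞} {l : Lim Dev K}
    {ls : NetGraph Dev → (Dev → Assign Dev K) → Dev → List (Value Dev K)}
    (h : Settles I Adm N s n l) (hs : SettlesList I Adm N ss m ls) :
    SettlesList I Adm N (s :: ss) (max n m) fun G ρl δ => l G ρl δ :: ls G ρl δ := by
  rintro E A G σ ρ ρl Ts hS ⟨T, Ts', hcons, hT, hTs⟩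
  refine ((h E A G σ ρ ρl T hS hT).inter (hs E A G σ ρ ρl Ts' hS hTs)).mono_right
    (fun ε hε => ⟨hε.1.1, ?_⟩) fun _ h => h.1
  rw [hcons ε hε.1.1, List.map_cons, hε.1.2, hε.2.2]

/-! ### Conditionals -/

/-- The subgraph of the devices in `X`. -/
def NetGraph.sub (G : NetGraph Dev) (X : Set Dev) : NetGraph Dev where
  devs := G.devs.filter (· ∈ X)
  adj := fun δ' δ => G.adj δ' δ ∧ δ' ∈ X ∧ δ ∈ X
  adj_mem := fun δ' δ h => by
    have := G.adj_mem δ' δ h.1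
    simp [this.1, this.2, h.2.1, h.2.2]
  refl := fun δ h => by
    rw [Finset.mem_filter] at h
    exact ⟨G.refl δ h.1, h.2, h.2⟩

/-- The devices where a guard with limit `l` selects the branch `c`. -/
def guardSet (l : Dev → Value Dev K) (c : Bool) : Set Dev := {δ | l δ = .loc (Loc.ofBool c)}

section Branch

variable {E : EventStr Dev} {A A' : Set E.Ev} {G : NetGraph Dev} {σ : E.Ev → S}
  {ρ : E.Ev → Assign Dev K} {ρl : Dev → Assign Dev K} {R : Set E.Ev} {X : Set Dev}

theorem iterate_inner_inter (hA : A' ⊆ A) (k : ℕ) (S : Set E.Ev) :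
    (E.inner A)^[k] S ∩ A' ⊆ (E.inner A')^[k] (S ∩ A') := by
  induction k generalizing S with
  | zero => exact subset_rfl
  | succ k ih =>
    refine (ih _).trans (E.iterate_inner_mono A' k ?_)
    rintro ε ⟨h, h'⟩
    exact ⟨⟨h.1, h'⟩, fun ε' hA' hn => ⟨h.2 ε' (hA hA') hn, hA'⟩⟩

/-- Once the branch chosen by an event and by its neighbours only depends on the device, the event
is settled in the branch. -/
theorem mem_good_branch (hA : A' ⊆ A) (hR : ∀ ε ∈ R, ε ∈ A' ↔ E.dev ε ∈ X) {ε : E.Ev}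
    (hε : ε ∈ E.inner A (R ∩ good E A Adm G σ ρ ρl)) (hε' : ε ∈ A') :
    ε ∈ good E A' Adm (G.sub X) σ ρ ρl := by
  have hg := hε.1.2
  have hX := (hR ε hε.1.1).1 hε'
  refine ⟨hε', ⟨by simpa [NetGraph.sub, hX] using hg.2.1.1, fun δ => ?_⟩, hg.2.2⟩
  have hadj := hg.2.1.2 δ
  rw [EventStr.pred_isSome] at hadj ⊢
  constructor
  · rintro ⟨q, hq, hn, rfl⟩
    exact ⟨hadj.1 ⟨q, hA hq, hn, rfl⟩, (hR q (hε.2 q (hA hq) hn).1).1 hq, hX⟩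
  · rintro ⟨h1, h2, -⟩
    obtain ⟨q, hq, hn, rfl⟩ := hadj.2 h1
    exact ⟨q, (hR q (hε.2 q hq hn).1).2 h2, hn, rfl⟩

theorem infinite_branch (hlim : E.LimitIn A G) (hf : (A \ R).Finite)
    (hR : ∀ ε ∈ R, ε ∈ A' ↔ E.dev ε ∈ X) {δ : Dev} (hδ : δ ∈ (G.sub X).devs) :
    {ε ∈ A' | E.dev ε = δ}.Infinite := by
  simp only [NetGraph.sub, Finset.mem_filter] at hδ
  intro hfin
  refine (hlim.devs δ).1 hδ.1 ((hfin.union hf).subset ?_)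
  rintro ε ⟨hεA, rfl⟩
  by_cases h : ε ∈ R
  · exact Or.inl ⟨(hR ε h).2 hδ.2, rfl⟩
  · exact Or.inr ⟨hεA, h⟩

theorem Setting.branch (hS : Setting Adm N E A G σ ρ ρl) (hA : A' ⊆ A) (hf : (A \ R).Finite)
    (hR : ∀ ε ∈ R, ε ∈ A' ↔ E.dev ε ∈ X) (hinf : A'.Infinite) :
    Setting Adm N E A' (G.sub X) σ ρ ρl := by
  have hfin : (A' \ good E A' Adm (G.sub X) σ ρ ρl).Finite := by
    have h1 : (A \ (R ∩ good E A Adm G σ ρ ρl)).Finite := by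
      rw [Set.sdiff_inter]; exact hf.union hS.finite
    refine (hS.aug.finite_diff_inner h1).subset ?_
    rintro ε ⟨h, h'⟩
    exact ⟨hA h, fun hi => h' (mem_good_branch hA hR hi h)⟩
  refine ⟨hS.aug, ⟨hinf, fun δ => ⟨infinite_branch hS.lim hf hR, fun hδ => ?_⟩,
    hfin.subset fun ε hε => ⟨hε.1, fun hg => hε.2 hg.2.1⟩⟩,
    (Finset.card_filter_le _ _).trans hS.card, hfin⟩
  by_contra hn
  refine hδ (hfin.subset ?_)
  rintro ε ⟨h, rfl⟩
  exact ⟨h, fun hg => hn hg.2.1.1⟩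

end Branch

/-- The branch taken by an event is final when its guard is; its neighbourhood in the branch is final
when the guards of its neighbours are, which takes one round more. If only finitely many events
take a branch, no device takes it in the limit. -/
theorem Settles.ite {s₁ s₂ s₃ : Expr Dev K B} {n₁ n₂ n₃ : ℕ∞} {l₁ l₂ l₃ : Lim Dev K}
    (h₁ : Settles I Adm N s₁ n₁ l₁) (h₂ : Settles I Adm N s₂ n₂ l₂)
    (h₃ : Settles I Adm N s₃ n₃ l₃) :
    Settles I Adm N (.ite s₁ s₂ s₃) (n₁ + 1 + max n₂ n₃) fun G ρl δ =>
      if δ ∈ guardSet (l₁ G ρl) true then l₂ (G.sub (guardSet (l₁ G ρl) true)) ρl δ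
      else l₃ (G.sub (guardSet (l₁ G ρl) false)) ρl δ := by
  intro E A G σ ρ ρl T hS hT
  simp only [Expr.subst] at hT
  obtain ⟨T₁, T₂, hT₁, hr, hguard, hT₂⟩ := hT.ite hS.aug
  have hR₁ := h₁ E A G σ ρ ρl T₁ hS hT₁
  -- the limit in the branch `c`
  let lb : Bool → Lim Dev K := fun c => if c then l₂ else l₃
  let R₁ := {ε ∈ A | (T₁ ε).root = l₁ G ρl (E.dev ε)}
  let X : Bool → Set Dev := guardSet (l₁ G ρl)
  let A' : Bool → Set E.Ev := fun c => {ε ∈ A | (T₁ ε).root = .loc (Loc.ofBool c)}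
  have hAA : ∀ c, A' c ⊆ A := fun c _ h => h.1
  have hX : ∀ c, ∀ ε ∈ R₁, ε ∈ A' c ↔ E.dev ε ∈ X c := fun c ε hε => by
    change ε ∈ A ∧ _ ↔ _ = _
    rw [hε.2]
    exact and_iff_right hε.1
  have hb : ∀ c, E.Reach A (n₁ + 1 + max n₂ n₃) (good E A Adm G σ ρ ρl)
      {ε ∈ A | ε ∈ A' c → (T₂ ε).root = lb c (G.sub (X c)) ρl (E.dev ε)} := by
    intro c
    have hD := (hS.and_good hR₁).inner hS.aug
    by_cases hinf : (A' c).Infinite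
    · have hS' := hS.branch (hAA c) hR₁.finite (hX c) hinf
      have hR₂ : E.Reach (A' c) (max n₂ n₃) (good E (A' c) Adm (G.sub (X c)) σ ρ ρl)
          {ε ∈ A' c | (T₂ ε).root = lb c (G.sub (X c)) ρl (E.dev ε)} := by
        cases c with
        | true =>
          exact (h₂ E _ _ σ ρ ρl T₂ hS' ((hT₂ true).congr fun _ _ => if_pos rfl)).mono
            (le_max_left _ _)
        | false =>
          exact (h₃ E _ _ σ ρ ρl T₂ hS' ((hT₂ false).congr fun _ _ =>
            if_neg Bool.false_ne_true)).mono (le_max_right _ _)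
      refine hD.trans ⟨fun _ h => h.1, hR₂.finite.subset ?_, fun k hk ε hε => ⟨?_, fun hA' => ?_⟩⟩
      · rintro ε ⟨h, h'⟩
        simp only [Set.mem_ofPred_eq, not_and, Classical.not_imp] at h'
        exact ⟨(h' h).1, fun h2 => (h' h).2 h2.2⟩
      · exact hD.subset (E.iterate_inner_subset A k _ hε)
      · refine (hR₂.within k hk (E.iterate_inner_mono _ k ?_
          (iterate_inner_inter (hAA c) k _ ⟨hε, hA'⟩))).2
        exact fun ε hε => mem_good_branch (hAA c) (hX c) hε.1 hε.2
    · have hnone : ∀ ε ∈ E.inner A (R₁ ∩ good E A Adm G σ ρ ρl), ε ∉ A' c := fun ε hε hA' =>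
        hinf ((infinite_branch hS.lim hR₁.finite (hX c)
          (mem_good_branch (hAA c) (hX c) hε hA').2.1.1).mono fun _ h => h.1)
      exact (hD.mono le_self_add).mono_right
        (fun ε hε => ⟨hD.subset hε, fun h => absurd h (hnone ε hε)⟩) fun _ h => h.1
  have hall := ((hS.and_good hR₁).inner hS.aug).mono
    (le_self_add : n₁ + 1 ≤ n₁ + 1 + max n₂ n₃)
  have := hall.inter ((hb true).inter (hb false))
  rw [max_self, max_self] at this
  refine this.mono_right ?_ fun _ h => h.1
  rintro ε ⟨h1, h2, h3⟩
  refine ⟨h2.1, (hr ε h2.1).trans ?_⟩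
  dsimp only
  obtain ⟨c, hc⟩ := hguard ε h2.1
  have hmem : E.dev ε ∈ guardSet (l₁ G ρl) c := (hX c ε h1.1.1).1 ⟨h2.1, hc⟩
  cases c with
  | true =>
    rw [if_pos hmem]
    exact h2.2 ⟨h2.1, hc⟩
  | false =>
    rw [if_neg]
    · exact h3.2 ⟨h2.1, hc⟩
    · intro ht
      have := hmem.symm.trans ht
      simp [Loc.ofBool, Loc.tt, Loc.ff] at this

/-! ### Function calls -/

theorem Settles.call {xs : List Var} {body : Expr Dev K B} {ss : List (Expr Dev K B)}
    {n₁ n₂ : ℕ∞} {ls : NetGraph Dev → (Dev → Assign Dev K) → Dev → List (Value Dev K)}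
    {l : Lim Dev K} (h₁ : SettlesList I Adm N ss n₁ ls) (h₂ : Settles I Adm N body n₂ l) :
    Settles I Adm N (.app (.decl xs body) ss) (n₁ + n₂)
      fun G ρl => l G fun δ => Assign.ofLists xs (ls G ρl δ) := by
  intro E A G σ ρ ρl T hS hT
  simp only [Expr.subst] at hT
  obtain ⟨Ts, hTs, hlen, hpre, -⟩ := hT.app
  have hd := fun ε (hε : ε ∈ A) => (hT ε hε).decl_inv
  simp only [Expr.length_substList] at hd
  have htake : ∀ ε ∈ A, (T ε).children.take ss.length = Ts ε := fun ε hε => by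
    rw [List.prefix_iff_eq_take.1 (hpre ε hε), hlen ε hε]
  have hR₁ := h₁ E A G σ ρ ρl Ts hS hTs
  obtain ⟨hS', hR⟩ := hS.extend
    (ρ' := fun ε => Assign.ofLists xs ((Ts ε).map VTree.root))
    (ρl' := fun δ => Assign.ofLists xs (ls G ρl δ)) hR₁ fun ε hε _ => by rw [hε.2]
  have hT₂ : IsRun I E A σ (fun ε => body.subst (Assign.ofLists xs ((Ts ε).map VTree.root)))
      (fun ε => (T ε).child ss.length) := by
    intro ε hε
    have := (hd ε hε).2.1
    rw [htake ε hε, IsRun.child_proj (n := ss.length + 1) (fun ε hε => (hd ε hε).1.ge)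
      (Nat.lt_succ_self _)] at this
    exact this
  exact (hR.trans (h₂ E A G σ _ _ _ hS' hT₂)).mono_right
    (fun ε hε => ⟨hε.1, (hd ε hε.1).2.2.trans hε.2⟩) fun _ h => h.1

/-- The limit of an application of a built-in operator to arguments with limits `vs`. -/
def builtinLim (lim : B → NetGraph Dev → (Dev → List (Value Dev K)) → Dev → Value Dev K)
    (b : Builtin K B) (G : NetGraph Dev) (vs : Dev → List (Value Dev K)) (δ : Dev) : Value Dev K :=
  match b with
  | .mux => (muxOp (vs δ)).getD default
  | .nbrlt P => .fld fun δ' => if G.adj δ' δ then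
      match vs δ', vs δ with
      | [.loc l'], [.loc l] => some (Loc.ofBool (decide (P.lt l' l)))
      | _, _ => none
      else none
  | .minHoodLoc P => (minHoodLocOp P δ (vs δ)).getD default
  | .localHood => (localHoodOp δ (vs δ)).getD default
  | .user b => lim b G vs δ

theorem nbrltOp_some {P : DataOrder K} {δ : Dev} {Θ : VEnv Dev K} {vs : List (Value Dev K)}
    {w : Value Dev K} (h : nbrltOp P δ Θ vs = some w) : ∃ l, vs = [.loc l] ∧
      w = .fld fun δ' => (Function.update (Θ.proj 0).roots δ (some l) δ').map
        fun l' => Loc.ofBool (decide (P.lt l' l)) := by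
  unfold nbrltOp at h
  split at h
  · exact ⟨_, rfl, (Option.some.inj h).symm⟩
  · cases h

theorem IsRun.user_builtin {E : EventStr Dev} (hE : E.IsAugmented) {A : Set E.Ev} {σ : E.Ev → S}
    {b : B} {ρ : E.Ev → Assign Dev K} {ss : List (Expr Dev K B)} {T : E.Ev → VTree Dev K}
    (hT : IsRun I E A σ (fun ε => .app (.builtin (.user b)) (Expr.substList (ρ ε) ss)) T) :
    IsBuiltinRun I b (E.restrict A) (fun ε => σ ε.1) (fun ε => (T ε.1).children)
      (fun ε => T ε.1) := by
  obtain ⟨Ts, hTs, hlen, hpre, hret⟩ := hT.app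
  rintro ⟨ε, hε⟩
  have hc : Ts ε = (T ε).children := (hpre ε hε).eq_of_length (by
    rw [hlen ε hε, (hT ε hε).builtin_inv, Expr.length_substList])
  refine ⟨envOf E A T ε, (T ε).root, fun δ t => ?_, ?_, ?_⟩
  · unfold envOf
    rw [Option.map_eq_some_iff]
    constructor
    · rintro ⟨q, hq, rfl⟩
      obtain ⟨h1, h2, h3⟩ := EventStr.pred_some hq
      exact ⟨⟨q, h1⟩, h2, h3, rfl⟩
    · rintro ⟨q, h2, h3, rfl⟩
      exact ⟨q.1, hE.pred_eq.2 ⟨q.2, h2, h3⟩, rfl⟩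
  · have := hret ε hε
    rw [hc] at this
    exact this
  · dsimp only
    cases T ε; rfl

theorem Settles.builtin {lim : B → NetGraph Dev → (Dev → List (Value Dev K)) → Dev → Value Dev K}
    {settle : B → ℕ∞} (hB : ∀ b, SelfStabilising I Adm b (lim b) (settle b)) (b : Builtin K B)
    {ss : List (Expr Dev K B)} {n : ℕ∞}
    {ls : NetGraph Dev → (Dev → Assign Dev K) → Dev → List (Value Dev K)}
    (h : SettlesList I Adm N ss n ls) :
    Settles I Adm N (.app (.builtin b) ss) (n + settleOf settle b)
      fun G ρl => builtinLim lim b G (ls G ρl) := by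
  intro E A G σ ρ ρl T hS hT
  simp only [Expr.subst] at hT
  obtain ⟨Ts, hTs, hlen, hpre, hret⟩ := hT.app
  have hR := hS.and_good (h E A G σ ρ ρl Ts hS hTs)
  cases b with
  | mux =>
    simp only [settleOf, add_zero]
    refine hR.mono_right (fun ε hε => ⟨hε.2.1, ?_⟩) fun _ h => h.1
    have := hret ε hε.2.1
    rw [hε.1.2] at this
    change muxOp _ = _ at this
    simp [builtinLim, this]
  | minHoodLoc P =>
    simp only [settleOf, add_zero]
    refine hR.mono_right (fun ε hε => ⟨hε.2.1, ?_⟩) fun _ h => h.1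
    have := hret ε hε.2.1
    rw [hε.1.2] at this
    change minHoodLocOp _ _ _ = _ at this
    simp [builtinLim, this]
  | localHood =>
    simp only [settleOf, add_zero]
    refine hR.mono_right (fun ε hε => ⟨hε.2.1, ?_⟩) fun _ h => h.1
    have := hret ε hε.2.1
    rw [hε.1.2] at this
    change localHoodOp _ _ = _ at this
    simp [builtinLim, this]
  | nbrlt P =>
    simp only [settleOf]
    have hl := fun ε (hε : ε ∈ A) => nbrltOp_some (hret ε hε)
    choose! l hl using hl
    have hroots : ∀ ε ∈ A, ((T ε).child 0).root = .loc (l ε) := fun ε hε => by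
      have h1 := (hl ε hε).1
      obtain ⟨u, hu⟩ := hpre ε hε
      rw [List.map_eq_singleton_iff] at h1
      obtain ⟨t, ht, hr⟩ := h1
      simp [VTree.child, ← hu, ht, hr]
    have hn : ∀ ε ∈ A, 1 ≤ (T ε).children.length := fun ε hε => by
      have h1 := congrArg List.length (hl ε hε).1
      have h2 := (hpre ε hε).length_le
      simp at h1; omega
    refine (hR.inner hS.aug).mono_right (fun ε hε => ⟨hε.1.2.1, ?_⟩) fun _ h => h.1
    have hg := hε.1.2
    have hls : ∀ q ∈ {ε ∈ A | (Ts ε).map VTree.root = ls G ρl (E.dev ε)} ∩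
        good E A Adm G σ ρ ρl, ls G ρl (E.dev q) = [.loc (l q)] := fun q hq => by
      rw [← hq.1.2, (hl q hq.1.1).1]
    rw [(hl ε hg.1).2, builtinLim]
    congr 1
    funext δ
    have hadj := hg.2.1.2 δ
    rw [IsRun.child_proj hn (by norm_num : 0 < 1)]
    by_cases hδ : δ = E.dev ε
    · subst hδ
      rw [if_pos (G.refl _ hg.2.1.1), hls ε hε.1]
      simp
    · rw [Function.update_of_ne hδ, envOf_roots hroots]
      cases hp : E.pred A ε δ with
      | none =>
        rw [if_neg fun hc => by rw [← hadj, hp] at hc; simp at hc]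
        rfl
      | some q =>
        rw [if_pos (hadj.1 (by simp [hp])), ← (EventStr.pred_some hp).2.2, hls ε hε.1,
          hls q (pred_mem_of_inner hε hp)]
        rfl
  | user b =>
    simp only [settleOf]
    have hc : ∀ ε ∈ A, Ts ε = (T ε).children := fun ε hε => (hpre ε hε).eq_of_length (by
      rw [hlen ε hε, (hT ε hε).builtin_inv, Expr.length_substList])
    have hfin := hR.finite
    have hss := hB b E A (E.restrict A) G (fun ε => σ ε.1) (fun ε => (T ε.1).children)
      (fun ε => T ε.1) (ls G ρl) hS.aug rfl (EventStr.limitIn_iff.2 hS.lim)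
      ((EventStr.finite_subtype_iff (p := fun ε => σ ε ∉ Adm (E.dev ε))).2
        (hfin.subset fun ε hε => ⟨hε.1, fun hg => hε.2 hg.2.2.2.1⟩))
      (hT.user_builtin hS.aug)
      ((EventStr.finite_subtype_iff
        (p := fun ε => (T ε).children.map VTree.root ≠ ls G ρl (E.dev ε))).2
        (hfin.subset fun ε hε => ⟨hε.1, fun hg => hε.2 (by rw [← hc ε hε.1]; exact hg.1.2)⟩))
    refine hR.trans ⟨fun _ h => h.1, ?_, fun k hk ε hε => ⟨?_, ?_⟩⟩
    · refine ((EventStr.finite_subtype_iff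
        (p := fun ε => (T ε).root ≠ lim b G (ls G ρl) (E.dev ε))).1 hss.1).subset ?_
      rintro ε ⟨h1, h2⟩
      exact ⟨h1, fun h3 => h2 ⟨h1, h3⟩⟩
    · exact hR.subset (E.iterate_inner_subset A k _ hε)
    · have hεA : ε ∈ A := hR.subset (E.iterate_inner_subset A k _ hε)
      refine hss.2 _ (fun q hq => ?_) ⟨ε, hεA⟩
        (hk.trans_lt (EventStr.lt_round_of_iterate (ε := ⟨ε, hεA⟩) hε))
      have hq' := not_not.1 hq
      refine ⟨(EventStr.restrict_agrees_iff q.2).2 hq'.2.2.1, hq'.2.2.2.1, ?_⟩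
      rw [← hc q.1 q.2]
      exact hq'.1.2

/-! ### Feedback loops -/

/-- The common view of `rep` and `share`. In a run `T` of the construct, the body is run with `x`
bound to some value. At the event `ε`, the subexpression `X` of the body gathers the field `φ ε` of
earlier results of the construct on the neighbours, at most `h` rounds old, and the
subexpression `Y` is its component for the own device, which is the previous result there.
For `rep`, `X` is `nbr{x}`, `Y` is `x` and `h` is `2`: the neighbours' `x` are their previous
results. For `share`, `X` is `x`, `Y` is `localHood(x)` and `h` is `1`. -/
structure Loop (I : Interp Dev K S B) (E : EventStr Dev) (A : Set E.Ev) (σ : E.Ev → S)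
    (ρ : E.Ev → Assign Dev K) (x : Var) (X Y body : Expr Dev K B) (h : ℕ)
    (T : E.Ev → VTree Dev K) (v : E.Ev → Value Dev K) (T₂ : E.Ev → VTree Dev K)
    (y : E.Ev → Loc K) (φ : E.Ev → Field Dev K) : Prop where
  run : IsRun I E A σ (fun ε => body.subst ((ρ ε).set x (v ε))) T₂
  root : ∀ ε ∈ A, (T ε).root = .loc (y ε)
  root_body : ∀ ε ∈ A, (T₂ ε).root = .loc (y ε)
  gather : ∀ T', IsRun I E A σ (fun ε => X.subst ((ρ ε).set x (v ε))) T' →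
    ∀ ε ∈ A, (T' ε).root = .fld (φ ε)
  own : ∀ T', IsRun I E A σ (fun ε => Y.subst ((ρ ε).set x (v ε))) T' →
    ∀ ε ∈ A, ∃ l, (T' ε).root = .loc l ∧ φ ε (E.dev ε) = some l
  prev : ∀ G, ∀ ε ∈ A, E.AgreesIn A G ε →
    ∃ q, E.Anc A 1 q ε ∧ E.dev q = E.dev ε ∧ φ ε (E.dev ε) = some (y q)
  field : ∀ G, ∀ ε ∈ E.inner A {ε ∈ A | E.AgreesIn A G ε}, ∀ δ,
    (∀ l, φ ε δ = some l → G.adj δ (E.dev ε)) ∧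
    (G.adj δ (E.dev ε) → ∃ q, E.Anc A h q ε ∧ E.dev q = δ ∧ φ ε δ = some (y q))

/-- All runs of the expression `e` are feedback loops. -/
def IsLoop (I : Interp Dev K S B) (x : Var) (X Y body : Expr Dev K B) (h : ℕ)
    (e : Expr Dev K B) : Prop :=
  ∀ (E : EventStr Dev) (A : Set E.Ev) (σ : E.Ev → S) (ρ : E.Ev → Assign Dev K)
    (T : E.Ev → VTree Dev K), IsRun I E A σ (fun ε => e.subst (ρ ε)) T →
    ∃ v T₂ y φ, Loop I E A σ ρ x X Y body h T v T₂ y φ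

theorem IsLoop.rep (x : Var) (e body : Expr Dev K B) :
    IsLoop I x (.nbr (.var x)) (.var x) body 2 (.rep e x body) := by
  intro E A σ ρ T hT
  simp only [Expr.subst] at hT
  obtain ⟨T₂, b, y, hrun, hr₂, hr, hb⟩ := hT.rep
  simp only [Expr.subst_erase_single] at hrun
  have hx : ∀ T', IsRun I E A σ
      (fun ε => (Expr.var x : Expr Dev K B).subst ((ρ ε).set x (.loc (b ε)))) T' →
      ∀ ε ∈ A, (T' ε).root = .loc (b ε) := fun T' hT' ε hε => by
    have h := hT' ε hε
    simp only [Expr.subst, Assign.set, if_true] at h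
    exact h.val_loc_inv
  refine ⟨fun ε => .loc (b ε), T₂, y,
    fun ε δ => if δ = E.dev ε then some (b ε) else (E.pred A ε δ).map b,
    hrun, hr, hr₂, fun T' hT' ε hε => ?_, fun T' hT' ε hε => ⟨b ε, hx T' hT' ε hε, by simp⟩,
    fun G ε hε hag => ?_, fun G ε hε δ => ?_⟩
  · obtain ⟨T₁, l, h1, h2, h3⟩ := IsRun.nbr (e := fun ε =>
      (Expr.var x : Expr Dev K B).subst ((ρ ε).set x (.loc (b ε))))
      (hT'.congr fun _ _ => by simp only [Expr.subst])
    have hl : ∀ ε ∈ A, l ε = b ε := fun ε hε =>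
      Value.loc.inj ((h2 ε hε).symm.trans (hx T₁ h1 ε hε))
    rw [h3 ε hε]
    congr 1
    funext δ
    rw [hl ε hε]
    congr 1
    cases hp : E.pred A ε δ with
    | none => rfl
    | some q => simp [hl q (EventStr.pred_some hp).1]
  · obtain ⟨q, hq⟩ := Option.ne_none_iff_exists'.1 (EventStr.AgreesIn.pred_self_ne_none hag)
    obtain ⟨h1, h2, h3⟩ := EventStr.pred_some hq
    exact ⟨q, .of_nb h1 h2, h3, by simp [hb ε hε q hq]⟩
  · have hadj := hε.1.2.2 δ
    constructor
    · intro l hl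
      by_cases hδ : δ = E.dev ε
      · subst hδ; exact G.refl _ hε.1.2.1
      · rw [if_neg hδ, Option.map_eq_some_iff] at hl
        obtain ⟨q, hq, -⟩ := hl
        exact hadj.1 (by simp [hq])
    · intro ha
      by_cases hδ : δ = E.dev ε
      · subst hδ
        obtain ⟨q, hq⟩ := Option.ne_none_iff_exists'.1 (EventStr.AgreesIn.pred_self_ne_none hε.1.2)
        obtain ⟨h1, h2, h3⟩ := EventStr.pred_some hq
        exact ⟨q, (EventStr.Anc.of_nb h1 h2).mono (by norm_num), h3, by
          rw [if_pos rfl, hb ε hε.1.1 q hq]⟩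
      · obtain ⟨q', hq'⟩ := Option.isSome_iff_exists.1 (hadj.2 ha)
        obtain ⟨h1', h2', h3'⟩ := EventStr.pred_some hq'
        have hag' := hε.2 q' h1' h2'
        obtain ⟨q, hq⟩ := Option.ne_none_iff_exists'.1 (EventStr.AgreesIn.pred_self_ne_none hag'.2)
        obtain ⟨h1, h2, h3⟩ := EventStr.pred_some hq
        refine ⟨q, EventStr.Anc.of_nb_nb h1 h1' h2 h2', h3.trans h3', ?_⟩
        rw [if_neg hδ, hq', Option.map_some, hb q' h1' q hq]

theorem IsLoop.share (x : Var) (e body : Expr Dev K B) :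
    IsLoop I x (.var x) (.app (.builtin .localHood) [.var x]) body 1 (.share e x body) := by
  intro E A σ ρ T hT
  simp only [Expr.subst] at hT
  obtain ⟨T₂, φ, y, hrun, hr₂, hr, hφ⟩ := hT.share
  simp only [Expr.subst_erase_single] at hrun
  have hx : ∀ T', IsRun I E A σ
      (fun ε => (Expr.var x : Expr Dev K B).subst ((ρ ε).set x (.fld (φ ε)))) T' →
      ∀ ε ∈ A, (T' ε).root = .fld (φ ε) := fun T' hT' ε hε => by
    have h := hT' ε hε
    simp only [Expr.subst, Assign.set, if_true] at h
    rw [h.val_fld_inv]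
    congr 1
    funext δ
    unfold Field.restrict
    split_ifs with hd
    · rfl
    · simp only [Set.mem_union, mem_envOf_dom, Set.mem_singleton_iff, not_or] at hd
      exact ((hφ ε hε).2 δ hd.2 (by simpa using hd.1)).symm
  refine ⟨fun ε => .fld (φ ε), T₂, y, φ, hrun, hr, hr₂, hx, fun T' hT' ε hε => ?_,
    fun G ε hε hag => ?_, fun G ε hε δ => ?_⟩
  · simp only [Expr.subst] at hT'
    obtain ⟨Ts, ⟨U, Us, hcons, hU, hUs⟩, -, -, hret⟩ := hT'.app
    have h := hret ε hε
    rw [hcons ε hε, hUs ε hε, List.map_cons, hx U hU ε hε] at h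
    change (φ ε (E.dev ε)).map Value.loc = some _ at h
    rw [Option.map_eq_some_iff] at h
    obtain ⟨l, h1, h2⟩ := h
    exact ⟨l, h2.symm, h1⟩
  · obtain ⟨q, hq⟩ := Option.ne_none_iff_exists'.1 (EventStr.AgreesIn.pred_self_ne_none hag)
    obtain ⟨h1, h2, h3⟩ := EventStr.pred_some hq
    exact ⟨q, .of_nb h1 h2, h3, (hφ ε hε).1 _ q hq⟩
  · have hadj := hε.1.2.2 δ
    constructor
    · intro l hl
      by_cases hδ : δ = E.dev ε
      · subst hδ; exact G.refl _ hε.1.2.1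
      · rw [← hadj, Option.isSome_iff_ne_none]
        intro hn
        rw [(hφ ε hε.1.1).2 δ hδ hn] at hl
        cases hl
    · intro ha
      obtain ⟨q, hq⟩ := Option.isSome_iff_exists.1 (hadj.2 ha)
      obtain ⟨h1, h2, h3⟩ := EventStr.pred_some hq
      exact ⟨q, .of_nb h1 h2, h3, (hφ ε hε.1.1).1 δ q hq⟩

section Patterns

variable {x : Var} {X Y e : Expr Dev K B} {h : ℕ}

theorem iterate_inner_good {E : EventStr Dev} {A : Set E.Ev} {G : NetGraph Dev} {σ : E.Ev → S}
    {ρ : E.Ev → Assign Dev K} {ρl : Dev → Assign Dev K} {C : Set E.Ev} (hh : 1 ≤ h)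
    (hC : C ⊆ good E A Adm G σ ρ ρl) :
    (E.inner A)^[h] C ⊆ E.inner A {ε ∈ A | E.AgreesIn A G ε} :=
  (E.iterate_inner_anti A hh C).trans (E.inner_mono A fun _ hε => ⟨(hC hε).1, (hC hε).2.1⟩)

theorem Value.toLoc_eq_some {v : Value Dev K} {l : Loc K} (h : v.toLoc = some l) : v = .loc l := by
  cases v with
  | loc l' => cases h; rfl
  | fld φ => cases h

/-! ### Converging pattern -/

/-- Once `s` has settled, the distance to the limit decreases along the loop: an event that is off
the limit has an ancestor that is off by more. -/
theorem Settles.converging {f : Fn Dev K B} {Z : Set (Loc K)} {m : MetricSpace Z}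
    (hf : f.Converging I Z m) (hwf : (distances Z m).IsWF) {s : Expr Dev K B}
    {es : List (Expr Dev K B)} (hh : 1 ≤ h)
    (hloop : IsLoop I x X Y (.app f (X :: .nbr s :: es)) h e) (hx : x ∉ s.fv) {n : ℕ∞}
    {l : Lim Dev K} (hs : Settles I Adm N s n l) :
    Settles I Adm N e (n + 1 + h * (distances Z m).encard) l := by
  intro E A G σ ρ ρl T hS hT
  obtain ⟨v, T₂, y, φ, L⟩ := hloop E A σ ρ T hT
  have hrun := L.run
  simp only [Expr.subst] at hrun
  obtain ⟨Ts, ⟨T₃, Ts', hc₃, hT₃, T₄, Ts'', hc₄, hT₄, hTs⟩, -, -, hret⟩ := hrun.app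
  have hR := hS.and_good (hs.nbr E A G σ ρ ρl T₄ hS (hT₄.congr fun ε _ =>
    (Expr.nbr s).subst_set (by simpa only [Expr.fv] using hx) _ _))
  set C := {ε ∈ A | (T₄ ε).root = .fld fun δ' => if G.adj δ' (E.dev ε) then
    (l G ρl δ').toLoc else none} ∩ good E A Adm G σ ρ ρl with hC
  have hconv : ∀ ε ∈ C, ∃ a p : Z, y ε = a ∧ l G ρl (E.dev ε) = .loc p ∧
      (a = p ∨ ∃ (δ' : Dev) (a' q : Z), φ ε δ' = some a'.1 ∧ l G ρl δ' = .loc q ∧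
        m.dist a p < m.dist a' q) := by
    intro ε hε
    have h1 := hret ε hε.2.1
    rw [hc₃ ε hε.2.1, hc₄ ε hε.2.1, List.map_cons, List.map_cons, L.gather T₃ hT₃ ε hε.2.1,
      hε.1.2, L.root_body ε hε.2.1] at h1
    obtain ⟨-, -, a, p, h2, h3, h4⟩ := hf _ _ _ _ _ _ _ h1
    rw [if_pos (G.refl _ hε.2.2.1.1)] at h3
    refine ⟨a, p, Value.loc.inj h2, Value.toLoc_eq_some h3, h4.imp_right ?_⟩
    rintro ⟨δ', a', q, h5, h6, h7⟩
    split_ifs at h6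
    exact ⟨δ', a', q, h5, Value.toLoc_eq_some h6, h7⟩
  -- the distance of the result from the limit; outside `C` these need not be in `Z`, hence the `0`
  let rank : E.Ev → ℝ := fun ε => if hz : y ε ∈ Z ∧ ∃ p : Z, l G ρl (E.dev ε) = .loc p then
    m.dist ⟨y ε, hz.1⟩ hz.2.choose else 0
  have hrank : ∀ ε (a p : Z), y ε = a → l G ρl (E.dev ε) = .loc p → rank ε = m.dist a p := by
    intro ε a p ha hp
    have hz : y ε ∈ Z ∧ ∃ p : Z, l G ρl (E.dev ε) = .loc p := ⟨ha ▸ a.2, p, hp⟩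
    have h1 : hz.2.choose = p := by
      have := hz.2.choose_spec.symm.trans hp
      exact Subtype.ext (Value.loc.inj this)
    simp only [rank]
    rw [dif_pos hz, h1]
    congr 1
    exact Subtype.ext ha
  refine (hR.trans (EventStr.Reach.descent hS.aug (fun _ hε => hε.1.1) hR.finite hh
    (B := {ε | l G ρl (E.dev ε) ≠ .loc (y ε)}) rank (distances Z m) (· < ·)
    ?_ (fun _ _ _ _ _ _ => lt_trans) hwf ?_)).mono_right ?_ fun _ h => h.1
  · intro ε _ hε
    obtain ⟨a, p, h1, h2, -⟩ := hconv ε hε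
    exact ⟨a, p, hrank ε a p h1 h2⟩
  · intro ε hB hε
    have hεC : ε ∈ C := E.iterate_inner_subset A h C hε
    have hin := iterate_inner_good hh (fun _ h => h.2 : C ⊆ good E A Adm G σ ρ ρl) hε
    obtain ⟨a, p, h1, h2, h3⟩ := hconv ε hεC
    rcases h3 with rfl | ⟨δ', a', q, h4, h5, h6⟩
    · exact absurd (by rw [h1]; exact h2) hB
    obtain ⟨r, hr, rfl, hrφ⟩ := (L.field G ε hin δ').2 ((L.field G ε hin δ').1 _ h4)
    have hra : y r = a' := Option.some.inj (hrφ.symm.trans h4)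
    refine ⟨r, fun heq => ?_, hr, ?_⟩
    · have hq : a' = q := by
        rw [h5, hra] at heq
        exact Subtype.ext (Value.loc.inj heq).symm
      subst hq
      have h7 : m.dist a' a' = 0 := m.dist_self a'
      have h8 : 0 ≤ m.dist a p := @dist_nonneg Z m.toPseudoMetricSpace a p
      linarith
    · rw [hrank ε a p h1 h2, hrank r a' q hra h5]
      exact h6
  · rintro ε ⟨hε, hB⟩
    exact ⟨hε.2.1, (L.root ε hε.2.1).trans (not_not.1 hB).symm⟩

/-! ### Acyclic pattern -/

/-- The relation between devices induced by the order of their potentials `p`. -/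
def PotLt (P : DataOrder K) (p : Dev → Value Dev K) (δ' δ : Dev) : Prop :=
  ∃ a b, p δ' = .loc a ∧ p δ = .loc b ∧ P.lt a b

/-- The number of devices of `G` with a lower potential. -/
def potRank (P : DataOrder K) (p : Dev → Value Dev K) (G : NetGraph Dev) (δ : Dev) : ℕ :=
  (G.devs.filter fun δ' => PotLt P p δ' δ).card

theorem potRank_lt_card (P : DataOrder K) (p : Dev → Value Dev K) (G : NetGraph Dev) {δ : Dev}
    (hδ : δ ∈ G.devs) : potRank P p G δ < G.devs.card := by
  refine Finset.card_lt_card ⟨Finset.filter_subset _ _, fun hsub => ?_⟩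
  obtain ⟨-, a, b, h1, h2, h3⟩ := Finset.mem_filter.1 (hsub hδ)
  rw [h1] at h2
  cases h2
  exact P.irrefl _ h3

theorem potRank_lt (P : DataOrder K) (p : Dev → Value Dev K) (G : NetGraph Dev) {δ' δ : Dev}
    (hδ : δ' ∈ G.devs) (hlt : PotLt P p δ' δ) : potRank P p G δ' < potRank P p G δ := by
  obtain ⟨a, b, h1, h2, h3⟩ := hlt
  refine Finset.card_lt_card ⟨fun δ'' hm => ?_, fun hsub => ?_⟩
  · obtain ⟨hd, a', b', h1', h2', h3'⟩ := Finset.mem_filter.1 hm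
    rw [h1] at h2'
    cases h2'
    exact Finset.mem_filter.2 ⟨hd, a', b, h1', h2, P.trans _ _ _ h3' h3⟩
  · have hmem : δ' ∈ G.devs.filter fun δ' => PotLt P p δ' δ :=
      Finset.mem_filter.2 ⟨hδ, a, b, h1, h2, h3⟩
    obtain ⟨-, a', b', h1', h2', h3'⟩ := Finset.mem_filter.1 (hsub hmem)
    rw [h1'] at h2'
    cases h2'
    exact P.irrefl _ h3'

/-- Recursion along a measure, in the form of a fixed-point equation. -/
theorem exists_eq_of_measure {α β : Type*} [Inhabited β] (c : α → ℕ) (Φ : α → (α → β) → β) :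
    ∃ g : α → β, ∀ a, g a = Φ a fun a' => if c a' < c a then g a' else default := by
  let R : α → α → Prop := InvImage (· < ·) c
  have hR : WellFounded R := InvImage.wf _ wellFounded_lt
  refine ⟨hR.fix fun a rec => Φ a fun a' => if h : c a' < c a then rec a' h else default,
    fun a => ?_⟩
  rw [hR.fix_eq]
  congr 1

/-- The field on which `f` operates at the device `δ`, when the results on the neighbours are
given by `g`: the first argument of `f` in the acyclic pattern. -/
def acyclicField (P : DataOrder K) (G : NetGraph Dev) (p : Dev → Value Dev K) (sv : Value Dev K)
    (δ : Dev) (g : Dev → Loc K) : Field Dev K := fun δ' =>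
  if G.adj δ' δ then
    match p δ', p δ with
    | .loc a, .loc b => if P.lt a b then some (g δ') else sv.at δ'
    | _, _ => none
  else none

/-- The limit of the acyclic pattern, by recursion on the potential. -/
theorem exists_acyclic_limit (F : Dev → Set Dev → List (Value Dev K) → Value Dev K)
    (P : DataOrder K) (lp l : Lim Dev K)
    (ls : NetGraph Dev → (Dev → Assign Dev K) → Dev → List (Value Dev K)) :
    ∃ g : NetGraph Dev → (Dev → Assign Dev K) → Dev → Loc K, ∀ G ρl δ,
      g G ρl δ = ((F δ {δ' | G.adj δ' δ} (.fld (acyclicField P G (lp G ρl) (l G ρl δ) δ fun δ' =>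
        if potRank P (lp G ρl) G δ' < potRank P (lp G ρl) G δ then g G ρl δ' else default) ::
          ls G ρl δ)).toLoc).getD default := by
  have := fun G ρl => exists_eq_of_measure (potRank P (lp G ρl) G) fun δ (g : Dev → Loc K) =>
    ((F δ {δ' | G.adj δ' δ} (.fld (acyclicField P G (lp G ρl) (l G ρl δ) δ g) ::
      ls G ρl δ)).toLoc).getD default
  choose g hg using this
  exact ⟨g, hg⟩

/-- After `h * k` rounds, all devices of rank less than `k` have settled: the neighbours with a lower
potential are the only ones whose results matter. -/
theorem Settles.acyclic {f : Fn Dev K B} {P : DataOrder K}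
    {F : Dev → Set Dev → List (Value Dev K) → Value Dev K}
    (hf : ∀ δ Θ, ∀ σ ∈ Adm δ, ∀ vs w, f.Returns I δ Θ σ vs w → w = F δ Θ.dom vs)
    {lim : B → NetGraph Dev → (Dev → List (Value Dev K)) → Dev → Value Dev K}
    {settle : B → ℕ∞} (hB : ∀ b, SelfStabilising I Adm b (lim b) (settle b))
    {p s : Expr Dev K B} {ss : List (Expr Dev K B)} (hh : 1 ≤ h)
    (hloop : IsLoop I x X Y
      (.app f (.app (.builtin .mux) [.app (.builtin (.nbrlt P)) [p], X, s] :: ss)) h e)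
    (hxp : x ∉ p.fv) (hxs : x ∉ s.fv) (hxss : x ∉ Expr.fvList ss) {np n nl : ℕ∞}
    {lp l : Lim Dev K} {ls : NetGraph Dev → (Dev → Assign Dev K) → Dev → List (Value Dev K)}
    (hp : Settles I Adm N p np lp) (hs : Settles I Adm N s n l)
    (hss : SettlesList I Adm N ss nl ls)
    {g : NetGraph Dev → (Dev → Assign Dev K) → Dev → Loc K}
    (hg : ∀ G ρl δ, g G ρl δ =
      ((F δ {δ' | G.adj δ' δ} (.fld (acyclicField P G (lp G ρl) (l G ρl δ) δ fun δ' =>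
        if potRank P (lp G ρl) G δ' < potRank P (lp G ρl) G δ then g G ρl δ' else default) ::
          ls G ρl δ)).toLoc).getD default) :
    Settles I Adm N e (max (np + 1) (max n nl) + h * N) fun G ρl δ => .loc (g G ρl δ) := by
  intro E A G σ ρ ρl T hS hT
  obtain ⟨v, T₂, y, φ, L⟩ := hloop E A σ ρ T hT
  have hrun := L.run
  simp only [Expr.subst] at hrun
  obtain ⟨Ts, ⟨Tm, Ts', hcm, hTm, hTss⟩, -, -, hret⟩ := hrun.app
  simp only [Expr.subst] at hTm
  obtain ⟨Us, ⟨Tβ, Us', hcβ, hTβ, TX, Us'', hcX, hTX, Tσ, Un, hcσ, hTσ, hUn⟩, -, -, hmux⟩ := hTm.app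
  have hRβ :=
    (Settles.builtin hB (.nbrlt P) (SettlesList.cons hp .nil)) E A G σ ρ ρl Tβ hS (hTβ.congr fun ε _ =>
    Expr.subst_set _ (by simpa only [Expr.fv, Expr.fvList, Set.union_empty] using hxp) _ _)
  have hRs := hs E A G σ ρ ρl Tσ hS (hTσ.congr fun ε _ => s.subst_set hxs _ _)
  have hRss := hss E A G σ ρ ρl Ts' hS (hTss.congr fun ε _ => Expr.substList_set ss hxss _ _)
  have hR := hS.and_good (hRβ.inter (hRs.inter hRss))
  set C := ({ε ∈ A | (Tβ ε).root = _} ∩ ({ε ∈ A | (Tσ ε).root = _} ∩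
    {ε ∈ A | (Ts' ε).map VTree.root = _})) ∩ good E A Adm G σ ρ ρl with hC
  have hmuxC : ∀ ε ∈ C, (Tm ε).root = .fld fun δ' =>
      if G.adj δ' (E.dev ε) then
        match lp G ρl δ', lp G ρl (E.dev ε) with
        | .loc a, .loc b => if P.lt a b then φ ε δ' else (l G ρl (E.dev ε)).at δ'
        | _, _ => none
      else none := by
    intro ε hε
    have hA := hε.2.1
    have h1 := hmux ε hA
    rw [hcβ ε hA, hcX ε hA, hcσ ε hA, hUn ε hA] at h1
    simp only [List.map_cons, List.map_nil] at h1
    rw [L.gather TX hTX ε hA, hε.1.1.2, hε.1.2.1.2] at h1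
    simp only [builtinLim] at h1
    have h2 := (Option.some.inj h1).symm
    rw [h2]
    congr 1
    funext δ'
    dsimp only
    by_cases ha : G.adj δ' (E.dev ε)
    · rw [if_pos ha, if_pos ha]
      cases lp G ρl δ' <;> cases lp G ρl (E.dev ε) <;> try rfl
      rename_i a b
      by_cases hab : P.lt a b
      · simp [hab, Loc.ofBool, Value.at]
      · simp [hab, Loc.ofBool, Loc.tt, Loc.ff]
    · rw [if_neg ha, if_neg ha]; rfl
  have hCg : C ⊆ good E A Adm G σ ρ ρl := fun _ h => h.2
  have key : ∀ k, ∀ ε ∈ (E.inner A)^[h * k] C, potRank P (lp G ρl) G (E.dev ε) < k →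
      y ε = g G ρl (E.dev ε) := by
    intro k
    induction k with
    | zero => intro ε _ hlt; exact absurd hlt (Nat.not_lt_zero _)
    | succ k ih =>
      intro ε hε hlt
      have hε' : ε ∈ (E.inner A)^[h] ((E.inner A)^[h * k] C) := by
        rw [← Function.iterate_add_apply, add_comm]; exact hε
      have hεC : ε ∈ C := E.iterate_inner_subset A _ C hε
      have hin := iterate_inner_good hh hCg
        (E.iterate_inner_mono A h (E.iterate_inner_subset A _ C) hε')
      have h1 := hret ε hεC.2.1
      rw [hcm ε hεC.2.1, List.map_cons, hmuxC ε hεC, hεC.1.2.2.2, L.root_body ε hεC.2.1] at h1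
      have h2 := hf _ _ _ hεC.2.2.2.1 _ _ h1
      rw [envOf_dom_of_agrees hεC.2.2.1] at h2
      rw [hg]
      have hfield : (fun δ' =>
          if G.adj δ' (E.dev ε) then
            match lp G ρl δ', lp G ρl (E.dev ε) with
            | .loc a, .loc b => if P.lt a b then φ ε δ' else (l G ρl (E.dev ε)).at δ'
            | _, _ => none
          else none) = acyclicField P G (lp G ρl) (l G ρl (E.dev ε)) (E.dev ε) fun δ' =>
            if potRank P (lp G ρl) G δ' < potRank P (lp G ρl) G (E.dev ε) then g G ρl δ'
            else default := by
        funext δ'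
        unfold acyclicField
        by_cases ha : G.adj δ' (E.dev ε)
        · rw [if_pos ha, if_pos ha]
          cases h3 : lp G ρl δ' with
          | fld _ => rfl
          | loc a =>
            cases h4 : lp G ρl (E.dev ε) with
            | fld _ => rfl
            | loc b =>
              dsimp only
              split_ifs with hab hr
              · obtain ⟨q, hq, rfl, hqφ⟩ := (L.field G ε hin δ').2 ha
                rw [hqφ, ih q (hq _ hε') (by omega)]
              · exact absurd (potRank_lt P (lp G ρl) G (G.adj_mem _ _ ha).1 ⟨a, b, h3, h4, hab⟩) hr
              · rfl
        · rw [if_neg ha, if_neg ha]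
      rw [← hfield, ← h2]
      rfl
  refine (hR.trans (EventStr.Reach.iterate hS.aug (fun _ hε => hε.2.1) hR.finite
    (h * N))).mono_right ?_ (fun _ h => h.1) |>.mono (by push_cast; simp [settleOf])
  intro ε hε
  have hεC : ε ∈ C := E.iterate_inner_subset A _ C hε
  refine ⟨hεC.2.1, ?_⟩
  dsimp only
  rw [L.root ε hεC.2.1, key N ε hε ((potRank_lt_card P _ G hεC.2.2.1.1).trans_le hS.card)]

end Patterns

/-! ### Shortest-path equations -/

/-- The reflexive closure of the order. -/
def DataOrder.le (P : DataOrder K) (a b : Loc K) : Prop := a = b ∨ P.lt a b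

namespace DataOrder

variable {P : DataOrder K} {a b c : Loc K}

theorem le.rfl : P.le a a := Or.inl (Eq.refl a)

theorem le.trans (h : P.le a b) (h' : P.le b c) : P.le a c := by
  rcases h with rfl | h
  · exact h'
  · rcases h' with rfl | h'
    · exact Or.inr h
    · exact Or.inr (P.trans _ _ _ h h')

theorem lt_of_lt_of_le (h : P.lt a b) (h' : P.le b c) : P.lt a c := by
  rcases h' with rfl | h'
  · exact h
  · exact P.trans _ _ _ h h'

theorem lt_of_le_of_lt (h : P.le a b) (h' : P.lt b c) : P.lt a c := by
  rcases h with rfl | h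
  · exact h'
  · exact P.trans _ _ _ h h'

theorem le.not_gt (h : P.le a b) : ¬ P.lt b a := fun h' =>
  P.irrefl _ (lt_of_le_of_lt h h')

theorem le.antisymm (h : P.le a b) (h' : P.le b a) : a = b :=
  h'.elim Eq.symm fun hlt => absurd hlt h.not_gt

theorem le_of_not_gt (hP : TotalNoetherian P.carrier P.lt) (ha : a ∈ P.carrier)
    (hb : b ∈ P.carrier) (h : ¬ P.lt b a) : P.le a b := by
  rcases hP.total a ha b hb with h' | h' | h'
  · exact Or.inl h'
  · exact Or.inr h'
  · exact absurd h' h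

theorem exists_le_of_nonempty (hP : TotalNoetherian P.carrier P.lt) {U : Finset Dev}
    (hU : U.Nonempty) {f : Dev → Loc K} (hf : ∀ δ ∈ U, f δ ∈ P.carrier) :
    ∃ δ₀ ∈ U, ∀ δ ∈ U, P.le (f δ₀) (f δ) := by
  induction hU using Finset.Nonempty.cons_induction with
  | singleton a => exact ⟨a, by simp, fun δ hδ => by rw [Finset.mem_singleton.1 hδ]; exact le.rfl⟩
  | cons a U ha hU ih =>
    obtain ⟨δ₀, h0, hmin⟩ := ih fun δ hδ => hf δ (Finset.mem_cons_of_mem hδ)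
    by_cases h : P.lt (f a) (f δ₀)
    · refine ⟨a, Finset.mem_cons_self a U, fun δ hδ => ?_⟩
      rcases Finset.mem_cons.1 hδ with rfl | hδ
      · exact le.rfl
      · exact Or.inr (lt_of_lt_of_le h (hmin δ hδ))
    · refine ⟨δ₀, Finset.mem_cons_of_mem h0, fun δ hδ => ?_⟩
      rcases Finset.mem_cons.1 hδ with rfl | hδ
      · exact le_of_not_gt hP (hf _ (Finset.mem_cons_of_mem h0)) (hf _ (Finset.mem_cons_self _ U)) h
      · exact hmin δ hδ

end DataOrder

theorem Progressive.le {P : DataOrder K} {F : Loc K → List (Loc K) → Loc K} (hF : Progressive P F)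
    {m a : Loc K} (hm : m ∈ P.carrier) (ha : a ∈ P.carrier) (h : P.le m a) (ls : List (Loc K)) :
    P.le m (F a ls) := by
  rcases (hF a ha ls).2 with h' | h'
  · exact h.trans (Or.inr h')
  · exact h' m hm

/-- The candidates of `δ` in the shortest-path equations: its own source value `s δ`, and the
images under `F` of the values `g δ'` of the devices `δ'` of `U` linked to it. The link from `δ'`
to `δ`, if any, carries the label `w δ δ'`. -/
def candidates (s : Dev → Loc K) (w : Dev → Dev → Option (List (Loc K)))
    (F : Loc K → List (Loc K) → Loc K) (U : Set Dev) (g : Dev → Loc K) (δ : Dev) : Set (Loc K) :=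
  {a | a = s δ ∨ ∃ δ' ∈ U, ∃ ls, w δ δ' = some ls ∧ a = F (g δ') ls}

/-- The shortest-path equations have a solution: a device with the least source value keeps it,
since links do not decrease values, and it may be removed after updating the source values of the
others. -/
theorem exists_shortest_path {P : DataOrder K} (hP : TotalNoetherian P.carrier P.lt)
    {F : Loc K → List (Loc K) → Loc K} (hF : Progressive P F)
    (w : Dev → Dev → Option (List (Loc K))) (n : ℕ) :
    ∀ (U : Finset Dev), U.card = n → ∀ s : Dev → Loc K, (∀ δ ∈ U, s δ ∈ P.carrier) →
      ∃ g : Dev → Loc K, ∀ δ ∈ U, P.IsMin (candidates s w F U g δ) (g δ) ∧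
        ∀ m ∈ P.carrier, (∀ δ' ∈ U, P.le m (s δ')) → P.le m (g δ) := by
  induction n with
  | zero =>
    intro U hU s _
    rw [Finset.card_eq_zero] at hU
    exact ⟨fun _ => default, by simp [hU]⟩
  | succ n ih =>
    intro U hU s hs
    obtain ⟨δ₀, h0, hmin⟩ := DataOrder.exists_le_of_nonempty hP
      (Finset.card_pos.1 (by omega : 0 < U.card)) hs
    have hT0 := hs δ₀ h0
    -- the value that `δ₀` sends over its link to `δ`, or the source value if there is no link
    let via : Dev → Loc K := fun δ => match w δ δ₀ with
      | none => s δ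
      | some ls => F (s δ₀) ls
    let s' : Dev → Loc K := fun δ => if P.lt (via δ) (s δ) then via δ else s δ
    have hvia : ∀ δ ∈ U, via δ ∈ P.carrier ∧ P.le (s δ₀) (via δ) := by
      intro δ hδ
      simp only [via]
      cases w δ δ₀ with
      | none => exact ⟨hs δ hδ, hmin δ hδ⟩
      | some ls => exact ⟨(hF _ hT0 ls).1, hF.le hT0 hT0 DataOrder.le.rfl ls⟩
    have hs' : ∀ δ ∈ U, s' δ ∈ P.carrier ∧ P.le (s δ₀) (s' δ) ∧ P.le (s' δ) (s δ) ∧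
        P.le (s' δ) (via δ) := by
      intro δ hδ
      simp only [s']
      split_ifs with h
      · exact ⟨(hvia δ hδ).1, (hvia δ hδ).2, Or.inr h, DataOrder.le.rfl⟩
      · exact ⟨hs δ hδ, hmin δ hδ, DataOrder.le.rfl,
          DataOrder.le_of_not_gt hP (hs δ hδ) (hvia δ hδ).1 h⟩
    obtain ⟨g, hg⟩ := ih (U.erase δ₀) (by rw [Finset.card_erase_of_mem h0]; omega) s'
      fun δ hδ => (hs' δ (Finset.mem_of_mem_erase hδ)).1
    have hge : ∀ δ ∈ U.erase δ₀, g δ ∈ P.carrier ∧ P.le (s δ₀) (g δ) := fun δ hδ =>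
      ⟨(hg δ hδ).1.1 (hg δ hδ).1.2.1,
        (hg δ hδ).2 _ hT0 fun δ' hδ' => (hs' δ' (Finset.mem_of_mem_erase hδ')).2.1⟩
    let g' : Dev → Loc K := Function.update g δ₀ (s δ₀)
    have hg'0 : g' δ₀ = s δ₀ := Function.update_self ..
    have hg'1 : ∀ δ ∈ U.erase δ₀, g' δ = g δ := fun δ hδ =>
      Function.update_of_ne (Finset.ne_of_mem_erase hδ) _ _
    have hg' : ∀ δ ∈ U, g' δ ∈ P.carrier ∧ P.le (s δ₀) (g' δ) := by
      intro δ hδ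
      by_cases hd : δ = δ₀
      · subst hd; rw [hg'0]; exact ⟨hT0, DataOrder.le.rfl⟩
      · have := Finset.mem_erase.2 ⟨hd, hδ⟩
        rw [hg'1 δ this]; exact hge δ this
    refine ⟨g', fun δ hδ => ⟨⟨?_, ?_, ?_⟩, fun m hm hle => (hle δ₀ h0).trans (hg' δ hδ).2⟩⟩
    · rintro a (rfl | ⟨δ', hδ', ls, -, rfl⟩)
      · exact hs δ hδ
      · exact (hF _ (hg' δ' hδ').1 ls).1
    · by_cases hd : δ = δ₀
      · subst hd; rw [hg'0]; exact Or.inl rfl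
      · have hδe := Finset.mem_erase.2 ⟨hd, hδ⟩
        rw [hg'1 δ hδe]
        rcases (hg δ hδe).1.2.1 with h | ⟨δ', hδ', ls, h1, h2⟩
        · rw [h]
          simp only [s']
          split_ifs with hlt
          · simp only [via] at hlt ⊢
            cases hw : w δ δ₀ with
            | none => rw [hw] at hlt; exact absurd hlt (P.irrefl _)
            | some ls => exact Or.inr ⟨δ₀, h0, ls, hw, by rw [hg'0]⟩
          · exact Or.inl rfl
        · exact Or.inr ⟨δ', Finset.mem_of_mem_erase hδ', ls, h1, by rw [hg'1 δ' hδ', h2]⟩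
    · suffices h : ∀ a ∈ candidates s w F U g' δ, P.le (g' δ) a from
        fun a ha => (h a ha).imp_left Eq.symm
      by_cases hd : δ = δ₀
      · subst hd
        rw [hg'0]
        rintro a (rfl | ⟨δ', hδ', ls, -, rfl⟩)
        · exact DataOrder.le.rfl
        · exact hF.le hT0 (hg' δ' hδ').1 (hg' δ' hδ').2 ls
      · have hδe := Finset.mem_erase.2 ⟨hd, hδ⟩
        rw [hg'1 δ hδe]
        have hle : ∀ a ∈ candidates s' w F (U.erase δ₀ : Finset Dev) g δ, P.le (g δ) a :=
          fun a ha => ((hg δ hδe).1.2.2 a ha).imp_left Eq.symm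
        have hle' : P.le (g δ) (s' δ) := hle _ (Or.inl rfl)
        rintro a (rfl | ⟨δ', hδ', ls, h1, rfl⟩)
        · exact hle'.trans (hs' δ hδ).2.2.1
        · by_cases hd' : δ' = δ₀
          · subst hd'
            have h2 := (hs' δ hδ).2.2.2
            simp only [via, h1] at h2
            rw [hg'0]
            exact hle'.trans h2
          · have hδe' := Finset.mem_erase.2 ⟨hd', hδ'⟩
            rw [hg'1 δ' hδe']
            exact hle _ (Or.inr ⟨δ', hδe', ls, h1, rfl⟩)

/-! ### Settling of the minimising loop -/

section Minimising

variable {E : EventStr Dev} {A : Set E.Ev}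

/-- What the minimising loop does at the event `ε`. The value `l₁` is the minimum of the source
value and of the candidates coming from the neighbours, whose values are at most `h` rounds old;
the value `l₂` is the previous result; the result `y ε` is combined from them by a raising
function. -/
structure MinStep (E : EventStr Dev) (A : Set E.Ev) (P : DataOrder K)
    (tri : Loc K → Loc K → Prop) (F : Loc K → List (Loc K) → Loc K) (s : Dev → Loc K)
    (w : Dev → Dev → Option (List (Loc K))) (h : ℕ) (y : E.Ev → Loc K) (ε : E.Ev)
    (l₁ l₂ : Loc K) : Prop where
  mem : l₁ ∈ P.carrier
  le_source : P.le l₁ (s (E.dev ε))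
  le_link : ∀ δ' ls, w (E.dev ε) δ' = some ls →
    ∃ q, E.Anc A h q ε ∧ E.dev q = δ' ∧ P.le l₁ (F (y q) ls)
  attained : l₁ = s (E.dev ε) ∨ ∃ q ls, E.Anc A h q ε ∧
    w (E.dev ε) (E.dev q) = some ls ∧ l₁ = F (y q) ls
  prev : ∃ q, E.Anc A 1 q ε ∧ E.dev q = E.dev ε ∧ l₂ = y q
  eq : l₁ = l₂ → y ε = l₁
  ge : P.le l₁ (y ε) ∨ P.le l₂ (y ε)
  raise : tri l₂ (y ε) ∨ y ε = l₁

variable {P : DataOrder K} {tri : Loc K → Loc K → Prop} {F : Loc K → List (Loc K) → Loc K}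
  {s : Dev → Loc K} {w : Dev → Dev → Option (List (Loc K))} {h : ℕ} {y : E.Ev → Loc K}
  {g : Dev → Loc K} {G : NetGraph Dev} {C : Set E.Ev}

/-- Let `U` be the devices that are not yet settled, and `m` a lower bound of their limits. Below
`m` the values can only rise: a value below `m` is larger than some earlier value. -/
theorem reach_rise (hE : E.IsAugmented) (hh : 1 ≤ h) (hP : TotalNoetherian P.carrier P.lt)
    (htri : TotalNoetherian P.carrier tri) (hF : Progressive P F)
    (hg : ∀ δ ∈ G.devs, P.IsMin (candidates s w F G.devs g δ) (g δ))
    (hw : ∀ δ δ' ls, w δ δ' = some ls → δ' ∈ G.devs)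
    (hCA : C ⊆ A) (hf : (A \ C).Finite) (hdev : ∀ ε ∈ C, E.dev ε ∈ G.devs ∧ y ε ∈ P.carrier)
    (hstep : ∀ ε ∈ (E.inner A)^[h] C, ∃ l₁ l₂, MinStep E A P tri F s w h y ε l₁ l₂)
    {U : Finset Dev} {V : Set (Loc K)} (hV : V ⊆ P.carrier)
    (hset : ∀ ε ∈ C, E.dev ε ∉ U → y ε = g (E.dev ε)) (hUV : ∀ ε ∈ C, E.dev ε ∈ U → y ε ∈ V)
    {m : Loc K} (hm : m ∈ P.carrier) (hmin : ∀ δ ∈ U, P.le m (g δ)) :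
    E.Reach A (h * {v ∈ V | P.lt v m}.encard) C (C \ {ε | E.dev ε ∈ U ∧ P.lt (y ε) m}) := by
  refine EventStr.Reach.descent hE hCA hf hh y _ (fun a b => P.lt b a)
    (fun ε hB hε => ⟨hUV ε hε hB.1, hB.2⟩) (fun a _ b _ c _ h1 h2 => P.trans _ _ _ h2 h1)
    ?_ ?_
  · exact Subrelation.wf (r := InvImage (fun a b : P.carrier => P.lt b a)
      fun v : {v ∈ V | P.lt v m} => ⟨v.1, hV v.2.1⟩) (fun h => h) (InvImage.wf _ hP.noetherian)
  · rintro ε ⟨hU, hlt⟩ hε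
    obtain ⟨l₁, l₂, M⟩ := hstep ε hε
    have hεC := E.iterate_inner_subset A h C hε
    -- otherwise no earlier value of an unsettled device is below `y ε`, and `l₁` exceeds `y ε`
    by_contra hno
    have hq : ∀ q, E.Anc A h q ε → E.dev q ∈ U → P.le (y ε) (y q) := fun q ha hd =>
      DataOrder.le_of_not_gt hP (hdev ε hεC).2 (hdev q (ha C hε)).2 fun hl =>
        hno ⟨q, ⟨hd, P.trans _ _ _ hl hlt⟩, ha, hl⟩
    have hcand : ∀ a ∈ candidates s w F G.devs g (E.dev ε), P.lt (y ε) a := fun a ha =>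
      DataOrder.lt_of_lt_of_le hlt ((hmin _ hU).trans
        (((hg _ (hdev ε hεC).1).2.2 a ha).imp_left Eq.symm))
    have hl₁ : P.lt (y ε) l₁ := by
      rcases M.attained with h1 | ⟨q, ls, ha, hwq, h1⟩
      · exact hcand _ (Or.inl h1)
      · rw [h1]
        by_cases hqU : E.dev q ∈ U
        · rcases (hF _ (hdev q (ha C hε)).2 ls).2 with h2 | h2
          · exact DataOrder.lt_of_le_of_lt (hq q ha hqU) h2
          · exact DataOrder.lt_of_lt_of_le hlt (h2 m hm)
        · rw [hset q (ha C hε) hqU]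
          exact hcand _ (Or.inr ⟨_, hw _ _ _ hwq, ls, hwq, rfl⟩)
    obtain ⟨q, ha, hd, hl₂⟩ := M.prev
    have hl₂' : P.le (y ε) l₂ := hl₂ ▸ hq q (ha.mono hh) (hd ▸ hU)
    have heq : l₂ = y ε := by
      rcases M.ge with h1 | h1
      · exact absurd hl₁ h1.not_gt
      · exact h1.antisymm hl₂'
    rcases M.raise with h1 | h1
    · rw [heq] at h1
      exact htri.irrefl _ (hdev ε hεC).2 h1
    · rw [h1] at hl₁
      exact P.irrefl _ hl₁

/-- When no unsettled device has a value below the least limit `g δ₀` of such a device, the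
candidate `l₁` of `δ₀` equals this limit within `h` rounds. From then on the results of `δ₀`
increase with respect to `tri` until they reach it. -/
theorem reach_settle (hE : E.IsAugmented)
    (htri : TotalNoetherian P.carrier tri) (hF : Progressive P F)
    (hg : ∀ δ ∈ G.devs, P.IsMin (candidates s w F G.devs g δ) (g δ))
    (hw : ∀ δ δ' ls, w δ δ' = some ls → δ' ∈ G.devs)
    (hCA : C ⊆ A) (hf : (A \ C).Finite) (hdev : ∀ ε ∈ C, E.dev ε ∈ G.devs ∧ y ε ∈ P.carrier)
    (hstep : ∀ ε ∈ (E.inner A)^[h] C, ∃ l₁ l₂, MinStep E A P tri F s w h y ε l₁ l₂)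
    {U : Finset Dev} (hU : U ⊆ G.devs) (hset : ∀ ε ∈ C, E.dev ε ∉ U → y ε = g (E.dev ε))
    {δ₀ : Dev} (h0 : δ₀ ∈ U) (hmin : ∀ δ ∈ U, P.le (g δ₀) (g δ))
    (hlow : ∀ ε ∈ C, E.dev ε ∈ U → P.le (g δ₀) (y ε)) :
    E.Reach A (h + P.carrier.encard) C
      ((E.inner A)^[h] C \ {ε | E.dev ε = δ₀ ∧ y ε ≠ g δ₀}) := by
  have hg0 := hg δ₀ (hU h0)
  have hT0 : g δ₀ ∈ P.carrier := hg0.1 hg0.2.1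
  have hmin0 : ∀ a ∈ candidates s w F G.devs g δ₀, P.le (g δ₀) a := fun a ha =>
    (hg0.2.2 a ha).imp_left Eq.symm
  -- the candidate attaining the minimum `g δ₀` comes from a settled device, or is the source value,
  -- unless `g δ₀` is the maximum of the type
  have hl₁ : ∀ ε ∈ (E.inner A)^[h] C, E.dev ε = δ₀ → ∀ l₁ l₂,
      MinStep E A P tri F s w h y ε l₁ l₂ → l₁ = g δ₀ := by
    rintro ε hε rfl l₁ l₂ M
    refine DataOrder.le.antisymm (P := P) ?_ ?_
    · rcases hg0.2.1 with h1 | ⟨δ', hδ', ls, h1, h2⟩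
      · rw [h1]; exact M.le_source
      · obtain ⟨q, ha, rfl, hle⟩ := M.le_link δ' ls h1
        by_cases hqU : E.dev q ∈ U
        · rcases (hF _ ((hg _ hδ').1 (hg _ hδ').2.1) ls).2 with h3 | h3
          · rw [← h2] at h3
            exact absurd h3 (hmin _ hqU).not_gt
          · rw [← h2] at h3
            exact h3 _ M.mem
        · rw [hset q (ha C hε) hqU, ← h2] at hle
          exact hle
    · rcases M.attained with h1 | ⟨q, ls, ha, hwq, h1⟩
      · exact hmin0 _ (Or.inl h1)
      · rw [h1]
        by_cases hqU : E.dev q ∈ U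
        · exact hF.le hT0 (hdev q (ha C hε)).2 (hlow q (ha C hε) hqU) ls
        · rw [hset q (ha C hε) hqU]
          exact hmin0 _ (Or.inr ⟨_, hw _ _ _ hwq, ls, hwq, rfl⟩)
  have hD := EventStr.Reach.iterate hE hCA hf h
  refine hD.trans ((EventStr.Reach.descent hE hD.subset hD.finite le_rfl y P.carrier
    (fun a b => tri b a) (fun ε _ hε => (hdev ε (E.iterate_inner_subset A h C hε)).2)
    (fun a ha b hb c hc h1 h2 => htri.trans _ hc _ hb _ ha h2 h1) htri.noetherian ?_).mono ?_)
  · rintro ε ⟨hd, hne⟩ hε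
    have hεD := E.iterate_inner_subset A 1 _ hε
    obtain ⟨l₁, l₂, M⟩ := hstep ε hεD
    have h1 := hl₁ ε hεD hd l₁ l₂ M
    obtain ⟨q, ha, hdq, rfl⟩ := M.prev
    refine ⟨q, ⟨hdq.trans hd, fun hq => hne ?_⟩, ha, ?_⟩
    · rw [M.eq (h1.trans hq.symm), h1]
    · rcases M.raise with h2 | h2
      · exact h2
      · exact absurd (h2.trans h1) hne
  · simp

/-- The devices settle one after the other, in the order of their limits: the values of the
unsettled devices first rise to the least limit `g δ₀` of such a device, and then `δ₀` settles.
The rising phases together pass at most once over each value, and a settling phase takes at most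
`h + |T|` rounds. -/
theorem reach_minimum (hE : E.IsAugmented) (hh : 1 ≤ h) (hP : TotalNoetherian P.carrier P.lt)
    (htri : TotalNoetherian P.carrier tri) (hF : Progressive P F)
    (hg : ∀ δ ∈ G.devs, P.IsMin (candidates s w F G.devs g δ) (g δ))
    (hw : ∀ δ δ' ls, w δ δ' = some ls → δ' ∈ G.devs) (n : ℕ) :
    ∀ (U : Finset Dev), U.card = n → U ⊆ G.devs → ∀ V ⊆ P.carrier, ∀ C ⊆ A, (A \ C).Finite →
    (∀ ε ∈ C, E.dev ε ∈ G.devs ∧ y ε ∈ P.carrier) →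
    (∀ ε ∈ (E.inner A)^[h] C, ∃ l₁ l₂, MinStep E A P tri F s w h y ε l₁ l₂) →
    (∀ ε ∈ C, E.dev ε ∉ U → y ε = g (E.dev ε)) → (∀ ε ∈ C, E.dev ε ∈ U → y ε ∈ V) →
    E.Reach A (h * V.encard + n * (h + P.carrier.encard)) C {ε ∈ A | y ε = g (E.dev ε)} := by
  induction n with
  | zero =>
    intro U hUn _ V _ C hCA hf _ _ hset _
    rw [Finset.card_eq_zero] at hUn
    exact (EventStr.Reach.refl hCA hf _).mono_right
      (fun ε hε => ⟨hCA hε, hset ε hε (by simp [hUn])⟩) fun _ h => h.1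
  | succ n ih =>
    intro U hUn hU V hV C hCA hf hdev hstep hset hUV
    have hgT : ∀ δ ∈ U, g δ ∈ P.carrier := fun δ hδ => (hg δ (hU hδ)).1 (hg δ (hU hδ)).2.1
    obtain ⟨δ₀, h0, hmin⟩ := DataOrder.exists_le_of_nonempty hP
      (Finset.card_pos.1 (by omega : 0 < U.card)) hgT
    have hrise := reach_rise hE hh hP htri hF hg hw hCA hf hdev hstep hV hset hUV (hgT δ₀ h0) hmin
    set C₁ := C \ {ε | E.dev ε ∈ U ∧ P.lt (y ε) (g δ₀)} with hC₁
    have hC₁C : C₁ ⊆ C := fun _ h => h.1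
    have hstep₁ := fun ε hε => hstep ε (E.iterate_inner_mono A h hC₁C hε)
    have hset₁ : ∀ ε ∈ C₁, E.dev ε ∉ U → y ε = g (E.dev ε) := fun ε hε => hset ε hε.1
    have hsettle := reach_settle hE htri hF hg hw hrise.subset hrise.finite
      (fun ε hε => hdev ε hε.1) hstep₁ hU hset₁ h0 hmin fun ε hε hεU =>
        DataOrder.le_of_not_gt hP (hgT δ₀ h0) (hdev ε hε.1).2 fun hlt => hε.2 ⟨hεU, hlt⟩
    set C₂ := (E.inner A)^[h] C₁ \ {ε | E.dev ε = δ₀ ∧ y ε ≠ g δ₀} with hC₂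
    have hC₂C : C₂ ⊆ C₁ := fun _ hε => E.iterate_inner_subset A h _ hε.1
    have hrest := ih (U.erase δ₀) (by rw [Finset.card_erase_of_mem h0]; omega)
      ((Finset.erase_subset _ _).trans hU) {v ∈ V | ¬ P.lt v (g δ₀)} (fun _ h => hV h.1) C₂
      hsettle.subset hsettle.finite (fun ε hε => hdev ε (hC₁C (hC₂C hε)))
      (fun ε hε => hstep₁ ε (E.iterate_inner_mono A h hC₂C hε)) (fun ε hε hd => ?_)
      fun ε hε hd => ⟨hUV ε (hC₁C (hC₂C hε)) (Finset.mem_of_mem_erase hd),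
        fun hlt => (hC₂C hε).2 ⟨Finset.mem_of_mem_erase hd, hlt⟩⟩
    · refine (hrise.trans (hsettle.trans hrest)).mono (le_of_eq ?_)
      have hsplit : {v ∈ V | P.lt v (g δ₀)}.encard + {v ∈ V | ¬ P.lt v (g δ₀)}.encard =
          V.encard := by
        rw [← Set.encard_union_eq]
        · congr 1
          ext v
          by_cases hv : P.lt v (g δ₀) <;> simp [hv]
        · exact Set.disjoint_left.2 fun v h1 h2 => h2.2 h1.2
      rw [← hsplit]
      push_cast
      ring
    · by_cases hd0 : E.dev ε = δ₀
      · by_contra hne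
        exact hε.2 ⟨hd0, by rw [← hd0]; exact hne⟩
      · exact hset₁ ε (hC₂C hε) fun hdU => hd (Finset.mem_erase.2 ⟨hd0, hdU⟩)

end Minimising

/-! ### Minimising pattern -/

theorem minHoodLocOp_some {P : DataOrder K} {δ : Dev} {v₁ v₂ u : Value Dev K}
    (h : minHoodLocOp P δ [v₁, v₂] = some u) : ∃ φ l m, v₁ = .fld φ ∧ v₂ = .loc l ∧ u = .loc m ∧
      P.IsMin (minHoodRange δ φ l) m := by
  cases v₁ with
  | loc _ => simp [minHoodLocOp] at h
  | fld φ =>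
    cases v₂ with
    | fld _ => simp [minHoodLocOp] at h
    | loc l =>
      simp only [minHoodLocOp] at h
      split_ifs at h with hex
      exact ⟨φ, l, hex.choose, rfl, rfl, (Option.some.inj h).symm, hex.choose_spec⟩

theorem mem_minHoodRange {δ : Dev} {φ : Field Dev K} {l a : Loc K} :
    a ∈ minHoodRange δ φ l ↔ a = l ∨ ∃ δ', δ' ≠ δ ∧ φ δ' = some a := by
  constructor
  · rintro ⟨δ', h⟩
    by_cases hd : δ' = δ
    · subst hd
      rw [Function.update_self] at h
      exact Or.inl (Option.some.inj h).symm
    · rw [Function.update_of_ne hd] at h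
      exact Or.inr ⟨δ', hd, h⟩
  · rintro (rfl | ⟨δ', hd, h⟩)
    · exact ⟨δ, Function.update_self ..⟩
    · exact ⟨δ', by rw [Function.update_of_ne hd]; exact h⟩

/-- The label of the link from `δ'` to `δ`: the arguments, in the application on `δ`, of the
function that carries values from `δ'` to `δ`. -/
def linkLabel (G : NetGraph Dev) (vs : Dev → List (Value Dev K)) (δ δ' : Dev) :
    Option (List (Loc K)) :=
  if δ' ≠ δ ∧ G.adj δ' δ then (vs δ).mapM (Value.at δ') else none

/-- The source value of `δ`, when the source expression has the limit `v`. -/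
def sourceValue (v : Dev → Value Dev K) (δ : Dev) : Loc K := (v δ).toLoc.getD default

/-- The limit of the minimising pattern: a solution of the shortest-path equations. -/
theorem exists_minimising_limit {P : DataOrder K} (hP : TotalNoetherian P.carrier P.lt)
    {F : Loc K → List (Loc K) → Loc K} (hF : Progressive P F) (l : Lim Dev K)
    (ls : NetGraph Dev → (Dev → Assign Dev K) → Dev → List (Value Dev K)) :
    ∃ g : NetGraph Dev → (Dev → Assign Dev K) → Dev → Loc K, ∀ G ρl,
      (∀ δ ∈ G.devs, sourceValue (l G ρl) δ ∈ P.carrier) → ∀ δ ∈ G.devs,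
        P.IsMin (candidates (sourceValue (l G ρl)) (linkLabel G (ls G ρl)) F G.devs (g G ρl) δ)
          (g G ρl δ) := by
  have : ∀ (G : NetGraph Dev) (ρl : Dev → Assign Dev K), ∃ g : Dev → Loc K,
      (∀ δ ∈ G.devs, sourceValue (l G ρl) δ ∈ P.carrier) → ∀ δ ∈ G.devs,
        P.IsMin (candidates (sourceValue (l G ρl)) (linkLabel G (ls G ρl)) F G.devs g δ)
          (g δ) := by
    intro G ρl
    by_cases hs : ∀ δ ∈ G.devs, sourceValue (l G ρl) δ ∈ P.carrier
    · obtain ⟨g, hg⟩ := exists_shortest_path hP hF (linkLabel G (ls G ρl)) _ G.devs rfl _ hs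
      exact ⟨g, fun _ δ hδ => (hg δ hδ).1⟩
    · exact ⟨fun _ => default, fun h => absurd h hs⟩
  choose g hg using this
  exact ⟨g, hg⟩

/-- The body of the loop performs a step of the kind described by `MinStep`, so that
`reach_minimum` applies as soon as `s` and `ss` have settled. -/
theorem Settles.minimising {x : Var} {X Y e : Expr Dev K B} {h : ℕ} {fR fMP : Fn Dev K B}
    {P : DataOrder K} {tri : Loc K → Loc K → Prop} {F : Loc K → List (Loc K) → Loc K}
    (hP : TotalNoetherian P.carrier P.lt) (htri : TotalNoetherian P.carrier tri)
    (hMP : fMP.Promotes I P.carrier F) (hF : Progressive P F) (hfR : fR.Raising I P tri)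
    {s : Expr Dev K B} {ss es : List (Expr Dev K B)} (hh : 1 ≤ h)
    (hloop : IsLoop I x X Y
      (.app fR (.app (.builtin (.minHoodLoc P)) [.app fMP (X :: ss), s] :: Y :: es)) h e)
    (hxs : x ∉ s.fv) (hxss : x ∉ Expr.fvList ss) {n nl : ℕ∞} {l : Lim Dev K}
    {ls : NetGraph Dev → (Dev → Assign Dev K) → Dev → List (Value Dev K)}
    (hs : Settles I Adm N s n l) (hss : SettlesList I Adm N ss nl ls)
    {g : NetGraph Dev → (Dev → Assign Dev K) → Dev → Loc K}
    (hg : ∀ G ρl, (∀ δ ∈ G.devs, sourceValue (l G ρl) δ ∈ P.carrier) → ∀ δ ∈ G.devs,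
      P.IsMin (candidates (sourceValue (l G ρl)) (linkLabel G (ls G ρl)) F G.devs (g G ρl) δ)
        (g G ρl δ)) :
    Settles I Adm N e (max n nl + (h * P.carrier.encard + N * (h + P.carrier.encard)))
      fun G ρl δ => .loc (g G ρl δ) := by
  intro E A G σ ρ ρl T hS hT
  obtain ⟨v, T₂, y, φ, L⟩ := hloop E A σ ρ T hT
  have hrun := L.run
  simp only [Expr.subst] at hrun
  obtain ⟨Ts, ⟨Tm, Ts', hcm, hTm, TY, Ts'', hcY, hTY, -⟩, -, -, hret⟩ := hrun.app
  simp only [Expr.subst] at hTm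
  obtain ⟨Us, ⟨Tf, Us', hcf, hTf, Tσ, Un, hcσ, hTσ, hUn⟩, -, -, hmin⟩ := hTm.app
  simp only [Expr.subst] at hTf
  obtain ⟨Vs, ⟨TX, Vs', hcX, hTX, hTss⟩, -, -, hprom⟩ := hTf.app
  have hRs := hs E A G σ ρ ρl Tσ hS (hTσ.congr fun ε _ => s.subst_set hxs _ _)
  have hRss := hss E A G σ ρ ρl Vs' hS (hTss.congr fun ε _ => Expr.substList_set ss hxss _ _)
  have hR := hS.and_good (hRs.inter hRss)
  set C := ({ε ∈ A | (Tσ ε).root = l G ρl (E.dev ε)} ∩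
    {ε ∈ A | (Vs' ε).map VTree.root = ls G ρl (E.dev ε)}) ∩ good E A Adm G σ ρ ρl with hC
  have hCg : C ⊆ good E A Adm G σ ρ ρl := fun _ h => h.2
  -- one application of the body, in terms of the limits of `s` and `ss`
  have hbody : ∀ ε ∈ C, ∃ l₁ l₂,
      P.IsMin (minHoodRange (E.dev ε) (fun δ' => (φ ε δ').bind fun a =>
        ((ls G ρl (E.dev ε)).mapM (Value.at δ')).map (F a)) (sourceValue (l G ρl) (E.dev ε))) l₁ ∧
      φ ε (E.dev ε) = some l₂ ∧ y ε ∈ P.carrier ∧ (l₁ = l₂ → y ε = l₁) ∧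
      (P.le l₁ (y ε) ∨ P.le l₂ (y ε)) ∧ (tri l₂ (y ε) ∨ y ε = l₁) := by
    intro ε hε
    have hA := hε.2.1
    have h1 := hprom ε hA
    rw [hcX ε hA, List.map_cons, L.gather TX hTX ε hA, hε.1.2.2] at h1
    obtain ⟨-, h2⟩ := hMP _ _ _ _ _ _ h1
    have h3 := hmin ε hA
    rw [hcf ε hA, hcσ ε hA, hUn ε hA] at h3
    simp only [List.map_cons, List.map_nil] at h3
    rw [hε.1.1.2, h2] at h3
    obtain ⟨ψ, a, l₁, h4, h5, h6, h7⟩ := minHoodLocOp_some h3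
    obtain ⟨l₂, h8, h9⟩ := L.own TY hTY ε hA
    have h10 := hret ε hA
    rw [hcm ε hA, hcY ε hA, List.map_cons, List.map_cons, h6, h8, L.root_body ε hA] at h10
    obtain ⟨-, -, b, hb, h11, h12, h13, h14⟩ := hfR _ _ _ _ _ _ _ h10
    cases Value.loc.inj h11
    refine ⟨l₁, l₂, ?_, h9, hb, h12, h13, h14⟩
    rw [Value.fld.inj h4, sourceValue, h5]
    exact h7
  have hsource : ∀ δ ∈ G.devs, sourceValue (l G ρl) δ ∈ P.carrier := by
    intro δ hδ
    have hinf := (hS.lim.devs δ).1 hδ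
    obtain ⟨ε, hε, hεC⟩ := (hinf.sdiff hR.finite).nonempty
    have hεC' : ε ∈ C := by
      by_contra hn
      exact hεC ⟨hε.1, hn⟩
    obtain ⟨l₁, l₂, h1, -⟩ := hbody ε hεC'
    rw [← hε.2]
    exact h1.1 (mem_minHoodRange.2 (Or.inl rfl))
  have hdev : ∀ ε ∈ C, E.dev ε ∈ G.devs ∧ y ε ∈ P.carrier := fun ε hε => by
    obtain ⟨_, _, -, -, h1, -⟩ := hbody ε hε
    exact ⟨hε.2.2.1.1, h1⟩
  have hstep : ∀ ε ∈ (E.inner A)^[h] C, ∃ l₁ l₂, MinStep E A P tri F (sourceValue (l G ρl))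
      (linkLabel G (ls G ρl)) h y ε l₁ l₂ := by
    intro ε hε
    have hεC := E.iterate_inner_subset A h C hε
    have hin := iterate_inner_good hh hCg hε
    obtain ⟨l₁, l₂, hm, hl₂, -, heq, hge, hraise⟩ := hbody ε hεC
    have hle : ∀ a ∈ minHoodRange (E.dev ε) _ (sourceValue (l G ρl) (E.dev ε)), P.le l₁ a :=
      fun a ha => (hm.2.2 a ha).imp_left Eq.symm
    refine ⟨l₁, l₂, hm.1 hm.2.1, hle _ (mem_minHoodRange.2 (Or.inl rfl)), fun δ' lb hlb => ?_,
      ?_, ?_, heq, hge, hraise⟩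
    · unfold linkLabel at hlb
      split_ifs at hlb with hc
      obtain ⟨q, ha, hd, hq⟩ := (L.field G ε hin δ').2 hc.2
      refine ⟨q, ha, hd, hle _ (mem_minHoodRange.2 (Or.inr ⟨δ', hc.1, ?_⟩))⟩
      rw [hq, Option.bind_some, hlb, Option.map_some]
    · rcases mem_minHoodRange.1 hm.2.1 with h1 | ⟨δ', hne, h1⟩
      · exact Or.inl h1
      · rw [Option.bind_eq_some_iff] at h1
        obtain ⟨b, hb, h2⟩ := h1
        rw [Option.map_eq_some_iff] at h2
        obtain ⟨lb, hlb, h3⟩ := h2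
        have hadj := (L.field G ε hin δ').1 b hb
        obtain ⟨q, ha, rfl, hq⟩ := (L.field G ε hin δ').2 hadj
        refine Or.inr ⟨q, lb, ha, ?_, ?_⟩
        · rw [linkLabel, if_pos ⟨hne, hadj⟩, hlb]
        · rw [← h3, ← Option.some.inj (hb.symm.trans hq)]
    · obtain ⟨q, ha, hd, hq⟩ := L.prev G ε hεC.2.1 hεC.2.2.1
      exact ⟨q, ha, hd, Option.some.inj (hl₂.symm.trans hq)⟩
  have hmain := reach_minimum hS.aug hh hP htri hF (hg G ρl hsource) (fun δ δ' lb hlb => by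
    unfold linkLabel at hlb
    split_ifs at hlb with hc
    exact (G.adj_mem _ _ hc.2).1) _ G.devs rfl subset_rfl P.carrier subset_rfl C hR.subset hR.finite
    hdev hstep (fun ε hε hn => absurd (hdev ε hε).1 hn) fun ε hε _ => (hdev ε hε).2
  refine ((hR.trans hmain).mono ?_).mono_right (fun ε hε => ⟨hε.1, ?_⟩) fun _ h => h.1
  · have := hS.card
    gcongr
  · rw [L.root ε hε.1, hε.2]

/-! ### The fragment -/

mutual

/-- Both an expression of the fragment and its translation settle to the same limit, because the two
forms of each pattern are loops with the same body, that differ in the age of the data only. -/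
theorem Fragment.settles
    {lim : B → NetGraph Dev → (Dev → List (Value Dev K)) → Dev → Value Dev K}
    {settle : B → ℕ∞} (hB : ∀ b, SelfStabilising I Adm b (lim b) (settle b))
    {s s' : Expr Dev K B} {nr ns : ℕ∞} : Fragment I Adm settle N s s' nr ns →
      ns ≤ nr ∧ ∃ l, Settles I Adm N s nr l ∧ Settles I Adm N s' ns l
  | .var x => ⟨le_rfl, _, .var x, .var x⟩
  | .val v => ⟨le_rfl, _, .val v, .val v⟩
  | .letE h₁ h₂ => by
    obtain ⟨le₁, l₁, h₁, h₁'⟩ := h₁.settles hB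
    obtain ⟨le₂, l₂, h₂, h₂'⟩ := h₂.settles hB
    exact ⟨by gcongr, _, h₁.letE h₂, h₁'.letE h₂'⟩
  | .builtin b h => by
    obtain ⟨le, l, h, h'⟩ := h.settles hB
    exact ⟨by gcongr, _, .builtin hB b h, .builtin hB b h'⟩
  | .call h₁ h₂ => by
    obtain ⟨le₁, l₁, h₁, h₁'⟩ := h₁.settles hB
    obtain ⟨le₂, l₂, h₂, h₂'⟩ := h₂.settles hB
    exact ⟨by gcongr, _, .call h₁ h₂, .call h₁' h₂'⟩
  | .ite h₁ h₂ h₃ => by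
    obtain ⟨le₁, l₁, h₁, h₁'⟩ := h₁.settles hB
    obtain ⟨le₂, l₂, h₂, h₂'⟩ := h₂.settles hB
    obtain ⟨le₃, l₃, h₃, h₃'⟩ := h₃.settles hB
    exact ⟨by gcongr, _, h₁.ite h₂ h₃, h₁'.ite h₂' h₃'⟩
  | .nbr h => by
    obtain ⟨le, l, h, h'⟩ := h.settles hB
    exact ⟨by gcongr, _, h.nbr, h'.nbr⟩
  | .converging f X m hf hwf h hx hx' _ _ => by
    obtain ⟨le, l, h, h'⟩ := h.settles hB
    refine ⟨?_, l, ?_, ?_⟩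
    · gcongr
      exact le_mul_of_one_le_left (zero_le) one_le_two
    · exact_mod_cast h.converging hf hwf one_le_two (.rep _ _ _) hx
    · simpa using h'.converging hf hwf le_rfl (.share _ _ _) hx'
  | .acyclic f P hf hp h hss hxp hxp' hxs hxs' hxss hxss' _ => by
    obtain ⟨lep, lp, hp, hp'⟩ := hp.settles hB
    obtain ⟨le, l, h, h'⟩ := h.settles hB
    obtain ⟨lel, ls, hss, hss'⟩ := hss.settles hB
    obtain ⟨F, hF⟩ := hf
    obtain ⟨g, hg⟩ := exists_acyclic_limit F P lp l ls
    refine ⟨?_, fun G ρl δ => .loc (g G ρl δ), ?_, ?_⟩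
    · gcongr
      exact le_mul_of_one_le_left (zero_le) one_le_two
    · exact_mod_cast Settles.acyclic hF hB one_le_two (.rep _ _ _) hxp hxs hxss hp h hss hg
    · simpa using Settles.acyclic hF hB le_rfl (.share _ _ _) hxp' hxs' hxss' hp' h' hss' hg
  | .minimising fR fMP P tri F hP htri hMP _ hF hfR h hss hxs hxs' hxss hxss' _ _ => by
    obtain ⟨le, l, h, h'⟩ := h.settles hB
    obtain ⟨lel, ls, hss, hss'⟩ := hss.settles hB
    obtain ⟨g, hg⟩ := exists_minimising_limit hP hF l ls
    refine ⟨?_, fun G ρl δ => .loc (g G ρl δ), ?_, ?_⟩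
    · gcongr
      · exact le_mul_of_one_le_left (zero_le) one_le_two
      · exact one_le_two
    · rw [add_assoc]
      exact_mod_cast Settles.minimising hP htri hMP hF hfR one_le_two (.rep _ _ _) hxs hxss h hss hg
    · rw [add_assoc]
      simpa using Settles.minimising hP htri hMP hF hfR le_rfl (.share _ _ _) hxs' hxss' h' hss' hg

theorem FragmentList.settles
    {lim : B → NetGraph Dev → (Dev → List (Value Dev K)) → Dev → Value Dev K}
    {settle : B → ℕ∞} (hB : ∀ b, SelfStabilising I Adm b (lim b) (settle b))
    {ss ss' : List (Expr Dev K B)} {nr ns : ℕ∞} : FragmentList I Adm settle N ss ss' nr ns →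
      ns ≤ nr ∧ ∃ ls, SettlesList I Adm N ss nr ls ∧ SettlesList I Adm N ss' ns ls
  | .nil => ⟨le_rfl, _, .nil, .nil⟩
  | .cons h hs => by
    obtain ⟨le, l, h, h'⟩ := h.settles hB
    obtain ⟨les, ls, hs, hs'⟩ := hs.settles hB
    exact ⟨by gcongr, _, .cons h hs, .cons h' hs'⟩

end

/-! ### Evolutions -/

theorem Step.comp_inv {e : Expr Dev K B} {n : ℕ} {N N' : Config Dev K S} {δ : Dev}
    {Θ : Inbox Dev K} (h : Step I e n N (.comp δ Θ) N') :
    ∃ Θ₀ t σ, N.status δ = some Θ₀ ∧ (∀ δ', Θ δ' = Θ₀ δ' ∨ Θ δ' = none) ∧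
      N'.status δ = some (Function.update Θ δ (some ⟨n, t⟩)) ∧ N.sensors δ = some σ ∧
      Eval I δ Θ.trees σ e t := by
  cases h with
  | comp h1 h2 h3 h4 h5 => exact ⟨_, _, _, h2, h3, by simp, h4, h5⟩

theorem Step.inbox {e : Expr Dev K B} {n : ℕ} {N N' : Config Dev K S} {a : Act Dev K}
    (h : Step I e n N a N') {δ δ' : Dev} {Θ : Inbox Dev K} {m : Msg Dev K}
    (hΘ : N'.status δ = some Θ) (hm : Θ δ' = some m) :
    (∃ δ₀ Θ₀, N.status δ₀ = some Θ₀ ∧ Θ₀ δ' = some m) ∨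
      ∃ Θ₁, a = .comp δ' Θ₁ ∧ m.stamp = n ∧
        N'.status δ' = some (Function.update Θ₁ δ' (some m)) := by
  cases h with
  | @comp δc Θ₀ Θ₁ σ t h1 h2 h3 h4 h5 =>
    dsimp only at hΘ ⊢
    by_cases hδ : δ = δc
    · subst hδ
      rw [Function.update_self, Option.some_inj] at hΘ
      subst hΘ
      by_cases hδ' : δ' = δ
      · subst hδ'
        rw [Function.update_self, Option.some_inj] at hm
        subst hm
        exact Or.inr ⟨Θ₁, rfl, rfl, by simp⟩
      · rw [Function.update_of_ne hδ'] at hm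
        rcases h3 δ' with h | h
        · exact Or.inl ⟨δ, Θ₀, h2, h ▸ hm⟩
        · rw [hm] at h; cases h
    · rw [Function.update_of_ne hδ] at hΘ
      exact Or.inl ⟨δ, Θ, hΘ, hm⟩
  | @send δs X Θs ms h1 h2 h3 h4 =>
    dsimp only at hΘ
    split_ifs at hΘ
    · rw [Option.map_eq_some_iff] at hΘ
      obtain ⟨Θ', h5, rfl⟩ := hΘ
      by_cases hδ' : δ' = δs
      · subst hδ'
        rw [Function.update_self] at hm
        exact Or.inl ⟨δ', Θs, h3, h4.trans hm⟩
      · rw [Function.update_of_ne hδ'] at hm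
        exact Or.inl ⟨δ, Θ', h5, hm⟩
    · exact Or.inl ⟨δ, Θ, hΘ, hm⟩
  | env h1 =>
    dsimp only at hΘ
    split_ifs at hΘ
    cases hst : N.status δ with
    | none =>
      rw [hst, Option.some_inj] at hΘ
      subst hΘ
      cases hm
    | some Θ₀ =>
      rw [hst, Option.some_inj] at hΘ
      subst hΘ
      exact Or.inl ⟨δ, Θ₀, hst, hm⟩

namespace Evolution

variable {e : Expr Dev K B} (R : Evolution I e)

theorem exists_tree (ε : R.events.Ev) : ∃ t σ,
    (R.conf (ε.1.1 + 1)).status ε.1.2.1 =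
      some (Function.update ε.1.2.2 ε.1.2.1 (some ⟨ε.1.1, t⟩)) ∧
    R.Reads ε σ ∧ Eval I ε.1.2.1 ε.1.2.2.trees σ e t := by
  have h := R.step ε.1.1
  rw [ε.2] at h
  obtain ⟨Θ₀, t, σ, -, -, h1, h2, h3⟩ := h.comp_inv
  exact ⟨t, σ, h1, h2, h3⟩

/-- The value-tree computed by a firing. -/
def treeOf (ε : R.events.Ev) : VTree Dev K := (R.exists_tree ε).choose

/-- The sensor state read by a firing. -/
def sensorOf (ε : R.events.Ev) : S := (R.exists_tree ε).choose_spec.choose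

theorem status_treeOf (ε : R.events.Ev) : (R.conf (ε.1.1 + 1)).status ε.1.2.1 =
    some (Function.update ε.1.2.2 ε.1.2.1 (some ⟨ε.1.1, R.treeOf ε⟩)) :=
  (R.exists_tree ε).choose_spec.choose_spec.1

theorem reads_sensorOf (ε : R.events.Ev) : R.Reads ε (R.sensorOf ε) :=
  (R.exists_tree ε).choose_spec.choose_spec.2.1

theorem eval_treeOf (ε : R.events.Ev) :
    Eval I ε.1.2.1 ε.1.2.2.trees (R.sensorOf ε) e (R.treeOf ε) :=
  (R.exists_tree ε).choose_spec.choose_spec.2.2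

theorem hasValue_iff {ε : R.events.Ev} {v : Value Dev K} :
    R.HasValue ε v ↔ (R.treeOf ε).root = v := by
  unfold HasValue
  rw [R.status_treeOf ε]
  constructor
  · rintro ⟨Θ, m, h1, h2, h3⟩
    cases h1
    rw [Function.update_self, Option.some_inj] at h2
    subst h2
    exact h3
  · intro h
    exact ⟨_, _, rfl, Function.update_self .., h⟩

/-- Every message kept by a device carries the tree computed by the firing that it is tagged
with. -/
theorem exists_event_of_status (n : ℕ) {δ δ' : Dev} {Θ : Inbox Dev K} {m : Msg Dev K}
    (hΘ : (R.conf n).status δ = some Θ) (hm : Θ δ' = some m) :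
    ∃ ε : R.events.Ev, R.events.dev ε = δ' ∧ ε.1.1 = m.stamp ∧ R.treeOf ε = m.tree := by
  induction n generalizing δ Θ with
  | zero => rw [R.start] at hΘ; cases hΘ
  | succ n ih =>
    rcases (R.step n).inbox hΘ hm with ⟨δ₀, Θ₀, h1, h2⟩ | ⟨Θ₁, h1, rfl, h2⟩
    · exact ih h1 h2
    · let ε : R.events.Ev := ⟨(m.stamp, δ', Θ₁), h1⟩
      refine ⟨ε, rfl, rfl, ?_⟩
      have h3 := (R.status_treeOf ε).symm.trans h2
      have h4 := congrFun (Option.some.inj h3) δ'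
      rw [Function.update_self, Function.update_self, Option.some_inj] at h4
      rw [← h4]

theorem trees_eq_envOf (hE : R.events.IsAugmented) (ε : R.events.Ev) :
    ε.1.2.2.trees = envOf R.events Set.univ R.treeOf ε := by
  funext δ'
  unfold Inbox.trees envOf
  cases hm : ε.1.2.2 δ' with
  | none =>
    have : R.events.pred Set.univ ε δ' = none := by
      rw [← Option.not_isSome_iff_eq_none, EventStr.pred_isSome]
      rintro ⟨q, -, ⟨m, h1, -⟩, rfl⟩
      have h2 := hm.symm.trans h1
      cases h2
    rw [this]; rfl
  | some m =>
    have h := R.step ε.1.1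
    rw [ε.2] at h
    obtain ⟨Θ₀, -, -, h1, h2, -⟩ := h.comp_inv
    have h3 : Θ₀ δ' = some m := by
      rcases h2 δ' with h | h
      · rw [← h, hm]
      · rw [hm] at h; cases h
    obtain ⟨q, rfl, h4, h5⟩ := R.exists_event_of_status _ h1 h3
    have hp : R.events.pred Set.univ ε (R.events.dev q) = some q :=
      hE.pred_eq.2 ⟨Set.mem_univ _, ⟨m, hm, h4.symm⟩, rfl⟩
    rw [hp, Option.map_some, Option.map_some, h5]

theorem isRun (hE : R.events.IsAugmented) :
    IsRun I R.events Set.univ R.sensorOf (fun _ => e.subst fun _ => none) R.treeOf := by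
  intro ε _
  rw [Expr.subst_empty, ← R.trees_eq_envOf hE]
  exact R.eval_treeOf ε

end Evolution

theorem EventStr.agreesIn_univ {E : EventStr Dev} {G : NetGraph Dev} {ε : E.Ev} :
    E.AgreesIn Set.univ G ε ↔ E.Agrees G ε := by
  unfold AgreesIn Agrees
  refine and_congr Iff.rfl ?_
  rw [Set.ext_iff]
  refine forall_congr' fun δ => iff_congr ?_ Iff.rfl
  rw [pred_isSome]
  simp

theorem EventStr.HasLimit.limitIn_univ {E : EventStr Dev} {G : NetGraph Dev} (h : E.HasLimit G) :
    E.LimitIn Set.univ G := by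
  obtain ⟨h1, h2, h3⟩ := h
  refine ⟨Set.infinite_univ_iff.2 h1, fun δ => ?_, ?_⟩
  · simpa using h2 δ
  · simpa [agreesIn_univ] using h3

/-- In an evolution, an expression that settles has its limit value in the sense of evolutions. -/
theorem Settles.reach {e : Expr Dev K B} {n : ℕ∞} {l : Lim Dev K} {G : NetGraph Dev}
    (h : Settles I Adm G.devs.card e n l) (R : Evolution I e) (hR : R.Follows Adm G) :
    R.events.Reach Set.univ n (R.transient Adm G)ᶜ
      {ε | R.HasValue ε (l G (fun _ _ => none) (R.events.dev ε))} := by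
  obtain ⟨haug, hlim, hfin⟩ := hR
  have hgood : (R.transient Adm G)ᶜ ⊆ good R.events Set.univ Adm G R.sensorOf
      (fun _ _ => none : R.events.Ev → Assign Dev K) (fun _ _ => none) := by
    intro ε hε
    obtain ⟨h1, h2⟩ := not_not.1 hε
    exact ⟨Set.mem_univ _, EventStr.agreesIn_univ.2 h1, h2 _ (R.reads_sensorOf ε), rfl⟩
  have hS : Setting Adm G.devs.card R.events Set.univ G R.sensorOf
      (fun _ _ => none : R.events.Ev → Assign Dev K) (fun _ _ => none) :=
    ⟨haug, hlim.limitIn_univ, le_rfl, hfin.subset fun ε hε => by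
      by_contra hn; exact hε.2 (hgood hn)⟩
  have hreach := h _ _ _ _ _ _ _ hS (R.isRun haug)
  have hset : {ε | R.HasValue ε (l G (fun _ _ => none) (R.events.dev ε))} =
      {ε ∈ Set.univ | (R.treeOf ε).root = l G (fun _ _ => none) (R.events.dev ε)} := by
    ext ε
    simp [R.hasValue_iff]
  rw [hset]
  exact ⟨hreach.subset, hreach.finite, fun k hk =>
    (R.events.iterate_inner_mono _ k hgood).trans (hreach.within k hk)⟩

theorem Settles.stabilising {e : Expr Dev K B} {n : ℕ∞} {l : Lim Dev K} {G : NetGraph Dev}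
    (h : Settles I Adm G.devs.card e n l) :
    Stabilising I Adm e G (l G fun _ _ => none) := fun R hR =>
  (h.reach R hR).finite.subset fun _ hε => ⟨Set.mem_univ _, hε⟩

theorem Settles.stabilisingWithin {e : Expr Dev K B} {n : ℕ∞} {l : Lim Dev K} {G : NetGraph Dev}
    (h : Settles I Adm G.devs.card e n l) :
    StabilisingWithin I Adm e G (l G fun _ _ => none) n := by
  intro R hR ε hε
  have hn : n ≠ ⊤ := fun hn => by rw [hn] at hε; exact not_top_lt hε
  lift n to ℕ using hn
  refine (h.reach R hR).within n le_rfl (R.events.iterate_inner_mono _ n ?_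
    (EventStr.iterate_of_lt_round hε))
  exact Set.compl_subset_compl.2 fun ε hε => ⟨ε, hε, Or.inl rfl⟩

end

end FieldCalculus

theorem mainTheorem5 {Dev K S B : Type}
    (I : FieldCalculus.Interp Dev K S B) (Adm : Dev → Set S)
    (lim : B → FieldCalculus.NetGraph Dev → (Dev → List (FieldCalculus.Value Dev K)) →
      Dev → FieldCalculus.Value Dev K)
    (settle : B → ℕ∞)
    (hB : ∀ b, FieldCalculus.SelfStabilising I Adm b (lim b) (settle b))
    (G : FieldCalculus.NetGraph Dev) (s s' : FieldCalculus.Expr Dev K B) (nr ns : ℕ∞)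
    (hs : FieldCalculus.Fragment I Adm settle G.devs.card s s' nr ns)
    (hclosed : s.fv = ∅) :
    ns ≤ nr ∧
    ∃ g : Dev → FieldCalculus.Value Dev K,
      FieldCalculus.Stabilising I Adm s G g ∧ FieldCalculus.Stabilising I Adm s' G g ∧
      FieldCalculus.StabilisingWithin I Adm s G g nr ∧
      FieldCalculus.StabilisingWithin I Adm s' G g ns := by
  obtain ⟨hle, l, h, h'⟩ := hs.settles hB
  exact ⟨hle, _, h.stabilising, h'.stabilising, h.stabilisingWithin, h'.stabilisingWithin⟩
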